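/- Let $s\ge 1$ and $q$ be coprime integers, let $p$ be a prime, and let $L(s,q)$ be the lens space $S^3/\!\sim$, where $S^3\subset\mathbb{C}^2$ and $(z,w)\sim(\zeta z,\zeta^q w)$ for every $\zeta$ with $\zeta^s=1$. Let $M=L(s,q)\mathbin{\#}L(s,q)$ be a connected sum: for open embeddings $e_1,e_2:\mathbb{R}^3\to L(s,q)$, remove the image of the open unit ball under $e_i$ from the $i$-th copy of $L(s,q)$ and identify $e_1(x)$ with $e_2(x)$ for $|x|=1$. (Any choice of $e_1,e_2$ is allowed, so the oriented connected sum is included.) Identify $H_1(M)$ with $H_1(L(s,q))\oplus H_1(L(s,q))$ through the inclusions of the punctured copies of $L(s,q)$ in $L(s,q)$ and in $M$; homology has integer coefficients. Let $\rho: H_1(L(s,q))\oplus H_1(L(s,q))\to\mathbb{Z}_p=\mathbb{Z}/p\mathbb{Z}$ be a surjective homomorphism, and let $\widetilde M\to M$ be the associated $p$-fold cover, that is, the connected cover whose fundamental group is the kernel of $\pi_1(M)\to H_1(M)\xrightarrow{\rho}\mathbb{Z}_p$. Let $\beta_1(\widetilde M)$ be the rank of $H_1(\widetilde M)$. 1.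 If $\rho$ is nontrivial on both summands, then $\beta_1(\widetilde M)=p-1$. 2. If $\rho$ is trivial on one of the two summands, then $\beta_1(\widetilde M)=0$. -/

import Mathlib

noncomputable section

namespace LensCover

/-- The first singular homology group `H₁(X; ℤ)`. -/
abbrev H1 (X : Type) [TopologicalSpace X] : ModuleCat.{0} ℤ :=
  ((AlgebraicTopology.singularHomologyFunctor (ModuleCat.{0} ℤ) 1).obj
    (ModuleCat.of ℤ ℤ)).obj (TopCat.of X)

/-- The homomorphism `f_* : H₁(X; ℤ) → H₁(Y; ℤ)` induced by a continuous map `f`. -/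
def H1map {X Y : Type} [TopologicalSpace X] [TopologicalSpace Y] (f : C(X, Y)) :
    H1 X →ₗ[ℤ] H1 Y :=
  (((AlgebraicTopology.singularHomologyFunctor (ModuleCat.{0} ℤ) 1).obj
    (ModuleCat.of ℤ ℤ)).map (TopCat.ofHom f)).hom

/-- The first Betti number `β₁(X)`: the rank of `H₁(X; ℤ)`, as a cardinal. -/
def betti1 (X : Type) [TopologicalSpace X] : Cardinal.{0} :=
  Module.rank ℤ (H1 X)

/-- The unit sphere `S³` in `ℂ²`. -/
abbrev S3 : Type := Metric.sphere (0 : EuclideanSpace ℂ (Fin 2)) 1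

/-- The orbit relation on `S³` of the action `ζ • (z, w) = (ζ z, ζ ^ q w)` of the group of
`s`-th roots of unity. -/
def lensSetoid (s : ℕ) (q : ℤ) : Setoid S3 where
  r x y := ∃ ζ : ℂˣ, ζ ^ s = 1 ∧
    y.1 0 = (ζ : ℂ) * x.1 0 ∧ y.1 1 = ((ζ ^ q : ℂˣ) : ℂ) * x.1 1
  iseqv := by
    refine ⟨fun x => ⟨1, by simp⟩, ?_, ?_⟩
    · rintro x y ⟨ζ, hζ, h0, h1⟩
      refine ⟨ζ⁻¹, by simp [hζ], ?_, ?_⟩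
      · rw [h0, Units.inv_mul_cancel_left]
      · rw [h1, inv_zpow, Units.inv_mul_cancel_left]
    · rintro x y z ⟨ζ, hζ, h0, h1⟩ ⟨ξ, hξ, k0, k1⟩
      refine ⟨ξ * ζ, by simp [mul_pow, hζ, hξ], ?_, ?_⟩
      · rw [k0, h0, Units.val_mul, mul_assoc]
      · rw [k1, h1, mul_zpow, Units.val_mul, mul_assoc]

/-- The lens space `L(s, q)` with the quotient topology. -/
abbrev LensSpace (s : ℕ) (q : ℤ) : Type := Quotient (lensSetoid s q)

/-- Euclidean three-space. -/
abbrev E3 : Type := EuclideanSpace ℝ (Fin 3)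

/-- `X` with the image under `e` of the open unit ball removed. -/
abbrev Punctured {X : Type} (e : E3 → X) : Type :=
  ((e '' Metric.ball (0 : E3) 1)ᶜ : Set X)

/-- The inclusion of the punctured space in the whole space. -/
def puncturedIncl {X : Type} [TopologicalSpace X] (e : E3 → X) : C(Punctured e, X) :=
  ⟨Subtype.val, continuous_subtype_val⟩

/-- The identification of the two boundary spheres: `e₁ x` is glued to `e₂ x` for `‖x‖ = 1`. -/
def glueRel {X Y : Type} (e₁ : E3 → X) (e₂ : E3 → Y) :
    Punctured e₁ ⊕ Punctured e₂ → Punctured e₁ ⊕ Punctured e₂ → Prop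
  | .inl a, .inr b => ∃ x ∈ Metric.sphere (0 : E3) 1, a.1 = e₁ x ∧ b.1 = e₂ x
  | _, _ => False

/-- The connected sum `X # Y` formed along the balls parametrized by `e₁` and `e₂` (meant for
open embeddings of `ℝ³` in 3-manifolds). In the oriented case `e₁` preserves and `e₂` reverses
orientation; every gluing homeomorphism of the boundary spheres arises from some choice of `e₂`. -/
abbrev ConnSum {X Y : Type} [TopologicalSpace X] [TopologicalSpace Y]
    (e₁ : E3 → X) (e₂ : E3 → Y) : Type :=
  Quot (glueRel e₁ e₂)

/-- The map of the punctured first space to the connected sum. -/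
def ConnSum.fromLeft {X Y : Type} [TopologicalSpace X] [TopologicalSpace Y]
    (e₁ : E3 → X) (e₂ : E3 → Y) : C(Punctured e₁, ConnSum e₁ e₂) :=
  ⟨fun a => Quot.mk _ (Sum.inl a), continuous_quot_mk.comp continuous_inl⟩

/-- The map of the punctured second space to the connected sum. -/
def ConnSum.fromRight {X Y : Type} [TopologicalSpace X] [TopologicalSpace Y]
    (e₁ : E3 → X) (e₂ : E3 → Y) : C(Punctured e₂, ConnSum e₁ e₂) :=
  ⟨fun b => Quot.mk _ (Sum.inr b), continuous_quot_mk.comp continuous_inr⟩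

/-- `ρ' : H₁(X # Y) → A` is the character that corresponds to `ρ : H₁(X) ⊕ H₁(Y) → A` under the
canonical isomorphism `H₁(X) ⊕ H₁(Y) ≅ H₁(X # Y)`, which is given by the inclusions
`X ← X \ ball → X # Y` and `Y ← Y \ ball → X # Y`. -/
def IsCharacterOnConnSum {X Y : Type} [TopologicalSpace X] [TopologicalSpace Y]
    (e₁ : E3 → X) (e₂ : E3 → Y) {A : Type} [AddCommGroup A]
    (ρ : H1 X × H1 Y →+ A) (ρ' : H1 (ConnSum e₁ e₂) →+ A) : Prop :=
  (∀ u : H1 (Punctured e₁),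
    ρ' (H1map (ConnSum.fromLeft e₁ e₂) u) = ρ (H1map (puncturedIncl e₁) u, 0)) ∧
  (∀ v : H1 (Punctured e₂),
    ρ' (H1map (ConnSum.fromRight e₁ e₂) v) = ρ (0, H1map (puncturedIncl e₂) v))

/-- `π : E → M` is the connected covering associated to `ρ : H₁(M) → A`, that is, the one whose
fundamental group is the kernel of `π₁(M) → H₁(M) → A`: a loop `γ` in `M` lifts to a closed loop
in `E`, starting at a given point over `γ 1`, if and only if `ρ` vanishes on the class of `γ`,
i.e. on the image of `γ_* : H₁(S¹) → H₁(M)`. -/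
structure IsAssociatedCovering {E M : Type} [TopologicalSpace E] [TopologicalSpace M]
    {A : Type} [AddCommGroup A] (ρ : H1 M →+ A) (π : C(E, M)) : Prop where
  isCoveringMap : IsCoveringMap π
  pathConnected : PathConnectedSpace E
  lifts_iff : ∀ (γ : C(Circle, M)) (x : E), π x = γ 1 →
    ((∃ γ' : C(Circle, E), π.comp γ' = γ ∧ γ' 1 = x) ↔ ∀ c : H1 Circle, ρ (H1map γ c) = 0)

end LensCover

end

/-! Split the cover as `E = P ∪ Q`, where `P` and `Q` lie over the two punctured lens spaces and `P
∩ Q` lies over the gluing sphere. The sphere carries no first cohomology, so `P ∩ Q` is `p` disjoint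
copies of it. Rationally `H¹(P) = H¹(Q) = 0`: pulled back to `S³` minus the lifted balls, `P`
becomes `p` copies of that simply punctured sphere, which has no first cohomology, and averaging
over the `s`-th roots of unity brings primitives back down to `P`. By Mayer–Vietoris `H¹(E; ℚ)` is
therefore the cokernel of `H⁰(P) ⊕ H⁰(Q) → H⁰(P ∩ Q) = ℚ^p`. If `ρ` is nontrivial on both summands,
`P` and `Q` are connected, the image is the line of constants, and the dimension is `p - 1`. If `ρ`
is trivial on one summand, the cover splits over that side into `p` sheets with one sphere each, so
the restriction is onto and the cokernel vanishes.

First cohomology is handled by local difference cocycles `d x z`, taken modulo those of the form `G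
z - G x`. On path connected, strongly locally contractible spaces they compute `Hom(H₁, A)`:
`exists_charOf_eq` gives surjectivity and `exists_primitive_of_charOf_eq_zero` gives injectivity.
The rank of `H₁(E)` is read off from `Hom(H₁(E), ℚ)` by `rank_eq_finrank_hom`. The character of the
cover is represented by a cocycle `r`; a primitive of its pullback to `E` is a function `θ` that
labels the sheets (`Labelling`). The transfer is `acyclicOn_preimage_of_finite_cover`, the
connectedness of the sides is `Labelling.isPreconnected_preimage`, and the two Mayer–Vietoris counts
are `betti1_eq_of_isPreconnected` and `betti1_eq_zero_of_locConstOn`. -/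

open Set Filter Topology

/-! ### Local difference cocycles -/

section Cocycle

variable {X Y A : Type*} [TopologicalSpace X] [TopologicalSpace Y] [AddCommGroup A]

/-- `d` is a cocycle on `P` if `d x z = d x y + d y z` for `x ∈ P`, for `y ∈ P` near `x` and
`z ∈ P` near `y`. Modulo the cocycles with a primitive these compute the first cohomology of `P`
with constant coefficients. -/
def CocycleOn (P : Set X) (d : X → X → A) : Prop :=
  ∀ x ∈ P, ∀ᶠ y in 𝓝[P] x, ∀ᶠ z in 𝓝[P] y, d x z = d x y + d y z

/-- `G` is a primitive of `d` on `P`. -/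
def PrimitiveOn (P : Set X) (d : X → X → A) (G : X → A) : Prop :=
  ∀ x ∈ P, ∀ᶠ z in 𝓝[P] x, d x z = G z - G x

/-- Every cocycle on `P` has a primitive. -/
def AcyclicOn (A : Type*) [AddCommGroup A] (P : Set X) : Prop :=
  ∀ d : X → X → A, CocycleOn P d → ∃ G, PrimitiveOn P d G

/-- `u` is locally constant on `P`. -/
def LocConstOn {B : Type*} (P : Set X) (u : X → B) : Prop :=
  ∀ x ∈ P, ∀ᶠ z in 𝓝[P] x, u z = u x

/-- The pullback of a difference function along a map. -/
def pullDiff {X Y A : Type*} (h : Y → X) (d : X → X → A) : Y → Y → A := fun y z => d (h y) (h z)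

theorem CocycleOn.diag {P : Set X} {d : X → X → A} (hd : CocycleOn P d) {x : X} (hx : x ∈ P) :
    d x x = 0 := by
  have h1 := (hd x hx).self_of_nhdsWithin hx
  obtain h2 := h1.self_of_nhdsWithin hx
  simpa using h2

theorem tendsto_within {P : Set X} {Q : Set Y} {h : Y → X} (hc : ContinuousOn h Q)
    (hm : MapsTo h Q P) {y : Y} (hy : y ∈ Q) : Tendsto h (𝓝[Q] y) (𝓝[P] (h y)) :=
  (hc y hy).tendsto_nhdsWithin hm

theorem CocycleOn.pull {P : Set X} {Q : Set Y} {d : X → X → A} (hd : CocycleOn P d) {h : Y → X}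
    (hc : ContinuousOn h Q) (hm : MapsTo h Q P) : CocycleOn Q (pullDiff h d) := by
  intro x hx
  have h1 := (tendsto_within hc hm hx).eventually (hd _ (hm hx))
  filter_upwards [h1, self_mem_nhdsWithin] with y hy hyQ
  exact (tendsto_within hc hm hyQ).eventually hy

theorem PrimitiveOn.pull {P : Set X} {Q : Set Y} {d : X → X → A} {G : X → A}
    (hd : PrimitiveOn P d G) {h : Y → X}
    (hc : ContinuousOn h Q) (hm : MapsTo h Q P) : PrimitiveOn Q (pullDiff h d) (G ∘ h) := by
  intro x hx
  exact (tendsto_within hc hm hx).eventually (hd _ (hm hx))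

theorem LocConstOn.pull {B : Type*} {P : Set X} {Q : Set Y} {u : X → B}
    (hd : LocConstOn P u) {h : Y → X}
    (hc : ContinuousOn h Q) (hm : MapsTo h Q P) : LocConstOn Q (u ∘ h) := by
  intro x hx
  exact (tendsto_within hc hm hx).eventually (hd _ (hm hx))

theorem CocycleOn.mono {P Q : Set X} {d : X → X → A} (hd : CocycleOn P d) (h : Q ⊆ P) :
    CocycleOn Q d := hd.pull (h := id) continuousOn_id h

theorem PrimitiveOn.mono {P Q : Set X} {d : X → X → A} {G : X → A} (hd : PrimitiveOn P d G)
    (h : Q ⊆ P) : PrimitiveOn Q d G := hd.pull (h := id) continuousOn_id h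

theorem LocConstOn.mono {B : Type*} {P Q : Set X} {u : X → B} (hd : LocConstOn P u)
    (h : Q ⊆ P) : LocConstOn Q u := hd.pull (h := id) continuousOn_id h

theorem LocConstOn.comp_left {B C : Type*} {P : Set X} {u : X → B} (hu : LocConstOn P u)
    (f : B → C) : LocConstOn P (fun x => f (u x)) := fun x hx => by
  filter_upwards [hu x hx] with z hz
  rw [hz]

theorem LocConstOn.continuousOn {B : Type*} [TopologicalSpace B] {P : Set X} {u : X → B}
    (hu : LocConstOn P u) : ContinuousOn u P := fun x hx =>
  (tendsto_congr' (hu x hx)).2 tendsto_const_nhds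

theorem LocConstOn.eq_of_isPreconnected {B : Type*} {P : Set X} {u : X → B}
    (hu : LocConstOn P u) (hP : IsPreconnected P) {x y : X} (hx : x ∈ P) (hy : y ∈ P) :
    u x = u y := by
  let _ : TopologicalSpace B := ⊥
  have : DiscreteTopology B := ⟨rfl⟩
  exact hP.constant hu.continuousOn hx hy

theorem PrimitiveOn.cocycleOn {P : Set X} {d : X → X → A} {G : X → A} (h : PrimitiveOn P d G) :
    CocycleOn P d := by
  intro x hx
  have h1 : ∀ᶠ y in 𝓝[P] x, ∀ᶠ z in 𝓝[P] y, d x z = G z - G x :=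
    eventually_eventually_nhdsWithin.2 (h x hx)
  filter_upwards [h1, self_mem_nhdsWithin] with y hy hyP
  filter_upwards [hy, h y hyP] with z hz hz'
  rw [hz, hz', hy.self_of_nhdsWithin hyP]
  abel

theorem PrimitiveOn.sub_locConstOn {P : Set X} {d : X → X → A} {G K : X → A}
    (hG : PrimitiveOn P d G) (hK : PrimitiveOn P d K) : LocConstOn P (fun x => G x - K x) := by
  intro x hx
  filter_upwards [hG x hx, hK x hx] with z hz hz'
  rw [hz] at hz'
  rw [sub_eq_sub_iff_add_eq_add] at hz' ⊢
  rw [hz', add_comm]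

theorem PrimitiveOn.add_locConstOn {P : Set X} {d : X → X → A} {G u : X → A}
    (hG : PrimitiveOn P d G) (hu : LocConstOn P u) : PrimitiveOn P d (fun x => G x + u x) := by
  intro x hx
  filter_upwards [hG x hx, hu x hx] with z hz hz'
  rw [hz, hz']; abel

theorem PrimitiveOn.congr {P : Set X} {d : X → X → A} {G K : X → A}
    (hG : PrimitiveOn P d G) (h : EqOn G K P) : PrimitiveOn P d K := by
  intro x hx
  filter_upwards [hG x hx, self_mem_nhdsWithin] with z hz hzP
  rw [hz, h hzP, h hx]

theorem PrimitiveOn.congr_diff {P : Set X} {d d' : X → X → A} {G : X → A}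
    (hG : PrimitiveOn P d G) (h : ∀ x ∈ P, ∀ᶠ z in 𝓝[P] x, d x z = d' x z) :
    PrimitiveOn P d' G := by
  intro x hx
  filter_upwards [hG x hx, h x hx] with z hz hz'
  rw [← hz', hz]

theorem PrimitiveOn.add {P : Set X} {d d' : X → X → A} {G G' : X → A}
    (hG : PrimitiveOn P d G) (hG' : PrimitiveOn P d' G') :
    PrimitiveOn P (fun x z => d x z + d' x z) (fun x => G x + G' x) := by
  intro x hx
  filter_upwards [hG x hx, hG' x hx] with z hz hz'
  rw [hz, hz']; abel

theorem PrimitiveOn.sub {P : Set X} {d d' : X → X → A} {G G' : X → A}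
    (hG : PrimitiveOn P d G) (hG' : PrimitiveOn P d' G') :
    PrimitiveOn P (fun x z => d x z - d' x z) (fun x => G x - G' x) := by
  intro x hx
  filter_upwards [hG x hx, hG' x hx] with z hz hz'
  rw [hz, hz']; abel

theorem CocycleOn.add {P : Set X} {d d' : X → X → A} (h : CocycleOn P d) (h' : CocycleOn P d') :
    CocycleOn P (fun x z => d x z + d' x z) := by
  intro x hx
  filter_upwards [h x hx, h' x hx] with y hy hy'
  filter_upwards [hy, hy'] with z hz hz'
  rw [hz, hz']; abel

theorem CocycleOn.sub {P : Set X} {d d' : X → X → A} (h : CocycleOn P d) (h' : CocycleOn P d') :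
    CocycleOn P (fun x z => d x z - d' x z) := by
  intro x hx
  filter_upwards [h x hx, h' x hx] with y hy hy'
  filter_upwards [hy, hy'] with z hz hz'
  rw [hz, hz']; abel

/-- Acyclicity passes to continuous retracts. -/
theorem AcyclicOn.of_retract {P : Set X} {Q : Set Y} (hQ : AcyclicOn A Q) {h : Y → X} {k : X → Y}
    (hc : ContinuousOn h Q) (hm : MapsTo h Q P) (kc : ContinuousOn k P) (km : MapsTo k P Q)
    (hk : ∀ x ∈ P, h (k x) = x) : AcyclicOn A P := by
  intro d hd
  obtain ⟨G, hG⟩ := hQ _ (hd.pull hc hm)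
  refine ⟨G ∘ k, (hG.pull kc km).congr_diff fun x hx => ?_⟩
  filter_upwards [self_mem_nhdsWithin] with z hz
  simp [pullDiff, hk x hx, hk z hz]

/-- Primitives on the two parts of a cover that agree on the intersection glue. -/
theorem PrimitiveOn.glue {P Q : Set X} (hPQ : P ∪ Q = univ) (hP : ∀ x ∉ Q, P ∈ 𝓝 x)
    (hQ : ∀ x ∉ P, Q ∈ 𝓝 x) {d : X → X → A} {G : X → A}
    (hG : PrimitiveOn P d G) (hK : PrimitiveOn Q d G) : PrimitiveOn univ d G := by
  intro x _
  rw [nhdsWithin_univ]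
  by_cases hxP : x ∈ P
  · by_cases hxQ : x ∈ Q
    · have := Filter.eventually_sup.2 ⟨hG x hxP, hK x hxQ⟩
      rwa [← nhdsWithin_union, hPQ, nhdsWithin_univ] at this
    · have := hG x hxP
      rwa [nhdsWithin_eq_nhds.2 (hP x hxQ)] at this
  · have hxQ : x ∈ Q := by
      have : x ∈ P ∪ Q := hPQ ▸ mem_univ x
      exact this.resolve_left hxP
    have := hK x hxQ
    rwa [nhdsWithin_eq_nhds.2 (hQ x hxP)] at this

/-- Two primitives of one cocycle differ by a locally constant function, hence by a constant on the
connected overlap; shifting one of them by it makes them agree. The neighbourhood hypotheses let the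
parts be open or closed. -/
theorem PrimitiveOn.exists_of_cover {P Q : Set X} (hPQ : P ∪ Q = univ) (hP : ∀ x ∉ Q, P ∈ 𝓝 x)
    (hQ : ∀ x ∉ P, Q ∈ 𝓝 x) (hconn : IsPreconnected (P ∩ Q)) {d : X → X → A} {G K : X → A}
    (hG : PrimitiveOn P d G) (hK : PrimitiveOn Q d K) : ∃ F, PrimitiveOn univ d F := by
  classical
  obtain ⟨c, hc⟩ : ∃ c, ∀ x ∈ P ∩ Q, G x - K x = c := by
    by_cases hne : (P ∩ Q).Nonempty
    · obtain ⟨x0, hx0⟩ := hne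
      refine ⟨G x0 - K x0, fun x hx => ?_⟩
      exact ((hG.mono inter_subset_left).sub_locConstOn
        (hK.mono inter_subset_right)).eq_of_isPreconnected hconn hx hx0
    · exact ⟨0, fun x hx => (hne ⟨x, hx⟩).elim⟩
  refine ⟨fun x => if x ∈ P then G x else K x + c, PrimitiveOn.glue hPQ hP hQ
    (hG.congr fun x hx => by simp [hx])
    ((hK.add_locConstOn (u := fun _ => c) fun x _ => by simp).congr fun x hx => ?_)⟩
  by_cases hxP : x ∈ P
  · simp [hxP, ← hc x ⟨hxP, hx⟩]
  · simp [hxP]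

theorem AcyclicOn.univ_of_cover {P Q : Set X} (hPQ : P ∪ Q = univ) (hP : ∀ x ∉ Q, P ∈ 𝓝 x)
    (hQ : ∀ x ∉ P, Q ∈ 𝓝 x) (hconn : IsPreconnected (P ∩ Q)) (h1 : AcyclicOn A P)
    (h2 : AcyclicOn A Q) : AcyclicOn A (univ : Set X) := by
  intro d hd
  obtain ⟨G, hG⟩ := h1 d (hd.mono (subset_univ _))
  obtain ⟨K, hK⟩ := h2 d (hd.mono (subset_univ _))
  exact PrimitiveOn.exists_of_cover hPQ hP hQ hconn hG hK

end Cocycle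

/-! ### Simply connected spaces are acyclic -/

section SimplyConnected

variable {X A : Type*} [TopologicalSpace X] [AddCommGroup A]

/-- The bundle with fibre `A` in which the primitives of `d` are the horizontal sections. -/
def cocycleBundle [TopologicalSpace A] [DiscreteTopology A] (d : X → X → A)
    (hd : CocycleOn univ d) : FiberBundleCore X X A where
  baseSet x := interior {y | ∀ᶠ z in 𝓝 y, d x z = d x y + d y z}
  isOpen_baseSet x := isOpen_interior
  indexAt x := x
  mem_baseSet_at x := by
    rw [mem_interior_iff_mem_nhds]
    have := hd x (mem_univ x)
    simp only [nhdsWithin_univ] at this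
    exact this
  -- In the chart of index `i` a primitive `G` has the coordinate `G x - d i x`, which is locally
  -- constant; this dictates the transition functions.
  coordChange i j x v := v + d i x - d j x
  coordChange_self i x _ v := by abel
  continuousOn_coordChange i j := by
    rintro ⟨y, v⟩ ⟨⟨hyi, hyj⟩, _⟩
    apply ContinuousAt.continuousWithinAt
    have hi := interior_subset hyi
    have hj := interior_subset hyj
    refine (continuousAt_const (y := v + d i y - d j y)).congr ?_
    have h1 : ∀ᶠ z in 𝓝 y, d i z - d j z = d i y - d j y := by
      filter_upwards [hi, hj] with z hz hz'
      rw [hz, hz']; abel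
    rw [nhds_prod_eq]
    have h2 : ∀ᶠ w in 𝓝 v, w = v := by simp
    filter_upwards [h1.prod_mk h2] with p hp
    rw [hp.2, add_sub_assoc, add_sub_assoc, hp.1]
  coordChange_comp i j k x _ v := by abel

/-- The bundle has discrete fibres, so it is a covering of a simply connected space. The identity
then lifts to a global section, and the fibre part of the section is a primitive. -/
theorem acyclicOn_univ [SimplyConnectedSpace X] [LocallyPathConnectedSpace X] :
    AcyclicOn A (univ : Set X) := by
  intro d hd
  let _ : TopologicalSpace A := ⊥
  have : DiscreteTopology A := ⟨rfl⟩
  let Z := cocycleBundle d hd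
  have cov : IsCoveringMap (Bundle.TotalSpace.proj : Z.TotalSpace → X) :=
    FiberBundle.isCoveringMap (F := A) (E := Z.Fiber)
  obtain ⟨x0⟩ : Nonempty X := inferInstance
  obtain ⟨s, ⟨-, hs⟩, -⟩ := cov.existsUnique_continuousMap_lifts (ContinuousMap.id X) x0
    (⟨x0, (0 : A)⟩ : Z.TotalSpace) rfl
  have hs' : ∀ x, (s x).proj = x := fun x => congrFun hs x
  let G : X → A := fun x => (s x).snd
  refine ⟨G, fun x _ => ?_⟩
  rw [nhdsWithin_univ]
  have hcont : ContinuousAt (fun y => (Z.localTriv x (s y)).2) x := by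
    refine ContinuousAt.snd ?_
    refine ContinuousAt.comp (g := Z.localTriv x) ?_ s.continuous.continuousAt
    refine (Z.localTriv x).toOpenPartialHomeomorph.continuousAt ?_
    show (s x).proj ∈ Z.baseSet x
    rw [hs' x]
    exact Z.mem_baseSet_at x
  have hval : ∀ y, (Z.localTriv x (s y)).2 = G y - d x y := by
    intro y
    show G y + d (s y).proj (s y).proj - d x (s y).proj = _
    rw [hs' y, hd.diag (mem_univ y), add_zero]
  simp only [hval] at hcont
  have := hcont.eventually (p := fun a => a = G x - d x x) (by simp [nhds_discrete])
  filter_upwards [this] with z hz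
  rw [hd.diag (mem_univ x), sub_zero] at hz
  rw [← hz]; abel

end SimplyConnected

/-! ### Acyclicity of spheres, from the complements of two antipodal points -/

section Sphere

variable {E A : Type*} [NormedAddCommGroup E] [InnerProductSpace ℝ E] [AddCommGroup A]

theorem acyclicOn_compl_singleton_sphere (v : Metric.sphere (0 : E) 1) :
    AcyclicOn A ({v}ᶜ : Set (Metric.sphere (0 : E) 1)) := by
  have hv : ‖(v : E)‖ = 1 := by simp
  let S := stereographic hv
  have hA : AcyclicOn A (univ : Set (ℝ ∙ (v : E))ᗮ) := acyclicOn_univ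
  refine hA.of_retract (h := S.symm) (k := S) S.continuousOn_symm ?_ S.continuousOn ?_ ?_
  · intro w _
    exact S.map_target (by simp [S])
  · intro w _; trivial
  · intro x hx
    exact S.left_inv hx

theorem one_lt_rank_orthogonal (h : 3 ≤ Module.finrank ℝ E) (v : E) :
    1 < Module.rank ℝ (ℝ ∙ v)ᗮ := by
  have : FiniteDimensional ℝ E := Module.finite_of_finrank_pos (by omega)
  rw [← Module.finrank_eq_rank]
  have h1 := (ℝ ∙ v).finrank_add_finrank_orthogonal
  have h2 : Module.finrank ℝ (ℝ ∙ v) ≤ 1 := by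
    simpa using finrank_span_le_card (R := ℝ) ({v} : Set E)
  have : 1 < Module.finrank ℝ (ℝ ∙ v)ᗮ := by omega
  exact_mod_cast this

theorem isPreconnected_compl_pair_sphere (h : 3 ≤ Module.finrank ℝ E)
    (v w : Metric.sphere (0 : E) 1) (hvw : w ≠ v) : IsPreconnected ({v}ᶜ ∩ {w}ᶜ : Set _) := by
  have hv : ‖(v : E)‖ = 1 := by simp
  let S := stereographic hv
  have h1 := (isConnected_compl_singleton_of_one_lt_rank (one_lt_rank_orthogonal h (v : E))
    (S w)).isPreconnected.image S.symm (S.continuousOn_symm.mono fun _ _ => by simp [S])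
  convert h1 using 1
  ext x
  constructor
  · rintro ⟨hx1, hx2⟩
    refine ⟨S x, fun hxw => hx2 ?_, S.left_inv hx1⟩
    exact S.injOn hx1 hvw hxw
  · rintro ⟨y, hy, rfl⟩
    refine ⟨S.map_target (by simp [S]), fun hyw => hy ?_⟩
    rw [mem_singleton_iff] at hyw ⊢
    rw [← hyw, S.right_inv (by simp [S])]

/-- Spheres of dimension at least two are acyclic. -/
theorem acyclicOn_sphere (h : 3 ≤ Module.finrank ℝ E) :
    AcyclicOn A (univ : Set (Metric.sphere (0 : E) 1)) := by
  have : FiniteDimensional ℝ E := Module.finite_of_finrank_pos (by omega)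
  have : Nontrivial E := Module.nontrivial_of_finrank_pos (R := ℝ) (by omega)
  obtain ⟨v⟩ : Nonempty (Metric.sphere (0 : E) 1) :=
    (NormedSpace.sphere_nonempty.2 zero_le_one).to_subtype
  have hvw : -v ≠ v := fun hv => by
    exact ne_neg_of_mem_unit_sphere ℝ v hv.symm
  refine AcyclicOn.univ_of_cover (P := {v}ᶜ) (Q := {-v}ᶜ) ?_ ?_ ?_
    (isPreconnected_compl_pair_sphere h v (-v) hvw)
    (acyclicOn_compl_singleton_sphere v) (acyclicOn_compl_singleton_sphere (-v))
  · rw [← compl_inter, compl_univ_iff, singleton_inter_eq_empty]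
    exact fun h => hvw h.symm
  · intro x hx
    refine isOpen_compl_singleton.mem_nhds ?_
    rw [notMem_compl_iff, mem_singleton_iff] at hx
    rw [hx]; exact hvw
  · intro x hx
    refine isOpen_compl_singleton.mem_nhds ?_
    rw [notMem_compl_iff, mem_singleton_iff] at hx
    rw [hx]; exact hvw.symm

end Sphere

namespace LensCover

open CategoryTheory Limits Simplicial

/-! ### Characters of `H₁` and singular `1`-cocycles -/

section Chains

variable {X Y A : Type} [TopologicalSpace X] [TopologicalSpace Y] [AddCommGroup A]

/-- The standard topological simplex. -/
abbrev Simplex (n : ℕ) : Type := stdSimplex ℝ (Fin (n + 1))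

/-- The `i`-th vertex of the standard simplex. -/
abbrev vtx {n : ℕ} (i : Fin (n + 1)) : Simplex n := stdSimplex.vertex (S := ℝ) i

/-- The `i`-th face inclusion of standard simplices. -/
noncomputable def faceIncl {n : ℕ} (i : Fin (n + 2)) : C(Simplex n, Simplex (n + 1)) :=
  ⟨stdSimplex.map i.succAbove, stdSimplex.continuous_map _⟩

/-- The singular chain complex. -/
noncomputable abbrev singChains (X : Type) [TopologicalSpace X] : ChainComplex (ModuleCat.{0} ℤ) ℕ :=
  (TopCat.toSSet.obj (TopCat.of X)).chainComplex (ModuleCat.of ℤ ℤ)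

/-- A continuous map from the standard simplex as an element of the singular set. -/
noncomputable def singSimplex {n : ℕ} (σ : C(Simplex n, X)) : (TopCat.toSSet.obj (TopCat.of X)) _⦋n⦌ :=
  (TopCat.toSSetObjEquiv (TopCat.of X) (Opposite.op ⦋n⦌)).symm σ

theorem singSimplex_surjective {n : ℕ} (x : (TopCat.toSSet.obj (TopCat.of X)) _⦋n⦌) :
    ∃ σ : C(Simplex n, X), singSimplex σ = x :=
  ⟨_, (TopCat.toSSetObjEquiv (TopCat.of X) (Opposite.op ⦋n⦌)).symm_apply_apply x⟩

theorem delta_singSimplex {n : ℕ} (σ : C(Simplex (n + 1), X)) (i : Fin (n + 2)) :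
    (TopCat.toSSet.obj (TopCat.of X)).δ i (singSimplex σ) =
      singSimplex (σ.comp (faceIncl i)) := rfl

/-- The inclusion of the summand of the singular chains that belongs to `σ`. -/
noncomputable def chainι {n : ℕ} (σ : C(Simplex n, X)) : ModuleCat.of ℤ ℤ ⟶ (singChains X).X n :=
  SSet.ιChainComplex _ (singSimplex σ)

theorem chain_hom_ext {n : ℕ} {T : ModuleCat.{0} ℤ} {f g : (singChains X).X n ⟶ T}
    (h : ∀ σ : C(Simplex n, X), chainι σ ≫ f = chainι σ ≫ g) : f = g := by
  refine SSet.chainComplex_hom_ext fun x => ?_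
  obtain ⟨σ, rfl⟩ := singSimplex_surjective x
  exact h σ

/-- The constant `0`-simplex. -/
noncomputable def pointSimplex (x : X) : C(Simplex 0, X) := ContinuousMap.const _ x

theorem comp_faceIncl_zero (σ : C(Simplex 1, X)) :
    σ.comp (faceIncl 0) = pointSimplex (σ (vtx 1)) := by
  ext x
  obtain rfl : x = vtx 0 := Subsingleton.elim _ _
  simp [pointSimplex, faceIncl]

theorem comp_faceIncl_one (σ : C(Simplex 1, X)) :
    σ.comp (faceIncl 1) = pointSimplex (σ (vtx 0)) := by
  ext x
  obtain rfl : x = vtx 0 := Subsingleton.elim _ _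
  simp [pointSimplex, faceIncl]

theorem chainι_d_one (σ : C(Simplex 1, X)) :
    chainι σ ≫ (singChains X).d 1 0 =
      chainι (pointSimplex (σ (vtx 1))) - chainι (pointSimplex (σ (vtx 0))) := by
  have := SSet.ιChainComplex_d (TopCat.toSSet.obj (TopCat.of X)) (R := ModuleCat.of ℤ ℤ)
    (singSimplex σ)
  rw [Fin.sum_univ_two, delta_singSimplex, delta_singSimplex, comp_faceIncl_zero,
    comp_faceIncl_one] at this
  simpa [sub_eq_add_neg, chainι] using this

theorem chainι_d_two (σ : C(Simplex 2, X)) :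
    chainι σ ≫ (singChains X).d 2 1 =
      chainι (σ.comp (faceIncl 0)) - chainι (σ.comp (faceIncl 1))
        + chainι (σ.comp (faceIncl 2)) := by
  have := SSet.ιChainComplex_d (TopCat.toSSet.obj (TopCat.of X)) (R := ModuleCat.of ℤ ℤ)
    (singSimplex σ)
  rw [Fin.sum_univ_three, delta_singSimplex, delta_singSimplex, delta_singSimplex] at this
  simpa [sub_eq_add_neg, chainι] using this

/-- The homomorphism on chains with prescribed values on simplices. -/
noncomputable def chainDesc {n : ℕ} (f : C(Simplex n, X) → A) : (singChains X).X n ⟶ ModuleCat.of ℤ A :=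
  Cofan.IsColimit.desc ((TopCat.toSSet.obj (TopCat.of X)).isColimitChainComplexXCofan
    (ModuleCat.of ℤ ℤ) n) fun x =>
      ModuleCat.ofHom (LinearMap.toSpanSingleton ℤ A (f (singSimplex_surjective x).choose))

theorem singSimplex_injective {n : ℕ} : Function.Injective (singSimplex (X := X) (n := n)) :=
  (TopCat.toSSetObjEquiv (TopCat.of X) (Opposite.op ⦋n⦌)).symm.injective

theorem chainι_desc {n : ℕ} (f : C(Simplex n, X) → A) (σ : C(Simplex n, X)) :
    chainι σ ≫ chainDesc f = ModuleCat.ofHom (LinearMap.toSpanSingleton ℤ A (f σ)) := by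
  have h1 := singSimplex_injective (singSimplex_surjective (singSimplex σ)).choose_spec
  have := Cofan.IsColimit.fac ((TopCat.toSSet.obj (TopCat.of X)).isColimitChainComplexXCofan
    (ModuleCat.of ℤ ℤ) n) (fun x =>
      ModuleCat.ofHom (LinearMap.toSpanSingleton ℤ A (f (singSimplex_surjective x).choose)))
      (singSimplex σ)
  rw [h1] at this
  exact this

/-- The cocycle condition for a function on singular `1`-simplices. -/
def SimplexCocycle (f : C(Simplex 1, X) → A) : Prop :=
  ∀ τ : C(Simplex 2, X),
    f (τ.comp (faceIncl 0)) - f (τ.comp (faceIncl 1)) + f (τ.comp (faceIncl 2)) = 0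

theorem d_chainDesc {f : C(Simplex 1, X) → A} (hf : SimplexCocycle f) :
    (singChains X).d 2 1 ≫ chainDesc f = 0 := by
  refine chain_hom_ext fun τ => ?_
  rw [← Category.assoc, chainι_d_two, Preadditive.add_comp, Preadditive.sub_comp, chainι_desc,
    chainι_desc, chainι_desc, comp_zero]
  ext
  simpa using hf τ

/-- The homomorphism on `H₁` given by a cocycle. -/
noncomputable def cochainChar (f : C(Simplex 1, X) → A) (hf : SimplexCocycle f) : H1 X →+ A :=
  ((singChains X).homologyι 1 ≫ (singChains X).descOpcycles (chainDesc f) 2 (by simp)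
    (d_chainDesc hf)).hom.toAddMonoidHom

/-- A homomorphism on `H₁` as a morphism of modules. -/
noncomputable def charHom (φ : H1 X →+ A) : (singChains X).homology 1 ⟶ ModuleCat.of ℤ A :=
  ModuleCat.ofHom
    { toFun := φ
      map_add' := map_add φ
      -- The `ℤ`-module structure carried by `H1 X` is compared with the one of its additive group.
      map_smul' := fun n x => (congrArg φ (int_smul_eq_zsmul (H1 X).isModule n x)).trans
        (map_zsmul φ n x) }

theorem charHom_zero : charHom (0 : H1 X →+ A) = 0 := by
  ext x; rfl

theorem homologyπ_cochainChar {f : C(Simplex 1, X) → A} (hf : SimplexCocycle f) :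
    (singChains X).homologyπ 1 ≫
      charHom (cochainChar f hf) =
        (singChains X).iCycles 1 ≫ chainDesc f := by
  have h : charHom (cochainChar f hf) =
      (singChains X).homologyι 1 ≫ (singChains X).descOpcycles (chainDesc f) 2 (by simp)
        (d_chainDesc hf) := by
    ext x; rfl
  rw [h]
  simp

theorem char_ext {φ ψ : H1 X →+ A}
    (h : (singChains X).homologyπ 1 ≫
        charHom φ =
      (singChains X).homologyπ 1 ≫
        charHom ψ) : φ = ψ := by
  have := (cancel_epi ((singChains X).homologyπ 1)).1 h
  ext x
  exact congrArg (fun k : (singChains X).homology 1 ⟶ ModuleCat.of ℤ A => k.hom x) this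

theorem cochainChar_eq_of_chain {f : C(Simplex 1, X) → A} (hf : SimplexCocycle f) {φ : H1 X →+ A}
    (h : (singChains X).homologyπ 1 ≫
        charHom φ =
      (singChains X).iCycles 1 ≫ chainDesc f) : cochainChar f hf = φ :=
  char_ext ((homologyπ_cochainChar hf).trans h.symm)

theorem chainDesc_coboundary (G : X → A) :
    chainDesc (fun σ : C(Simplex 1, X) => G (σ (vtx 1)) - G (σ (vtx 0))) =
      (singChains X).d 1 0 ≫ chainDesc (fun σ : C(Simplex 0, X) => G (σ (vtx 0))) := by
  refine chain_hom_ext fun σ => ?_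
  rw [chainι_desc, ← Category.assoc, chainι_d_one, Preadditive.sub_comp, chainι_desc, chainι_desc]
  ext
  simp [pointSimplex]

theorem cochainChar_coboundary {f : C(Simplex 1, X) → A} (hf : SimplexCocycle f) {G : X → A}
    (h : ∀ σ, f σ = G (σ (vtx 1)) - G (σ (vtx 0))) : cochainChar f hf = 0 := by
  refine cochainChar_eq_of_chain hf ?_
  obtain rfl : f = fun σ => _ := funext h
  rw [chainDesc_coboundary, HomologicalComplex.iCycles_d_assoc, zero_comp, charHom_zero, comp_zero]

theorem chainDesc_add (f g : C(Simplex 1, X) → A) :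
    chainDesc (fun σ => f σ + g σ) = chainDesc f + chainDesc g := by
  refine chain_hom_ext fun σ => ?_
  rw [Preadditive.comp_add, chainι_desc, chainι_desc, chainι_desc]
  ext
  simp

theorem cochainChar_add {f g : C(Simplex 1, X) → A} (hf : SimplexCocycle f)
    (hg : SimplexCocycle g) (hfg : SimplexCocycle (fun σ => f σ + g σ)) :
    cochainChar _ hfg = cochainChar f hf + cochainChar g hg := by
  refine cochainChar_eq_of_chain hfg ?_
  rw [chainDesc_add, Preadditive.comp_add, ← homologyπ_cochainChar hf, ← homologyπ_cochainChar hg,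
    ← Preadditive.comp_add]
  rfl

theorem cochainChar_comp_left {B : Type} [AddCommGroup B] {f : C(Simplex 1, X) → A}
    (hf : SimplexCocycle f) (g : A →+ B) (hg : SimplexCocycle (fun σ => g (f σ))) :
    cochainChar _ hg = g.comp (cochainChar f hf) := by
  refine cochainChar_eq_of_chain hg ?_
  have h1 : chainDesc (fun σ => g (f σ)) =
      chainDesc f ≫ ModuleCat.ofHom g.toIntLinearMap := by
    refine chain_hom_ext fun σ => ?_
    rw [← Category.assoc, chainι_desc, chainι_desc]
    ext
    simp
  rw [h1, ← Category.assoc, ← homologyπ_cochainChar hf, Category.assoc]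
  rfl

theorem SimplexCocycle.pull {f : C(Simplex 1, X) → A} (hf : SimplexCocycle f) (h : C(Y, X)) :
    SimplexCocycle (fun σ : C(Simplex 1, Y) => f (h.comp σ)) := fun τ => by
  simpa [ContinuousMap.comp_assoc] using hf (h.comp τ)

/-- The chain map induced by a continuous map. -/
noncomputable abbrev singChainsMap (h : C(Y, X)) : singChains Y ⟶ singChains X :=
  SSet.chainComplexMap (TopCat.toSSet.map (TopCat.ofHom h)) (ModuleCat.of ℤ ℤ)

theorem chainι_map {n : ℕ} (h : C(Y, X)) (σ : C(Simplex n, Y)) :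
    chainι σ ≫ (singChainsMap h).f n = chainι (h.comp σ) :=
  SSet.ι_chainComplexMap_f _ _ _ _ _

theorem cochainChar_natural {f : C(Simplex 1, X) → A} (hf : SimplexCocycle f) (h : C(Y, X)) :
    cochainChar _ (hf.pull h) = (cochainChar f hf).comp (H1map h).toAddMonoidHom := by
  refine cochainChar_eq_of_chain _ ?_
  have h1 : chainDesc (fun σ : C(Simplex 1, Y) => f (h.comp σ)) =
      (singChainsMap h).f 1 ≫ chainDesc f := by
    refine chain_hom_ext fun σ => ?_
    rw [← Category.assoc, chainι_map, chainι_desc, chainι_desc]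
  have h2 : charHom ((cochainChar f hf).comp (H1map h).toAddMonoidHom) = HomologicalComplex.homologyMap (singChainsMap h) 1 ≫
        charHom (cochainChar f hf) := rfl
  rw [h1, h2, HomologicalComplex.homologyπ_naturality_assoc, homologyπ_cochainChar,
    HomologicalComplex.cyclesMap_i_assoc]

theorem exists_simplex_of_pathConnected [PathConnectedSpace X] (x y : X) :
    ∃ σ : C(Simplex 1, X), σ (vtx 0) = x ∧ σ (vtx 1) = y := by
  obtain ⟨γ⟩ := PathConnectedSpace.joined x y
  refine ⟨γ.toContinuousMap.comp ⟨stdSimplexHomeomorphUnitInterval,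
    stdSimplexHomeomorphUnitInterval.continuous⟩, ?_, ?_⟩
  · simp [vtx]
  · simp [vtx]

/-- A simplex from a base point to `x`. -/
noncomputable def ray [PathConnectedSpace X] (x₀ x : X) : C(Simplex 1, X) :=
  (exists_simplex_of_pathConnected x₀ x).choose

theorem ray_zero [PathConnectedSpace X] (x₀ x : X) : ray x₀ x (vtx 0) = x₀ :=
  (exists_simplex_of_pathConnected x₀ x).choose_spec.1

theorem ray_one [PathConnectedSpace X] (x₀ x : X) : ray x₀ x (vtx 1) = x :=
  (exists_simplex_of_pathConnected x₀ x).choose_spec.2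

/-- The map from `0`-chains to `1`-chains that takes `x` to a simplex from `x₀` to `x`. -/
noncomputable def coneMap [PathConnectedSpace X] (x₀ : X) :
    (singChains X).X 0 ⟶ (singChains X).X 1 :=
  Cofan.IsColimit.desc ((TopCat.toSSet.obj (TopCat.of X)).isColimitChainComplexXCofan
    (ModuleCat.of ℤ ℤ) 0) fun x => chainι (ray x₀ ((singSimplex_surjective x).choose (vtx 0)))

theorem chainι_coneMap [PathConnectedSpace X] (x₀ x : X) :
    chainι (pointSimplex x) ≫ coneMap x₀ = chainι (ray x₀ x) := by
  have h1 := singSimplex_injective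
    (singSimplex_surjective (singSimplex (pointSimplex x))).choose_spec
  have := Cofan.IsColimit.fac ((TopCat.toSSet.obj (TopCat.of X)).isColimitChainComplexXCofan
    (ModuleCat.of ℤ ℤ) 0) (fun x => chainι (ray x₀ ((singSimplex_surjective x).choose (vtx 0))))
      (singSimplex (pointSimplex x))
  rw [h1] at this
  exact this

/-- The projection of the `1`-chains onto the cycles given by the choice of rays. -/
noncomputable def closeUp [PathConnectedSpace X] (x₀ : X) :
    (singChains X).X 1 ⟶ (singChains X).X 1 :=
  𝟙 _ - (singChains X).d 1 0 ≫ coneMap x₀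

/-- The boundary of the ray to `x` is `x - x₀`, and the base points cancel on the boundary of a
`1`-simplex. -/
theorem closeUp_d [PathConnectedSpace X] (x₀ : X) :
    closeUp x₀ ≫ (singChains X).d 1 0 = 0 := by
  refine chain_hom_ext fun σ => ?_
  rw [closeUp, Preadditive.sub_comp, Preadditive.comp_sub, Category.id_comp, Category.assoc,
    ← Category.assoc (chainι σ) _ (coneMap x₀ ≫ _), chainι_d_one,
    ← Category.assoc, Preadditive.sub_comp, chainι_coneMap, chainι_coneMap,
    Preadditive.sub_comp, chainι_d_one, chainι_d_one, ray_one, ray_one, ray_zero, ray_zero,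
    comp_zero]
  abel

theorem chainι_closeUp [PathConnectedSpace X] (x₀ : X) (σ : C(Simplex 1, X)) :
    chainι σ ≫ closeUp x₀ =
      chainι σ - (chainι (ray x₀ (σ (vtx 1))) - chainι (ray x₀ (σ (vtx 0)))) := by
  rw [closeUp, Preadditive.comp_sub, Category.comp_id, ← Category.assoc, chainι_d_one,
    Preadditive.sub_comp, chainι_coneMap, chainι_coneMap]

/-- The lift of `closeUp` to the cycles. -/
noncomputable def toCycle [PathConnectedSpace X] (x₀ : X) :
    (singChains X).X 1 ⟶ (singChains X).cycles 1 :=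
  (singChains X).liftCycles (closeUp x₀) 0 (by simp) (closeUp_d x₀)

theorem toCycle_i [PathConnectedSpace X] (x₀ : X) :
    toCycle x₀ ≫ (singChains X).iCycles 1 = closeUp x₀ := by simp [toCycle]

theorem iCycles_toCycle [PathConnectedSpace X] (x₀ : X) :
    (singChains X).iCycles 1 ≫ toCycle x₀ = 𝟙 _ := by
  rw [← cancel_mono ((singChains X).iCycles 1), Category.assoc, toCycle_i, closeUp,
    Preadditive.comp_sub, ← Category.assoc, HomologicalComplex.iCycles_d, zero_comp]
  simp

/-- The projection `toCycle` splits the inclusion of the cycles, so a character extends to all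
`1`-chains. This works for every coefficient group, in particular for `ZMod p`, which is not
divisible. -/
theorem exists_cochain [PathConnectedSpace X] (φ : H1 X →+ A) :
    ∃ (f : C(Simplex 1, X) → A) (hf : SimplexCocycle f), cochainChar f hf = φ := by
  obtain ⟨x₀⟩ : Nonempty X := inferInstance
  let Φ := charHom φ
  let F : (singChains X).X 1 ⟶ ModuleCat.of ℤ A :=
    toCycle x₀ ≫ (singChains X).homologyπ 1 ≫ Φ
  let f : C(Simplex 1, X) → A := fun σ => (chainι σ ≫ F).hom (1 : ℤ)
  have hF : F = chainDesc f := by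
    refine chain_hom_ext fun σ => ?_
    rw [chainι_desc]
    ext
    simp [f]
  have hd : (singChains X).d 2 1 ≫ toCycle x₀ = (singChains X).toCycles 2 1 := by
    rw [← cancel_mono ((singChains X).iCycles 1), Category.assoc, toCycle_i, closeUp,
      Preadditive.comp_sub]
    simp
  have hdF : (singChains X).d 2 1 ≫ F = 0 := by
    simp only [F]
    rw [← Category.assoc, hd, HomologicalComplex.toCycles_comp_homologyπ_assoc, zero_comp]
  have hf : SimplexCocycle f := by
    intro τ
    have h1 : chainι τ ≫ (singChains X).d 2 1 ≫ F = 0 := by rw [hdF, comp_zero]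
    rw [← Category.assoc, chainι_d_two, Preadditive.add_comp, Preadditive.sub_comp] at h1
    have := congrArg (fun k : ModuleCat.of ℤ ℤ ⟶ ModuleCat.of ℤ A => k.hom (1 : ℤ)) h1
    simpa [f] using this
  refine ⟨f, hf, cochainChar_eq_of_chain hf ?_⟩
  rw [← hF]
  simp only [F]
  rw [← Category.assoc _ (toCycle x₀), iCycles_toCycle, Category.id_comp]

/-- Integrate along the rays from a base point: a simplex closed up by the rays to its end points is
a cycle, on which the cocycle vanishes. -/
theorem exists_coboundary [PathConnectedSpace X] {f : C(Simplex 1, X) → A} (hf : SimplexCocycle f)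
    (h : cochainChar f hf = 0) : ∃ G : X → A, ∀ σ, f σ = G (σ (vtx 1)) - G (σ (vtx 0)) := by
  obtain ⟨x₀⟩ : Nonempty X := inferInstance
  refine ⟨fun x => f (ray x₀ x), fun σ => ?_⟩
  have h1 : (singChains X).iCycles 1 ≫ chainDesc f = 0 := by
    rw [← homologyπ_cochainChar hf, h, charHom_zero, comp_zero]
  have h2 : chainι σ ≫ closeUp x₀ ≫ chainDesc f = 0 := by
    rw [← toCycle_i, Category.assoc, h1, comp_zero, comp_zero]
  rw [← Category.assoc, chainι_closeUp, Preadditive.sub_comp, Preadditive.sub_comp, chainι_desc,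
    chainι_desc, chainι_desc] at h2
  have := congrArg (fun k : ModuleCat.of ℤ ℤ ⟶ ModuleCat.of ℤ A => k.hom (1 : ℤ)) h2
  simp only [ModuleCat.hom_sub, ModuleCat.hom_ofHom, LinearMap.sub_apply,
    LinearMap.toSpanSingleton_apply, one_smul, ModuleCat.hom_zero, LinearMap.zero_apply] at this
  exact sub_eq_zero.1 this

/-- A simplex with equal end points pairs to zero with a cocycle of trivial character. -/
theorem eq_zero_of_closed {f : C(Simplex 1, X) → A} (hf : SimplexCocycle f)
    (h : cochainChar f hf = 0) (σ : C(Simplex 1, X)) (hσ : σ (vtx 0) = σ (vtx 1)) : f σ = 0 := by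
  have h1 : (singChains X).iCycles 1 ≫ chainDesc f = 0 := by
    rw [← homologyπ_cochainChar hf, h, charHom_zero, comp_zero]
  have h0 : chainι σ ≫ (singChains X).d 1 0 = 0 := by rw [chainι_d_one, hσ, sub_self]
  have h2 : chainι σ ≫ chainDesc f = 0 := by
    rw [← (singChains X).liftCycles_i (chainι σ) 0 (by simp) h0, Category.assoc, h1, comp_zero]
  rw [chainι_desc] at h2
  have := congrArg (fun k : ModuleCat.of ℤ ℤ ⟶ ModuleCat.of ℤ A => k.hom (1 : ℤ)) h2
  simpa using this

theorem H1map_comp {Z : Type} [TopologicalSpace Z] (g : C(Y, Z)) (h : C(X, Y)) :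
    H1map (g.comp h) = H1map g ∘ₗ H1map h := by
  simp only [H1map, TopCat.ofHom_comp, Functor.map_comp, ModuleCat.hom_comp]

theorem H1map_id : H1map (ContinuousMap.id X) = LinearMap.id :=
  congrArg ModuleCat.Hom.hom (CategoryTheory.Functor.map_id
    ((AlgebraicTopology.singularHomologyFunctor (ModuleCat.{0} ℤ) 1).obj (ModuleCat.of ℤ ℤ))
      (TopCat.of X))

theorem H1map_eq_of_homotopy {g h : C(X, Y)} (H : g.Homotopy h) : H1map g = H1map h :=
  congrArg ModuleCat.Hom.hom
    (TopCat.Homotopy.congr_homologyMap_singularChainComplexFunctor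
      (f := TopCat.ofHom g) (g := TopCat.ofHom h) H (ModuleCat.of ℤ ℤ) 1)

theorem H1_subsingleton_of_contractible [ContractibleSpace X] : Subsingleton (H1 X) := by
  obtain ⟨e⟩ := ContractibleSpace.hequiv_unit X
  have h1 : H1map e.symm.toFun ∘ₗ H1map e.toFun = LinearMap.id := by
    obtain ⟨H⟩ := e.left_inv
    rw [← H1map_comp, ← H1map_id]
    exact H1map_eq_of_homotopy H
  have : IsZero (H1 Unit) :=
    AlgebraicTopology.isZero_singularHomologyFunctor_of_totallyDisconnectedSpace _ _ _ _ one_ne_zero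
  have h2 : Subsingleton (H1 Unit) := ModuleCat.subsingleton_of_isZero this
  refine ⟨fun a b => ?_⟩
  have ha := LinearMap.congr_fun h1 a
  have hb := LinearMap.congr_fun h1 b
  simp only [LinearMap.comp_apply, LinearMap.id_apply] at ha hb
  rw [← ha, ← hb, Subsingleton.elim (H1map e.toFun a)]

end Chains
end LensCover

namespace LensCover

/-! ### Integrals of difference cocycles along simplices -/

section Period

variable {X Y A : Type} [TopologicalSpace X] [TopologicalSpace Y] [AddCommGroup A]

instance (n : ℕ) : ContractibleSpace (Simplex n) :=
  (convex_stdSimplex ℝ (Fin (n + 1))).contractibleSpace ⟨_, (vtx (n := n) 0).2⟩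

instance (n : ℕ) : LocallyPathConnectedSpace (Simplex n) :=
  (convex_stdSimplex ℝ (Fin (n + 1))).locallyPathConnectedSpace

theorem exists_primitive_simplex {n : ℕ} {d : X → X → A} (hd : CocycleOn univ d)
    (σ : C(Simplex n, X)) : ∃ G, PrimitiveOn univ (pullDiff σ d) G :=
  acyclicOn_univ _ (hd.pull σ.continuous.continuousOn (mapsTo_univ _ _))

open Classical in
/-- The integral of `d` along a singular `1`-simplex. -/
noncomputable def period (d : X → X → A) (σ : C(Simplex 1, X)) : A :=
  -- For a cocycle a primitive along `σ` always exists, by `exists_primitive_simplex`; the value `0`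
  -- is only a default.
  if h : ∃ G, PrimitiveOn univ (pullDiff σ d) G then h.choose (vtx 1) - h.choose (vtx 0) else 0

theorem _root_.PrimitiveOn.sub_eq_sub [PreconnectedSpace Y] {d : Y → Y → A} {G K : Y → A}
    (hG : PrimitiveOn univ d G) (hK : PrimitiveOn univ d K) (x y : Y) :
    G y - G x = K y - K x := by
  have := (hG.sub_locConstOn hK).eq_of_isPreconnected isPreconnected_univ (mem_univ x)
    (mem_univ y)
  rw [sub_eq_sub_iff_add_eq_add] at this ⊢
  rw [add_comm (G y), add_comm (K y), ← sub_eq_zero] at *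
  rw [← neg_eq_zero, ← this]
  abel

theorem period_eq {d : X → X → A} {σ : C(Simplex 1, X)} {G : Simplex 1 → A}
    (hG : PrimitiveOn univ (pullDiff σ d) G) : period d σ = G (vtx 1) - G (vtx 0) := by
  have h : ∃ G, PrimitiveOn univ (pullDiff σ d) G := ⟨G, hG⟩
  rw [period, dif_pos h]
  exact h.choose_spec.sub_eq_sub hG _ _

theorem period_comp {d : X → X → A} {P : Set Y} {h : Y → X} {G : Y → A}
    (hG : PrimitiveOn P (pullDiff h d) G) (k : C(Simplex 1, Y)) (hk : ∀ t, k t ∈ P)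
    (σ : C(Simplex 1, X)) (hσ : ∀ t, σ t = h (k t)) :
    period d σ = G (k (vtx 1)) - G (k (vtx 0)) := by
  have h1 : pullDiff σ d = pullDiff k (pullDiff h d) := by
    ext s t; simp [pullDiff, hσ]
  exact period_eq (G := G ∘ k)
    (h1 ▸ hG.pull k.continuous.continuousOn (Q := univ) fun t _ => hk t)

theorem period_of_primitive {d : X → X → A} {P : Set X} {G : X → A}
    (hG : PrimitiveOn P d G) (σ : C(Simplex 1, X)) (hσ : ∀ t, σ t ∈ P) :
    period d σ = G (σ (vtx 1)) - G (σ (vtx 0)) :=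
  period_comp (h := id) hG σ hσ σ fun _ => rfl

theorem faceIncl_vtx {n : ℕ} (i : Fin (n + 2)) (j : Fin (n + 1)) :
    faceIncl i (vtx j) = vtx (i.succAbove j) := stdSimplex.map_vertex _ _

/-- One primitive on the whole `2`-simplex computes the integrals along all three edges, and these
telescope. -/
theorem simplexCocycle_period {d : X → X → A} (hd : CocycleOn univ d) :
    SimplexCocycle (period d) := by
  intro τ
  obtain ⟨G, hG⟩ := exists_primitive_simplex hd τ
  have h : ∀ i, period d (τ.comp (faceIncl i)) =
      G (vtx (i.succAbove 1)) - G (vtx (i.succAbove 0)) := fun i => by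
    rw [period_comp hG (faceIncl i) (fun _ => mem_univ _) _ fun _ => rfl, faceIncl_vtx,
      faceIncl_vtx]
  rw [h, h, h]
  simp only [show (0 : Fin 3).succAbove (1 : Fin 2) = 2 from rfl,
    show (0 : Fin 3).succAbove (0 : Fin 2) = 1 from rfl,
    show (1 : Fin 3).succAbove (1 : Fin 2) = 2 from rfl,
    show (1 : Fin 3).succAbove (0 : Fin 2) = 0 from rfl,
    show (2 : Fin 3).succAbove (1 : Fin 2) = 1 from rfl,
    show (2 : Fin 3).succAbove (0 : Fin 2) = 0 from rfl]
  abel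

/-- The character of `H₁(X)` given by the periods of a cocycle. -/
noncomputable def charOf {d : X → X → A} (hd : CocycleOn univ d) : H1 X →+ A :=
  cochainChar (period d) (simplexCocycle_period hd)

theorem charOf_pull {d : X → X → A} (hd : CocycleOn univ d) (h : C(Y, X))
    (hd' : CocycleOn univ (pullDiff h d)) (u : H1 Y) :
    charOf hd' u = charOf hd (H1map h u) :=
  DFunLike.congr_fun (cochainChar_natural (simplexCocycle_period hd) h) u

theorem charOf_eq_zero {d : X → X → A} {G : X → A} (hG : PrimitiveOn univ d G)
    (hd : CocycleOn univ d) : charOf hd = 0 :=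
  cochainChar_coboundary _ fun σ => period_of_primitive hG σ fun _ => mem_univ _

theorem period_add {d d' : X → X → A} (hd : CocycleOn univ d) (hd' : CocycleOn univ d')
    (σ : C(Simplex 1, X)) :
    period (fun x z => d x z + d' x z) σ = period d σ + period d' σ := by
  obtain ⟨G, hG⟩ := exists_primitive_simplex hd σ
  obtain ⟨K, hK⟩ := exists_primitive_simplex hd' σ
  rw [period_eq hG, period_eq hK, period_eq (d := fun x z => d x z + d' x z) (hG.add hK)]
  abel

theorem charOf_add {d d' : X → X → A} (hd : CocycleOn univ d) (hd' : CocycleOn univ d')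
    (h : CocycleOn univ (fun x z => d x z + d' x z)) :
    charOf h = charOf hd + charOf hd' := by
  have h1 : period (fun x z => d x z + d' x z) = fun σ => period d σ + period d' σ :=
    funext fun σ => period_add hd hd' σ
  have h2 : SimplexCocycle (fun σ => period d σ + period d' σ) := h1 ▸ simplexCocycle_period h
  rw [charOf, charOf, charOf, ← cochainChar_add _ _ h2]
  congr 1

theorem _root_.PrimitiveOn.map {B : Type} [AddCommGroup B] {P : Set X} {d : X → X → A} {G : X → A}
    (hG : PrimitiveOn P d G) (g : A →+ B) :
    PrimitiveOn P (fun x z => g (d x z)) (fun x => g (G x)) := by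
  intro x hx
  filter_upwards [hG x hx] with z hz
  rw [hz, map_sub]

theorem charOf_map {B : Type} [AddCommGroup B] {d : X → X → A} (hd : CocycleOn univ d)
    (g : A →+ B) (h : CocycleOn univ (fun x z => g (d x z))) :
    charOf h = g.comp (charOf hd) := by
  have h1 : period (fun x z => g (d x z)) = fun σ => g (period d σ) := funext fun σ => by
    obtain ⟨G, hG⟩ := exists_primitive_simplex hd σ
    rw [period_eq hG, period_eq (d := fun x z => g (d x z)) (hG.map g), map_sub]
  have h2 : SimplexCocycle (fun σ => g (period d σ)) := h1 ▸ simplexCocycle_period h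
  rw [charOf, charOf, ← cochainChar_comp_left _ _ h2]
  congr 1

/-- The cocycle condition at `x`, read as `d y z = d x z - d x y`, says that `d x` itself is a
primitive near `x`. -/
theorem _root_.CocycleOn.exists_nhds_primitiveOn {d : X → X → A} (hd : CocycleOn univ d) (x : X) :
    ∃ N ∈ 𝓝 x, PrimitiveOn N d (d x) := by
  have h := hd x (mem_univ x)
  rw [nhdsWithin_univ] at h
  simp only [nhdsWithin_univ] at h
  refine ⟨_, h, fun y hy => nhdsWithin_le_nhds ?_⟩
  filter_upwards [hy] with z hz
  rw [hz]; abel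

theorem exists_simplex_in {W : Set X} (hW : IsPathConnected W) {x y : X} (hx : x ∈ W)
    (hy : y ∈ W) : ∃ σ : C(Simplex 1, X), (∀ t, σ t ∈ W) ∧ σ (vtx 0) = x ∧ σ (vtx 1) = y := by
  have : PathConnectedSpace W := isPathConnected_iff_pathConnectedSpace.1 hW
  obtain ⟨σ, h0, h1⟩ := exists_simplex_of_pathConnected (⟨x, hx⟩ : W) ⟨y, hy⟩
  exact ⟨⟨fun t => σ t, by fun_prop⟩, fun t => (σ t).2, congrArg Subtype.val h0,
    congrArg Subtype.val h1⟩

/-- A point `z` near `x` is joined to `x` by a path inside a neighbourhood where `d x` is a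
primitive, so the integral along this path is `d x z`. -/
theorem primitiveOn_of_period [LocallyPathConnectedSpace X] {d : X → X → A}
    (hd : CocycleOn univ d) {G : X → A}
    (h : ∀ σ : C(Simplex 1, X), period d σ = G (σ (vtx 1)) - G (σ (vtx 0))) :
    PrimitiveOn univ d G := by
  intro x _
  rw [nhdsWithin_univ]
  obtain ⟨N, hN, hNd⟩ := hd.exists_nhds_primitiveOn x
  obtain ⟨W, ⟨hWx, hW⟩, hWN⟩ := (LocallyPathConnectedSpace.path_connected_basis x).mem_iff.1 hN
  filter_upwards [hWx] with z hz
  obtain ⟨σ, hσ, h0, h1⟩ := exists_simplex_in hW (mem_of_mem_nhds hWx) hz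
  have h2 := period_of_primitive hNd σ fun t => hWN (hσ t)
  rw [h, h0, h1, hd.diag (mem_univ x), sub_zero] at h2
  exact h2.symm

/-- A cocycle with trivial character has a primitive. -/
theorem exists_primitive_of_charOf_eq_zero [PathConnectedSpace X] [LocallyPathConnectedSpace X]
    {d : X → X → A} (hd : CocycleOn univ d) (h : charOf hd = 0) :
    ∃ G, PrimitiveOn univ d G := by
  obtain ⟨G, hG⟩ := exists_coboundary _ h
  exact ⟨G, primitiveOn_of_period hd hG⟩

end Period

/-! ### Every character of `H₁` comes from a difference cocycle -/

section Subdivision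

variable {X A : Type} [TopologicalSpace X] [AddCommGroup A]

/-- The affine map of standard simplices with given images of the vertices. -/
noncomputable def affMap {n m : ℕ} (p : Fin (n + 1) → Simplex m) : C(Simplex n, Simplex m) where
  toFun w := ⟨∑ i, w.1 i • (p i).1, (convex_stdSimplex ℝ (Fin (m + 1))).sum_mem
    (fun i _ => w.2.1 i) w.2.2 fun i _ => (p i).2⟩
  continuous_toFun := by
    refine Continuous.subtype_mk ?_ _
    exact continuous_finsetSum _ fun i _ =>
      ((continuous_apply i).comp continuous_subtype_val).smul continuous_const

theorem affMap_apply {n m : ℕ} (p : Fin (n + 1) → Simplex m) (w : Simplex n) (j : Fin (m + 1)) :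
    affMap p w j = ∑ i, w i * p i j := by
  show (∑ i, w.1 i • (p i).1) j = _
  rw [Finset.sum_apply]
  rfl

theorem affMap_comp_faceIncl {n m : ℕ} (p : Fin (n + 2) → Simplex m) (i : Fin (n + 2)) :
    (affMap p).comp (faceIncl i) = affMap (p ∘ i.succAbove) := by
  ext w j
  have h : ∀ k, (faceIncl i w) k = (FunOnFinite.linearMap ℝ ℝ i.succAbove w) k := fun k => rfl
  rw [ContinuousMap.comp_apply, affMap_apply, affMap_apply, Fin.sum_univ_succAbove _ i]
  simp only [h, FunOnFinite.linearMap_apply_apply]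
  simp [Finset.filter_eq']

theorem affMap_vtx {n : ℕ} : affMap (fun i : Fin (n + 1) => vtx i) = ContinuousMap.id _ := by
  ext w j
  rw [affMap_apply]
  simp [Pi.single_apply]

theorem SimplexCocycle.const {f : C(Simplex 1, X) → A} (hf : SimplexCocycle f) (x : X) :
    f (ContinuousMap.const _ x) = 0 := by
  simpa using hf (ContinuousMap.const _ x)

/-- This stands in for barycentric subdivision. The value of `f` on the part of `σ` between the
initial vertex and `t` is a function of `t`; it is a primitive of `d` along `σ`, because `f` is
additive by its cocycle condition on affine triangles inside the `1`-simplex and equals `d` on short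
segments. -/
theorem primitive_of_simplexCocycle {f : C(Simplex 1, X) → A} (hf : SimplexCocycle f)
    {d : X → X → A} {V : X → Set X} (hV : ∀ x, V x ∈ 𝓝 x)
    (h : ∀ x (σ : C(Simplex 1, X)), σ (vtx 0) = x → (∀ t, σ t ∈ V x) → f σ = d x (σ (vtx 1)))
    (σ : C(Simplex 1, X)) : period d σ = f σ := by
  let seg : Simplex 1 → Simplex 1 → C(Simplex 1, Simplex 1) := fun s t => affMap ![s, t]
  have hseg0 : ∀ s t, seg s t (vtx 0) = s := fun s t => by
    ext j; simp [seg, affMap_apply]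
  have hseg1 : ∀ s t, seg s t (vtx 1) = t := fun s t => by
    ext j; simp [seg, affMap_apply]
  have hadd : ∀ s t u, f (σ.comp (seg t u)) = f (σ.comp (seg s u)) - f (σ.comp (seg s t)) := by
    intro s t u
    have := hf (σ.comp (affMap ![s, t, u]))
    simp only [ContinuousMap.comp_assoc, affMap_comp_faceIncl] at this
    have e0 : ![s, t, u] ∘ Fin.succAbove 0 = ![t, u] := by
      ext i : 1; fin_cases i <;> rfl
    have e1 : ![s, t, u] ∘ Fin.succAbove 1 = ![s, u] := by
      ext i : 1; fin_cases i <;> rfl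
    have e2 : ![s, t, u] ∘ Fin.succAbove 2 = ![s, t] := by
      ext i : 1; fin_cases i <;> rfl
    rw [e0, e1, e2] at this
    rw [eq_sub_iff_add_eq, ← sub_eq_zero, ← this]
    abel
  have hG : PrimitiveOn univ (pullDiff σ d) (fun t => f (σ.comp (seg (vtx 0) t))) := by
    intro t _
    rw [nhdsWithin_univ]
    obtain ⟨ε, hε, hb⟩ := Metric.mem_nhds_iff.1 (σ.continuous.continuousAt (hV (σ t)))
    filter_upwards [Metric.ball_mem_nhds t hε] with u hu
    rw [← hadd, h (σ t) (σ.comp (seg t u)) (by simp [hseg0]) fun w => hb ?_]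
    · simp [hseg1, pullDiff]
    -- The segment from `t` to `u` stays in the ball around `t`, which is convex.
    · have h1 := (convex_ball t.1 ε) (Metric.mem_ball_self hε) (y := u.1) hu (w.2.1 0) (w.2.1 1)
        (by simpa using w.2.2)
      have h2 : (seg t u w).1 = w.1 0 • t.1 + w.1 1 • u.1 := by
        ext j; simp [seg, affMap]
      rw [← h2] at h1
      exact h1
  rw [period_eq hG]
  have h1 : seg (vtx 0) (vtx 1) = ContinuousMap.id _ := by
    rw [← affMap_vtx]
    show affMap _ = affMap _
    congr 1
    ext i : 1; fin_cases i <;> rfl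
  have h0 : σ.comp (seg (vtx 0) (vtx 0)) = ContinuousMap.const _ (σ (vtx 0)) := by
    ext w
    have : seg (vtx 0) (vtx 0) w = vtx 0 := by
      ext j
      have := stdSimplex.add_eq_one w
      simp only [seg, affMap_apply]
      simp [← add_mul, this]
    simp [this]
  rw [h0, hf.const, h1, sub_zero, ContinuousMap.comp_id]

/-- Every character of `H₁(X)` is the character of a cocycle. -/
theorem exists_charOf_eq [PathConnectedSpace X] [StronglyLocallyContractibleSpace X]
    (φ : H1 X →+ A) : ∃ (d : X → X → A) (hd : CocycleOn univ d), charOf hd = φ := by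
  obtain ⟨f, hf, hfφ⟩ := exists_cochain φ
  have hloc : ∀ x : X, ∃ (V : Set X) (G : X → A), V ∈ 𝓝 x ∧
      ∀ σ : C(Simplex 1, X), (∀ t, σ t ∈ V) → f σ = G (σ (vtx 1)) - G (σ (vtx 0)) := by
    intro x
    obtain ⟨V, ⟨hVx, hVc⟩, -⟩ := (contractible_basis x).mem_iff.1 univ_mem
    have hsub := H1_subsingleton_of_contractible (X := V)
    let ι : C(V, X) := ⟨Subtype.val, continuous_subtype_val⟩
    obtain ⟨G, hG⟩ := exists_coboundary (hf.pull ι) (by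
      ext u
      rw [Subsingleton.elim u 0, map_zero, map_zero])
    classical
    refine ⟨V, fun z => if h : z ∈ V then G ⟨z, h⟩ else 0, hVx, fun σ hσ => ?_⟩
    have := hG ⟨fun t => ⟨σ t, hσ t⟩, by fun_prop⟩
    simp only [hσ, dite_true]
    exact this
  choose V G hV hG using hloc
  -- Where a simplex from `x` to `z` inside `V x` exists, `d x z` is the value of `f` on it.
  let d : X → X → A := fun x z => G x z - G x x
  have hd : CocycleOn univ d := by
    intro x _
    simp only [nhdsWithin_univ]
    filter_upwards [eventually_mem_nhds_iff.2 (hV x)] with y hy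
    -- Near `y` both `G x` and `G y` compute `f` on short simplices starting at `y`, so they have
    -- the same increments there.
    obtain ⟨W, ⟨hWy, hW⟩, hWV⟩ :=
      (LocallyPathConnectedSpace.path_connected_basis y).mem_iff.1 (inter_mem hy (hV y))
    filter_upwards [hWy] with z hz
    obtain ⟨σ, hσ, h0, h1⟩ := exists_simplex_in hW (mem_of_mem_nhds hWy) hz
    have e1 := hG x σ fun t => (hWV (hσ t)).1
    have e2 := hG y σ fun t => (hWV (hσ t)).2
    rw [h0, h1] at e1 e2
    simp only [d]
    rw [← e2, e1]
    abel
  have hper : period d = f := funext fun σ => primitive_of_simplexCocycle hf hV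
    (fun x σ h0 hσ => by rw [hG x σ hσ, h0]) σ
  refine ⟨d, hd, ?_⟩
  rw [← hfφ, charOf]
  congr 1

end Subdivision

end LensCover

namespace LensCover

open scoped unitInterval

/-! ### Integrals along paths and loops -/

section Paths

variable {X Y A : Type} [TopologicalSpace X] [TopologicalSpace Y] [AddCommGroup A]

/-- The identification of the standard `1`-simplex with the unit interval. -/
noncomputable def simplexToI : C(Simplex 1, I) :=
  ⟨stdSimplexHomeomorphUnitInterval, stdSimplexHomeomorphUnitInterval.continuous⟩

theorem simplexToI_zero : simplexToI (vtx 0) = 0 :=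
  stdSimplexHomeomorphUnitInterval_zero

theorem simplexToI_one : simplexToI (vtx 1) = 1 :=
  stdSimplexHomeomorphUnitInterval_one

/-- The integral of `d` along a path. -/
noncomputable def pathPeriod (d : X → X → A) (α : C(I, X)) : A := period d (α.comp simplexToI)

instance : LocallyPathConnectedSpace I := (convex_Icc (0 : ℝ) 1).locallyPathConnectedSpace

instance : ContractibleSpace I := (convex_Icc (0 : ℝ) 1).contractibleSpace ⟨0, by simp⟩

theorem exists_primitive_path {d : X → X → A} (hd : CocycleOn univ d)
    (α : C(I, X)) : ∃ G, PrimitiveOn univ (pullDiff α d) G :=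
  acyclicOn_univ _ (hd.pull α.continuous.continuousOn (mapsTo_univ _ _))

theorem pathPeriod_comp {d : X → X → A} {P : Set Y} {h : Y → X} {G : Y → A}
    (hG : PrimitiveOn P (pullDiff h d) G) (k : C(I, Y)) (hk : ∀ t, k t ∈ P)
    (α : C(I, X)) (hα : ∀ t, α t = h (k t)) :
    pathPeriod d α = G (k 1) - G (k 0) := by
  rw [pathPeriod, period_comp hG (k.comp simplexToI) (fun t => hk _) _ fun t => hα _]
  simp [simplexToI_zero, simplexToI_one]

theorem pathPeriod_eq {d : X → X → A} {α : C(I, X)} {G : I → A}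
    (hG : PrimitiveOn univ (pullDiff α d) G) : pathPeriod d α = G 1 - G 0 :=
  pathPeriod_comp hG (ContinuousMap.id I) (fun _ => mem_univ _) α fun _ => rfl

theorem pathPeriod_trans {d : X → X → A} (hd : CocycleOn univ d) {x y z : X} (α : Path x y)
    (β : Path y z) :
    pathPeriod d (α.trans β).toContinuousMap =
      pathPeriod d α.toContinuousMap + pathPeriod d β.toContinuousMap := by
  obtain ⟨G, hG⟩ := exists_primitive_path hd (α.trans β).toContinuousMap
  let k1 : C(I, I) := ⟨fun t => ⟨t / 2, by constructor <;> linarith [t.2.1, t.2.2]⟩, by fun_prop⟩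
  let k2 : C(I, I) :=
    ⟨fun t => ⟨(1 + t) / 2, by constructor <;> linarith [t.2.1, t.2.2]⟩, by fun_prop⟩
  rw [pathPeriod_eq hG, pathPeriod_comp hG k1 (fun _ => mem_univ _) α.toContinuousMap,
    pathPeriod_comp hG k2 (fun _ => mem_univ _) β.toContinuousMap]
  · have h1 : k1 1 = k2 0 := Subtype.ext (by simp [k1, k2])
    have h2 : k2 1 = 1 := Subtype.ext (by simp [k2])
    have h3 : k1 0 = 0 := Subtype.ext (by simp [k1])
    rw [h1, h2, h3]
    abel
  · intro t
    show β t = (α.trans β) (k2 t)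
    rw [Path.trans_apply]
    split_ifs with h
    · have ht : t = 0 := Subtype.ext (by
        have := t.2.1
        simp [k2] at h
        simpa using le_antisymm (by linarith) this)
      subst ht
      rw [β.source]
      convert! α.target.symm using 2
      exact Subtype.ext (by simp [k2])
    · congr 1
      exact Subtype.ext (by simp [k2]; ring)
  · intro t
    show α t = (α.trans β) (k1 t)
    rw [Path.trans_apply, dif_pos (by simp [k1]; linarith [t.2.2])]
    congr 1
    exact Subtype.ext (by simp [k1]; ring)

theorem pathPeriod_symm {d : X → X → A} (hd : CocycleOn univ d) {x y : X} (α : Path x y) :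
    pathPeriod d α.symm.toContinuousMap = - pathPeriod d α.toContinuousMap := by
  obtain ⟨G, hG⟩ := exists_primitive_path hd α.toContinuousMap
  let k : C(I, I) := ⟨fun t => unitInterval.symm t, unitInterval.continuous_symm⟩
  rw [pathPeriod_eq hG, pathPeriod_comp hG k (fun _ => mem_univ _) _ fun t => rfl]
  simp [k]

/-- A cocycle with vanishing integrals along loops has a primitive. -/
theorem exists_primitive_of_loops [PathConnectedSpace X] [LocallyPathConnectedSpace X]
    {d : X → X → A} (hd : CocycleOn univ d)
    (h : ∀ (x : X) (α : Path x x), pathPeriod d α.toContinuousMap = 0) :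
    ∃ G, PrimitiveOn univ d G := by
  obtain ⟨x₀⟩ : Nonempty X := inferInstance
  let γ : ∀ x, Path x₀ x := fun x => PathConnectedSpace.somePath x₀ x
  refine ⟨fun x => pathPeriod d (γ x).toContinuousMap, primitiveOn_of_period hd fun τ => ?_⟩
  let α : Path (τ (vtx 0)) (τ (vtx 1)) :=
    { toFun := fun t => τ (stdSimplexHomeomorphUnitInterval.symm t)
      continuous_toFun := by fun_prop
      source' := by
        congr 1
        rw [Homeomorph.symm_apply_eq]
        exact simplexToI_zero.symm
      target' := by
        congr 1
        rw [Homeomorph.symm_apply_eq]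
        exact simplexToI_one.symm }
  have h1 : period d τ = pathPeriod d α.toContinuousMap := by
    rw [pathPeriod]
    congr 1
    ext t
    show τ t = τ (stdSimplexHomeomorphUnitInterval.symm (stdSimplexHomeomorphUnitInterval t))
    rw [Homeomorph.symm_apply_apply]
  have h2 := h x₀ (((γ _).trans α).trans (γ _).symm)
  rw [pathPeriod_trans hd, pathPeriod_trans hd, pathPeriod_symm hd] at h2
  rw [h1, eq_sub_iff_add_eq, add_comm, ← sub_eq_zero, ← h2]
  abel

theorem pathPeriod_eq_zero_of_charOf {d : X → X → A} (hd : CocycleOn univ d) (h : charOf hd = 0)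
    {x : X} (α : Path x x) : pathPeriod d α.toContinuousMap = 0 := by
  refine eq_zero_of_closed _ h _ ?_
  show α (simplexToI (vtx 0)) = α (simplexToI (vtx 1))
  rw [simplexToI_zero, simplexToI_one, α.source, α.target]

end Paths

/-! ### Loops as maps from the circle -/

section CircleLoops

variable {X A : Type} [TopologicalSpace X] [AddCommGroup A]

/-- The path that runs once around the circle. -/
noncomputable def circlePath : C(I, Circle) :=
  ⟨fun t => Circle.exp (2 * Real.pi * t), by fun_prop⟩

theorem circlePath_zero : circlePath 0 = 1 := by simp [circlePath]

theorem circlePath_one : circlePath 1 = 1 := by simp [circlePath]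

theorem circlePath_surjective : Function.Surjective circlePath := by
  intro z
  have hz := Circle.exp_arg z
  have hpi := Real.pi_pos
  have h1 := Complex.neg_pi_lt_arg (z : ℂ)
  have h2 := Complex.arg_le_pi (z : ℂ)
  by_cases h : 0 ≤ Complex.arg (z : ℂ)
  · refine ⟨⟨Complex.arg z / (2 * Real.pi), by positivity, ?_⟩, ?_⟩
    · rw [div_le_one (by positivity)]; linarith
    · simp only [circlePath, ContinuousMap.coe_mk]
      rw [mul_div_cancel₀ _ (by positivity), hz]
  · refine ⟨⟨(Complex.arg z + 2 * Real.pi) / (2 * Real.pi), ?_, ?_⟩, ?_⟩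
    · apply div_nonneg <;> linarith
    · rw [div_le_one (by positivity)]; linarith
    · simp only [circlePath, ContinuousMap.coe_mk]
      rw [mul_div_cancel₀ _ (by positivity), Circle.exp_add, hz, Circle.exp_two_pi, mul_one]

theorem eq_of_circlePath_eq {s t : I} (h : circlePath s = circlePath t) :
    s = t ∨ (s = 0 ∧ t = 1) ∨ (s = 1 ∧ t = 0) := by
  obtain ⟨m, hm⟩ := Circle.exp_eq_exp.1 h
  have hpi := Real.pi_pos
  have h1 : (s : ℝ) = t + m := by
    have : 2 * Real.pi * (s : ℝ) = 2 * Real.pi * (t + m) := by rw [hm]; ring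
    exact mul_left_cancel₀ (by positivity) this
  have hs := s.2
  have ht := t.2
  have h2 : -1 ≤ m := by
    have : (-1 : ℝ) ≤ m := by linarith [hs.1, ht.2]
    exact_mod_cast this
  have h3 : m ≤ 1 := by
    have : (m : ℝ) ≤ 1 := by linarith [hs.2, ht.1]
    exact_mod_cast this
  obtain rfl | rfl | rfl : m = -1 ∨ m = 0 ∨ m = 1 := by omega
  · right; left
    push_cast at h1
    exact ⟨Subtype.ext (by show (s : ℝ) = 0; linarith [hs.1, ht.2]),
      Subtype.ext (by show (t : ℝ) = 1; linarith [hs.1, ht.2])⟩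
  · left
    push_cast at h1
    exact Subtype.ext (by linarith)
  · right; right
    push_cast at h1
    exact ⟨Subtype.ext (by show (s : ℝ) = 1; linarith [hs.2, ht.1]),
      Subtype.ext (by show (t : ℝ) = 0; linarith [hs.2, ht.1])⟩

/-- A closed path factors through the circle. -/
theorem exists_circle_map {x : X} (α : Path x x) :
    ∃ γ : C(Circle, X), γ.comp circlePath = α.toContinuousMap ∧ γ 1 = x := by
  have hq : IsQuotientMap circlePath :=
    IsQuotientMap.of_surjective_continuous circlePath_surjective circlePath.continuous
  have hf : Function.FactorsThrough α.toContinuousMap circlePath := by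
    intro s t h
    show α s = α t
    obtain rfl | ⟨rfl, rfl⟩ | ⟨rfl, rfl⟩ := eq_of_circlePath_eq h
    · rfl
    · rw [α.source, α.target]
    · rw [α.source, α.target]
  have h1 : (hq.lift α.toContinuousMap hf).comp circlePath = α.toContinuousMap :=
    hq.lift_comp _ _
  refine ⟨hq.lift α.toContinuousMap hf, h1, ?_⟩
  have := DFunLike.congr_fun h1 0
  rw [ContinuousMap.comp_apply, circlePath_zero] at this
  rw [this]
  exact α.source

/-- For the converse, a primitive of the pullback to `ℝ` grows over each turn by the integral around
the circle. If this is zero, the primitive is periodic and descends. -/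
theorem charOf_circle_eq_zero_iff {d : Circle → Circle → A} (hd : CocycleOn univ d) :
    charOf hd = 0 ↔ pathPeriod d circlePath = 0 := by
  constructor
  · intro h
    exact pathPeriod_eq_zero_of_charOf hd h
      (⟨circlePath, circlePath_zero, circlePath_one⟩ : Path (1 : Circle) 1)
  · intro h
    obtain ⟨G, hG⟩ := acyclicOn_univ (X := ℝ) (pullDiff Circle.exp d)
      (hd.pull Circle.exp.continuous.continuousOn (mapsTo_univ _ _))
    have hper : ∀ t, Circle.exp (t + 2 * Real.pi) = Circle.exp t := Circle.periodic_exp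
    have hG' : PrimitiveOn univ (pullDiff Circle.exp d) (fun t => G (t + 2 * Real.pi)) := by
      have := hG.pull (Q := univ) (h := fun t : ℝ => t + 2 * Real.pi) (by fun_prop) (mapsTo_univ univ _)
      refine this.congr_diff fun x _ => Eventually.of_forall fun z => ?_
      simp [pullDiff, hper]
    have hGper : ∀ t, G (t + 2 * Real.pi) = G t := by
      intro t
      have h1 := (hG'.sub_locConstOn hG).eq_of_isPreconnected isPreconnected_univ (mem_univ t)
        (mem_univ 0)
      have h2 := pathPeriod_comp hG ⟨fun t : I => 2 * Real.pi * t, by fun_prop⟩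
        (fun _ => mem_univ _) circlePath fun _ => rfl
      simp only [h, ContinuousMap.coe_mk, Set.Icc.coe_one, Set.Icc.coe_zero, mul_one,
        mul_zero] at h2
      rw [zero_add, ← h2] at h1
      exact sub_eq_zero.1 h1
    have hGexp : ∀ s t, Circle.exp s = Circle.exp t → G s = G t := by
      intro s t hst
      obtain ⟨m, rfl⟩ := Circle.exp_eq_exp.1 hst
      exact (show Function.Periodic G (2 * Real.pi) from hGper).int_mul m t
    -- The jump of `Complex.arg` is harmless: `G` depends only on the point of the circle.
    refine charOf_eq_zero (G := fun z : Circle => G (Complex.arg z)) (fun z _ => ?_) hd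
    rw [nhdsWithin_univ]
    have h1 := hG (Complex.arg z) (mem_univ _)
    have h2 := isLocalHomeomorph_circleExp.map_nhds_eq (Complex.arg z)
    rw [nhdsWithin_univ] at h1
    rw [Circle.exp_arg] at h2
    rw [← h2, eventually_map]
    filter_upwards [h1] with t ht
    rw [pullDiff, Circle.exp_arg] at ht
    rw [ht, hGexp _ t (Circle.exp_arg _)]

end CircleLoops

/-! ### Labelling the sheets of the associated covering -/

section Covering

variable {E M : Type} [TopologicalSpace E] [TopologicalSpace M]

/-- Labels `θ` that identify the points of a covering `π : E → M` with pairs of a point of `M` and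
an element of `A`, in such a way that the change of `θ` is given by the cocycle `r` of the
covering. -/
structure Labelling {A : Type} [AddCommGroup A] (r : M → M → A) (π : C(E, M)) (θ : E → A) :
    Prop where
  isOpenMap : IsOpenMap π
  primitive : PrimitiveOn univ (pullDiff π r) θ
  inj : ∀ {x y}, π x = π y → θ x = θ y → x = y
  surj : ∀ m c, ∃ x, π x = m ∧ θ x = c

namespace Labelling

variable {A : Type} [AddCommGroup A] {r : M → M → A} {π : C(E, M)} {θ : E → A}
  (L : Labelling r π θ)
include L

/-- The point with given projection and label. -/
noncomputable def pt (m : M) (c : A) : E := (L.surj m c).choose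

theorem π_pt (m : M) (c : A) : π (L.pt m c) = m := (L.surj m c).choose_spec.1

theorem θ_pt (m : M) (c : A) : θ (L.pt m c) = c := (L.surj m c).choose_spec.2

theorem pt_eq (x : E) : L.pt (π x) (θ x) = x := L.inj (L.π_pt _ _) (L.θ_pt _ _)

/-- A primitive of the pullback of `r` along `h` gives continuous lifts of `h`. -/
theorem continuousOn_pt {Y : Type} [TopologicalSpace Y] {h : Y → M} {Q : Set Y} {R : Y → A}
    (hc : ContinuousOn h Q) (hR : PrimitiveOn Q (pullDiff h r) R) (c : A) :
    ContinuousOn (fun y => L.pt (h y) (R y + c)) Q := by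
  intro y hy W hW
  set x := L.pt (h y) (R y + c) with hx
  have h1 := L.primitive x (mem_univ x)
  rw [nhdsWithin_univ] at h1
  have h2 := L.isOpenMap.image_mem_nhds (inter_mem hW h1)
  have hπx : π x = h y := L.π_pt _ _
  rw [hπx] at h2
  have h3 := (hc y hy) h2
  rw [mem_map] at h3 ⊢
  filter_upwards [h3, hR y hy] with z hz hz'
  obtain ⟨x', ⟨hx'W, hx'⟩, hx'z⟩ := hz
  have hx'2 : r (π x) (π x') = θ x' - θ x := hx'
  rw [hx'z, hπx, hx, L.θ_pt] at hx'2
  have hz2 : r (h y) (h z) = R z - R y := hz'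
  -- The label `θ` and the function `R` change by the same amount, so the point over `h z` found
  -- close to `x` is the chosen lift.
  have : x' = L.pt (h z) (R z + c) := by
    refine L.inj ?_ ?_
    · rw [hx'z, L.π_pt]
    · rw [L.θ_pt]
      rw [hz2] at hx'2
      rw [eq_sub_iff_add_eq] at hx'2
      rw [← hx'2]; abel
  rw [mem_preimage, ← this]
  exact hx'W

end Labelling

variable {p : ℕ} {ρ' : H1 M →+ ZMod p} {π : C(E, M)} {r : M → M → ZMod p}

/-- Pulled back to the circle, the character vanishes exactly when the integral of `r` around the
loop does, which turns the lifting criterion into a condition on integrals. -/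
theorem IsAssociatedCovering.closed_iff (hπ : IsAssociatedCovering ρ' π) (hr : CocycleOn univ r)
    (hrρ : charOf hr = ρ') (γ : C(Circle, M)) (x : E) (hx : π x = γ 1) :
    (∃ γ' : C(Circle, E), π.comp γ' = γ ∧ γ' 1 = x) ↔
      pathPeriod r (γ.comp circlePath) = 0 := by
  have hd : CocycleOn univ (pullDiff γ r) := hr.pull γ.continuous.continuousOn (mapsTo_univ _ _)
  rw [hπ.lifts_iff γ x hx, show pathPeriod r (γ.comp circlePath) =
    pathPeriod (pullDiff γ r) circlePath from rfl, ← charOf_circle_eq_zero_iff hd]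
  constructor
  · intro h
    ext c
    rw [charOf_pull hr γ, hrρ]
    exact h c
  · intro h c
    rw [← hrρ, ← charOf_pull hr γ hd, h]
    rfl

theorem IsAssociatedCovering.loop_period (hπ : IsAssociatedCovering ρ' π) (hr : CocycleOn univ r)
    (hrρ : charOf hr = ρ') {x : E} (α : Path x x) :
    pathPeriod r (π.comp α.toContinuousMap) = 0 := by
  obtain ⟨γ, hγ, h1⟩ := exists_circle_map α
  rw [← hγ, ← ContinuousMap.comp_assoc]
  exact (hπ.closed_iff hr hrρ (π.comp γ) x (by simp [h1])).1 ⟨γ, rfl, h1⟩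

/-- The path projects to a loop. When the integral vanishes this loop has a closed lift from `x`,
and by uniqueness of lifts that lift is the given path. -/
theorem IsAssociatedCovering.eq_of_period (hπ : IsAssociatedCovering ρ' π)
    (hr : CocycleOn univ r)
    (hrρ : charOf hr = ρ') {x y : E} (α : Path x y) (hxy : π x = π y)
    (h : pathPeriod r (π.comp α.toContinuousMap) = 0) : x = y := by
  let β : Path (π x) (π x) := (α.map π.continuous).cast rfl hxy
  obtain ⟨γ, hγ, h1⟩ := exists_circle_map β
  have hβ : β.toContinuousMap = π.comp α.toContinuousMap := rfl
  rw [← hβ, ← hγ] at h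
  obtain ⟨γ', hγ', h1'⟩ := (hπ.closed_iff hr hrρ γ x h1.symm).2 h
  have h2 : (γ'.comp circlePath : I → E) = α := by
    refine hπ.isCoveringMap.eq_of_comp_eq (by fun_prop) α.continuous ?_ 0 ?_
    · have : π.comp (γ'.comp circlePath) = π.comp α.toContinuousMap := by
        rw [← hβ, ← hγ, ← ContinuousMap.comp_assoc, hγ']
      exact congrArg DFunLike.coe this
    · simp [circlePath_zero, h1']
  have h3 := congrFun h2 1
  rw [ContinuousMap.comp_apply, circlePath_one, h1', α.target] at h3
  exact h3

theorem _root_.IsCoveringMap.exists_lift_path {π : E → M} (hπ : IsCoveringMap π) (x : E) {m : M}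
    (α : Path (π x) m) : ∃ (y : E) (β : Path x y), π y = m ∧ ∀ t, π (β t) = α t := by
  have h0 := hπ.liftPath_zero α.toContinuousMap x α.source
  have h1 := hπ.liftPath_lifts α.toContinuousMap x α.source
  refine ⟨_, ⟨hπ.liftPath α.toContinuousMap x α.source, h0, rfl⟩, ?_, fun t => congrFun h1 t⟩
  exact (congrFun h1 1).trans α.target

/-- The covering associated to a nontrivial character of prime order has a labelling. -/
theorem IsAssociatedCovering.exists_labelling [Fact p.Prime] [PathConnectedSpace M]
    [LocallyPathConnectedSpace E]
    (hπ : IsAssociatedCovering ρ' π) (hr : CocycleOn univ r)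
    (hrρ : charOf hr = ρ') {m₀ : M} (α₀ : Path m₀ m₀)
    (hα₀ : pathPeriod r α₀.toContinuousMap ≠ 0) : ∃ θ, Labelling r π θ := by
  have := hπ.pathConnected
  have hd : CocycleOn univ (pullDiff π r) := hr.pull π.continuous.continuousOn (mapsTo_univ _ _)
  -- Loops in `E` project to loops that lift closed, so the pullback of `r` has no periods.
  obtain ⟨θ, hθ⟩ := exists_primitive_of_loops hd fun x α => hπ.loop_period hr hrρ α
  have hper : ∀ {x y : E} (β : Path x y),
      pathPeriod r (π.comp β.toContinuousMap) = θ y - θ x := fun {x y} β => by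
    rw [pathPeriod_comp hθ β.toContinuousMap (fun _ => mem_univ _) _ fun _ => rfl]
    show θ (β 1) - θ (β 0) = _
    rw [β.source, β.target]
  have hlift : ∀ (x : E) {m : M} (α : Path (π x) m), ∃ y, π y = m ∧
      θ y = θ x + pathPeriod r α.toContinuousMap := fun x m α => by
    obtain ⟨y, β, hy, hβ⟩ := hπ.isCoveringMap.exists_lift_path x α
    refine ⟨y, hy, ?_⟩
    have h1 : π.comp β.toContinuousMap = α.toContinuousMap := by
      ext t; exact hβ t
    rw [← h1, hper]
    abel
  refine ⟨θ, hπ.isCoveringMap.isOpenMap, hθ, fun {x y} hxy hθxy => ?_, fun m c => ?_⟩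
  · refine hπ.eq_of_period hr hrρ (PathConnectedSpace.somePath x y) hxy ?_
    rw [hper, hθxy, sub_self]
  · obtain ⟨x₁⟩ : Nonempty E := inferInstance
    obtain ⟨x₂, hx₂, -⟩ := hlift x₁ (PathConnectedSpace.somePath (π x₁) m₀)
    -- Each lift of `α₀` raises the label by its integral; as `p` is prime, the multiples of this
    -- nonzero element exhaust `ZMod p`.
    have key : ∀ n : ℕ, ∃ x, π x = m₀ ∧ θ x = θ x₂ + n * pathPeriod r α₀.toContinuousMap := by
      intro n
      induction n with
      | zero => exact ⟨x₂, hx₂, by simp⟩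
      | succ n ih =>
        obtain ⟨x, rfl, hθx⟩ := ih
        obtain ⟨y, hy, hθy⟩ := hlift x α₀
        exact ⟨y, hy, by rw [hθy, hθx]; push_cast; ring⟩
    let δ := PathConnectedSpace.somePath m₀ m
    obtain ⟨x, rfl, hθx⟩ := key ((c - pathPeriod r δ.toContinuousMap - θ x₂) /
      pathPeriod r α₀.toContinuousMap : ZMod p).val
    obtain ⟨y, hy, hθy⟩ := hlift x δ
    refine ⟨y, hy, ?_⟩
    rw [hθy, hθx, ZMod.natCast_val, ZMod.cast_id, div_mul_cancel₀ _ hα₀]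
    ring

end Covering

end LensCover

/-! ### Strong local contractibility along open embeddings and local homeomorphisms -/

section LocallyContractible

variable {X Y : Type*} [TopologicalSpace X] [TopologicalSpace Y]

theorem stronglyLocallyContractibleSpace_of_openEmbeddings
    (h : ∀ x : X, ∃ (Y : Type) (_ : TopologicalSpace Y) (_ : StronglyLocallyContractibleSpace Y)
      (f : Y → X), IsOpenEmbedding f ∧ x ∈ range f) : StronglyLocallyContractibleSpace X := by
  refine ⟨fun x => ?_⟩
  obtain ⟨Y, _, _, f, hf, y, rfl⟩ := h x
  rw [hasBasis_self]
  intro t ht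
  obtain ⟨s, ⟨hs, hsc⟩, hst⟩ :=
    (contractible_basis y).mem_iff.1 (hf.continuous.continuousAt ht)
  refine ⟨f '' s, hf.image_mem_nhds.2 hs, ?_, image_subset_iff.2 hst⟩
  exact (hf.isEmbedding.homeomorphImage s).contractibleSpace_iff.1 hsc

theorem IsLocalHomeomorph.stronglyLocallyContractibleSpace_left {X : Type} [TopologicalSpace X]
    {f : X → Y} (hf : IsLocalHomeomorph f) [StronglyLocallyContractibleSpace Y] :
    StronglyLocallyContractibleSpace X := by
  refine stronglyLocallyContractibleSpace_of_openEmbeddings fun x => ?_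
  obtain ⟨e, hx, -⟩ := hf x
  exact ⟨e.source, inferInstance, e.isOpenEmbedding_restrict.stronglyLocallyContractibleSpace,
    Subtype.val, e.open_source.isOpenEmbedding_subtypeVal, by simpa using hx⟩

theorem IsLocalHomeomorph.stronglyLocallyContractibleSpace_right {X : Type} [TopologicalSpace X]
    {f : X → Y} (hf : IsLocalHomeomorph f) (hs : Function.Surjective f)
    [StronglyLocallyContractibleSpace X] : StronglyLocallyContractibleSpace Y := by
  refine stronglyLocallyContractibleSpace_of_openEmbeddings fun y => ?_
  obtain ⟨x, rfl⟩ := hs y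
  obtain ⟨e, hx, rfl⟩ := hf x
  exact ⟨e.source, inferInstance, e.open_source.stronglyLocallyContractibleSpace,
    _, e.isOpenEmbedding_restrict, ⟨x, hx⟩, rfl⟩

instance (priority := 100) stronglyLocallyContractibleSpace_of_normedSpace {E : Type*}
    [NormedAddCommGroup E] [NormedSpace ℝ E] : StronglyLocallyContractibleSpace E :=
  .of_bases (fun _ => Metric.nhds_basis_ball) fun x r hr =>
    (convex_ball x r).contractibleSpace ⟨x, Metric.mem_ball_self hr⟩

end LocallyContractible

/-! ### Cocycles on subspaces and under embeddings -/

section Subtype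

variable {X A : Type*} [TopologicalSpace X] [AddCommGroup A]

theorem map_subtype_nhds {P : Set X} (x : P) : map Subtype.val (𝓝 x) = 𝓝[P] (x : X) :=
  map_nhds_subtype_val x

theorem PrimitiveOn.of_subtype {P : Set X} {d : X → X → A} {G : P → A}
    (hG : PrimitiveOn univ (pullDiff Subtype.val d) G) :
    ∃ G' : X → A, PrimitiveOn P d G' ∧ ∀ x : P, G' x = G x := by
  classical
  let G' : X → A := fun x => if h : x ∈ P then G ⟨x, h⟩ else 0
  have h : ∀ x : P, G' x = G x := fun x => by simp [G']
  refine ⟨G', fun x hx => ?_, h⟩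
  have h1 := hG ⟨x, hx⟩ (mem_univ _)
  rw [nhdsWithin_univ] at h1
  rw [← map_subtype_nhds ⟨x, hx⟩, eventually_map]
  filter_upwards [h1] with z hz
  rw [h z, show G' x = G ⟨x, hx⟩ from h ⟨x, hx⟩]
  exact hz

theorem CocycleOn.toSubtype {P : Set X} {d : X → X → A} (hG : CocycleOn P d) :
    CocycleOn (univ : Set P) (pullDiff Subtype.val d) :=
  hG.pull continuous_subtype_val.continuousOn fun x _ => x.2

theorem AcyclicOn.of_subtype {P : Set X} (h : AcyclicOn A (univ : Set P)) : AcyclicOn A P := by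
  intro d hd
  obtain ⟨G, hG⟩ := h _ hd.toSubtype
  obtain ⟨G', hG', -⟩ := hG.of_subtype
  exact ⟨G', hG'⟩

theorem Topology.IsEmbedding.continuousOn_invFun {Y : Type*} [TopologicalSpace Y] [Nonempty Y]
    {f : Y → X} (hf : IsEmbedding f) : ContinuousOn (Function.invFun f) (range f) := by
  rw [hf.isInducing.continuousOn_iff]
  refine continuousOn_id.congr ?_
  rintro _ ⟨y, rfl⟩
  simp [Function.leftInverse_invFun hf.injective y]

/-- Acyclicity passes to images under embeddings. -/
theorem AcyclicOn.image {Y : Type*} [TopologicalSpace Y] {Q : Set Y} (h : AcyclicOn A Q)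
    {f : Y → X} (hf : IsEmbedding f) : AcyclicOn A (f '' Q) := by
  rcases isEmpty_or_nonempty Y with hY | hY
  · exact fun d _ => ⟨0, fun x hx => by
      obtain ⟨y, -, -⟩ := hx
      exact (hY.false y).elim⟩
  refine h.of_retract (h := f) (k := Function.invFun f) hf.continuous.continuousOn
    (mapsTo_image f Q) (hf.continuousOn_invFun.mono (image_subset_range f Q)) ?_ ?_
  · rintro _ ⟨y, hy, rfl⟩
    rwa [Function.leftInverse_invFun hf.injective]
  · rintro _ ⟨y, hy, rfl⟩
    rw [Function.leftInverse_invFun hf.injective]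

end Subtype

namespace LensCover

/-! ### Removing a ball from a space -/

section Ball

variable {X A : Type} [TopologicalSpace X] [AddCommGroup A]

theorem one_lt_rank_E3 : 1 < Module.rank ℝ E3 := by
  rw [← Module.finrank_eq_rank]
  norm_num [finrank_euclideanSpace]

/-- The complement of the open ball, as a set. -/
abbrev outside (e : E3 → X) : Set X := (e '' Metric.ball (0 : E3) 1)ᶜ

/-- The closed ball. -/
abbrev inside (e : E3 → X) : Set X := e '' Metric.closedBall (0 : E3) 1

/-- The boundary sphere. -/
abbrev bdry (e : E3 → X) : Set X := e '' Metric.sphere (0 : E3) 1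

variable {e : E3 → X} (he : IsOpenEmbedding e)
include he

theorem outside_inter_inside : outside e ∩ inside e = bdry e := by
  ext x
  constructor
  · rintro ⟨hx, v, hv, rfl⟩
    refine ⟨v, ?_, rfl⟩
    have : v ∉ Metric.ball (0 : E3) 1 := fun h => hx ⟨v, h, rfl⟩
    simp only [Metric.mem_ball, Metric.mem_closedBall, Metric.mem_sphere] at *
    linarith
  · rintro ⟨v, hv, rfl⟩
    refine ⟨?_, v, Metric.sphere_subset_closedBall hv, rfl⟩
    rintro ⟨w, hw, hwv⟩
    obtain rfl := he.injective hwv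
    simp only [Metric.mem_ball, Metric.mem_sphere] at *
    linarith

omit [TopologicalSpace X] he in
theorem outside_union_inside : outside e ∪ inside e = univ := by
  refine eq_univ_of_forall fun x => ?_
  by_cases hx : x ∈ e '' Metric.ball (0 : E3) 1
  · exact Or.inr (image_mono Metric.ball_subset_closedBall hx)
  · exact Or.inl hx

theorem isClosed_outside : IsClosed (outside e) :=
  (he.isOpenMap _ Metric.isOpen_ball).isClosed_compl

theorem isClosed_inside [T2Space X] : IsClosed (inside e) :=
  ((isCompact_closedBall _ _).image he.continuous).isClosed

theorem isPreconnected_bdry : IsPreconnected (bdry e) :=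
  (isPreconnected_sphere one_lt_rank_E3 _ _).image _ he.continuous.continuousOn

theorem acyclicOn_inside : AcyclicOn A (inside e) := by
  refine (AcyclicOn.of_subtype ?_).image he.isEmbedding
  have h := convex_closedBall (0 : E3) 1
  have : ContractibleSpace (Metric.closedBall (0 : E3) 1) := h.contractibleSpace ⟨0, by simp⟩
  have : LocallyPathConnectedSpace (Metric.closedBall (0 : E3) 1) := h.locallyPathConnectedSpace
  exact acyclicOn_univ

theorem bdry_subset_outside : bdry e ⊆ outside e := fun _ hx =>
  ((outside_inter_inside he).symm ▸ hx : _ ∈ outside e ∩ inside e).1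

omit [TopologicalSpace X] he in
theorem bdry_nonempty (e : E3 → X) : (bdry e).Nonempty :=
  (NormedSpace.sphere_nonempty.2 zero_le_one).image _

theorem outside_mem_nhds [T2Space X] {x : X} (hx : x ∉ inside e) : outside e ∈ 𝓝 x := by
  refine mem_of_superset ((isClosed_inside he).isOpen_compl.mem_nhds hx) ?_
  exact compl_subset_compl.2 (image_mono Metric.ball_subset_closedBall)

theorem inside_mem_nhds {x : X} (hx : x ∉ outside e) : inside e ∈ 𝓝 x := by
  refine mem_of_superset ((isClosed_outside he).isOpen_compl.mem_nhds hx) ?_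
  rw [compl_compl]
  exact image_mono Metric.ball_subset_closedBall

/-- A cocycle that is exact outside of a ball is exact. -/
theorem exists_primitive_of_outside [T2Space X] {d : X → X → A} (hd : CocycleOn univ d)
    {G : X → A} (hG : PrimitiveOn (outside e) d G) : ∃ F, PrimitiveOn univ d F := by
  obtain ⟨K, hK⟩ := acyclicOn_inside he d (hd.mono (subset_univ _))
  refine PrimitiveOn.exists_of_cover (outside_union_inside (e := e))
    (fun x hx => outside_mem_nhds he hx) (fun x hx => inside_mem_nhds he hx) ?_ hG hK
  rw [outside_inter_inside he]
  exact isPreconnected_bdry he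

/-- A locally constant function on the complement is constant on the boundary sphere, so it extends
over the ball by that value and is constant because `X` is connected. -/
theorem isPreconnected_outside [T2Space X] [PreconnectedSpace X] :
    IsPreconnected (outside e) := by
  classical
  refine isPreconnected_of_forall_constant fun f hf x hx y hy => ?_
  obtain ⟨b, hb⟩ := bdry_nonempty e
  let g : X → Bool := fun x => if x ∈ outside e then f x else f b
  have h1 : ContinuousOn g (outside e) := hf.congr fun x hx => if_pos hx
  have h2 : ContinuousOn g (inside e) := by
    refine (continuousOn_const (c := f b)).congr fun x hx => ?_
    by_cases hxo : x ∈ outside e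
    · have hxb : x ∈ bdry e := outside_inter_inside he ▸ ⟨hxo, hx⟩
      simp only [g, if_pos hxo]
      exact (isPreconnected_bdry he).constant (hf.mono (bdry_subset_outside he)) hxb hb
    · exact if_neg hxo
  have h3 : Continuous g := by
    rw [← continuousOn_univ, ← outside_union_inside (e := e)]
    exact h1.union_of_isClosed h2 (isClosed_outside he) (isClosed_inside he)
  have h4 := PreconnectedSpace.constant ‹_› h3 (x := x) (y := y)
  simpa only [g, if_pos hx, if_pos hy] using h4

/-- The radial retraction onto the complement of the open ball. -/
noncomputable def radial (e : E3 → X) (x : X) : X :=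
  open Classical in
  -- The factor is `‖v‖⁻¹` in the unit ball and `1` beyond it; the value at the centre plays no
  -- role.
  if x ∈ range e then e ((min ‖Function.invFun e x‖ 1)⁻¹ • Function.invFun e x) else x

theorem radial_apply (v : E3) : radial e (e v) = e ((min ‖v‖ 1)⁻¹ • v) := by
  simp [radial, Function.leftInverse_invFun he.injective v]

theorem radial_of_mem {x : X} (hx : x ∈ outside e) : radial e x = x := by
  by_cases h : x ∈ range e
  · obtain ⟨v, rfl⟩ := h
    have hv : 1 ≤ ‖v‖ := by
      by_contra! hv
      exact hx ⟨v, by simpa using hv, rfl⟩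
    rw [radial_apply he, min_eq_right hv]
    simp
  · simp only [radial, if_neg h]

theorem radial_mem {x : X} (hx : x ≠ e 0) : radial e x ∈ outside e := by
  by_cases h : x ∈ range e
  · obtain ⟨v, rfl⟩ := h
    have hv : 0 < ‖v‖ := norm_pos_iff.2 fun h => hx (h ▸ rfl)
    rw [radial_apply he]
    rintro ⟨w, hw, hwv⟩
    obtain rfl := he.injective hwv
    have hm : 0 < min ‖v‖ 1 := lt_min hv one_pos
    rw [mem_ball_zero_iff, norm_smul, norm_inv, Real.norm_of_nonneg hm.le,
      inv_mul_lt_one₀ hm] at hw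
    exact absurd (min_le_left _ _) hw.not_ge
  · simp only [radial, if_neg h]
    rintro ⟨w, -, rfl⟩
    exact h ⟨w, rfl⟩

theorem continuousAt_radial [T2Space X] {x : X} (hx : x ≠ e 0) : ContinuousAt (radial e) x := by
  by_cases h : x ∈ inside e
  · obtain ⟨v, -, rfl⟩ := h
    have hv : 0 < ‖v‖ := norm_pos_iff.2 fun h => hx (h ▸ rfl)
    have hm : min ‖v‖ 1 ≠ 0 := (lt_min hv one_pos).ne'
    rw [← he.continuousAt_iff, show radial e ∘ e = fun v => e ((min ‖v‖ 1)⁻¹ • v) from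
      funext (radial_apply he)]
    refine he.continuous.continuousAt.comp ?_
    have h1 : ContinuousAt (fun v : E3 => min ‖v‖ 1) v := by fun_prop
    exact (h1.inv₀ hm).smul continuousAt_id
  · refine continuousAt_id.congr ?_
    filter_upwards [outside_mem_nhds he h] with y hy
    exact (radial_of_mem he hy).symm

/-- The radial retraction presents the punctured space, which has a boundary, as a quotient of the
open set `{e 0}ᶜ`, and quotients inherit local path connectedness. -/
theorem locallyPathConnectedSpace_punctured [T2Space X] [LocallyPathConnectedSpace X] :
    LocallyPathConnectedSpace (Punctured e) := by
  have h0 : LocallyPathConnectedSpace ({e 0}ᶜ : Set X) :=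
    isOpen_compl_singleton.locallyPathConnectedSpace
  let f : ({e 0}ᶜ : Set X) → Punctured e := fun x => ⟨radial e x, radial_mem he x.2⟩
  let g : Punctured e → ({e 0}ᶜ : Set X) := fun x => ⟨x, fun h => x.2 ⟨0, by simp, h.symm⟩⟩
  have hf : Continuous f := by
    refine Continuous.subtype_mk (continuous_iff_continuousAt.2 fun x => ?_) _
    exact (continuousAt_radial he x.2).comp continuous_subtype_val.continuousAt
  have hg : Continuous g := continuous_subtype_val.subtype_mk _
  exact (IsQuotientMap.of_inverse hg hf
    fun x => Subtype.ext (radial_of_mem he x.2)).locallyPathConnectedSpace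

theorem pathConnectedSpace_punctured [T2Space X] [LocallyPathConnectedSpace X]
    [PreconnectedSpace X] : PathConnectedSpace (Punctured e) := by
  have := locallyPathConnectedSpace_punctured he
  rw [pathConnectedSpace_iff_connectedSpace]
  have : PreconnectedSpace (Punctured e) :=
    isPreconnected_iff_preconnectedSpace.1 (isPreconnected_outside he)
  obtain ⟨b, hb⟩ := bdry_nonempty e
  exact ⟨⟨b, bdry_subset_outside he hb⟩⟩

end Ball

end LensCover

namespace LensCover

/-! ### The lens space as a quotient of the three-sphere -/

section Lens

variable (s : ℕ) [NeZero s] (q : ℤ)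

theorem norm_rootOfUnity (ζ : rootsOfUnity s ℂ) : ‖((ζ : ℂˣ) : ℂ)‖ = 1 :=
  Complex.norm_eq_one_of_pow_eq_one (n := s)
    (by rw [← Units.val_pow_eq_pow_val, (mem_rootsOfUnity s _).1 ζ.2, Units.val_one]) (NeZero.ne s)

/-- The action of the `s`-th roots of unity on the three-sphere with weights `1` and `q`. -/
noncomputable abbrev lensAction : MulAction (rootsOfUnity s ℂ) S3 where
  smul ζ v := ⟨WithLp.toLp 2 ![((ζ : ℂˣ) : ℂ) * v.1 0, (((ζ : ℂˣ) ^ q : ℂˣ) : ℂ) * v.1 1], by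
    have h1 := norm_eq_of_mem_sphere v
    rw [EuclideanSpace.norm_eq] at h1
    rw [mem_sphere_zero_iff_norm, EuclideanSpace.norm_eq]
    simpa [Fin.sum_univ_two, norm_rootOfUnity s ζ] using h1⟩
  one_smul v := by
    refine Subtype.ext (PiLp.ext fun i => ?_)
    change (![_, _] : Fin 2 → ℂ) i = _
    fin_cases i <;> simp
  mul_smul ζ ξ v := by
    refine Subtype.ext (PiLp.ext fun i => ?_)
    change (![_, _] : Fin 2 → ℂ) i = (![_, _] : Fin 2 → ℂ) i
    fin_cases i
    · exact mul_assoc (((ζ : ℂˣ) : ℂ)) ((ξ : ℂˣ) : ℂ) (v.1 0)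
    · change (((((ζ * ξ : rootsOfUnity s ℂ) : ℂˣ) ^ q : ℂˣ) : ℂ)) * v.1 1 =
        (((ζ : ℂˣ) ^ q : ℂˣ) : ℂ) * ((((ξ : ℂˣ) ^ q : ℂˣ) : ℂ) * v.1 1)
      rw [Subgroup.coe_mul, mul_zpow, Units.val_mul, mul_assoc]

theorem lensSetoid_eq : lensSetoid s q = @MulAction.orbitRel _ S3 _ (lensAction s q) := by
  let _ := lensAction s q
  ext x y
  refine Iff.trans ?_ (Setoid.comm' (MulAction.orbitRel _ S3))
  rw [MulAction.orbitRel_apply]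
  constructor
  · rintro ⟨ζ, hζ, h0, h1⟩
    refine ⟨⟨ζ, hζ⟩, Subtype.ext (PiLp.ext fun i => ?_)⟩
    fin_cases i
    · exact h0.symm
    · exact h1.symm
  · rintro ⟨⟨ζ, hζ⟩, rfl⟩
    exact ⟨ζ, hζ, rfl, rfl⟩

theorem continuousConstSMul_lensAction :
    @ContinuousConstSMul (rootsOfUnity s ℂ) S3 _ (lensAction s q).toSMul := by
  let _ := lensAction s q
  refine ⟨fun ζ => Continuous.subtype_mk ?_ _⟩
  refine (PiLp.continuous_toLp 2 _).comp (continuous_pi fun i => ?_)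
  fin_cases i
  · change Continuous fun v : S3 => ((ζ : ℂˣ) : ℂ) * v.1 0
    fun_prop
  · change Continuous fun v : S3 => (((ζ : ℂˣ) ^ q : ℂˣ) : ℂ) * v.1 1
    fun_prop

/-- A root of unity that fixes a point with nonzero first coordinate is `1`. At the other points it
satisfies `ζ ^ s = ζ ^ q = 1`, and coprimality gives `ζ = 1`. -/
theorem isCancelSMul_lensAction (hsq : IsCoprime (s : ℤ) q) :
    @IsCancelSMul (rootsOfUnity s ℂ) S3 (lensAction s q).toSMul := by
  let _ := lensAction s q
  rw [isCancelSMul_iff_eq_one_of_smul_eq]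
  intro ζ v hv
  have h0 : ((ζ : ℂˣ) : ℂ) * v.1 0 = v.1 0 := congrArg (fun w : S3 => w.1 0) hv
  have h1 : (((ζ : ℂˣ) ^ q : ℂˣ) : ℂ) * v.1 1 = v.1 1 := congrArg (fun w : S3 => w.1 1) hv
  refine Subtype.ext ?_
  by_cases hv0 : v.1 0 = 0
  · have hv1 : v.1 1 ≠ 0 := fun hv1 => by
      have h := norm_eq_of_mem_sphere v
      rw [EuclideanSpace.norm_eq] at h
      simp [Fin.sum_univ_two, hv0, hv1] at h
    have hq : (ζ : ℂˣ) ^ q = 1 := Units.ext (mul_eq_right₀ hv1 |>.1 h1)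
    have hs : (ζ : ℂˣ) ^ (s : ℤ) = 1 := by
      rw [zpow_natCast]
      exact ζ.2
    obtain ⟨a, b, hab⟩ := hsq
    calc (ζ : ℂˣ) = (ζ : ℂˣ) ^ (a * s + b * q) := by rw [hab, zpow_one]
      _ = 1 := by rw [zpow_add, mul_comm a, mul_comm b, zpow_mul, zpow_mul, hq, hs]; simp
  · exact Units.ext (mul_eq_right₀ hv0 |>.1 h0)

theorem isQuotientCoveringMap_lens (hsq : IsCoprime (s : ℤ) q) :
    @IsQuotientCoveringMap S3 (LensSpace s q) _ _ (Quotient.mk (lensSetoid s q))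
      (rootsOfUnity s ℂ) _ (lensAction s q) := by
  let _ := lensAction s q
  have := continuousConstSMul_lensAction s q
  have := isCancelSMul_lensAction s q hsq
  have h := isQuotientCoveringMap_quotientMk_of_properlyDiscontinuousSMul (E := S3)
    (G := rootsOfUnity s ℂ)
  rwa [← lensSetoid_eq s q] at h

instance t2Space_lens : T2Space (LensSpace s q) := by
  let _ := lensAction s q
  have := continuousConstSMul_lensAction s q
  have h : T2Space (Quotient (MulAction.orbitRel (rootsOfUnity s ℂ) S3)) := inferInstance
  rwa [← lensSetoid_eq s q] at h

instance stronglyLocallyContractibleSpace_sphere {n : ℕ} :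
    StronglyLocallyContractibleSpace (Metric.sphere (0 : EuclideanSpace ℂ (Fin n)) 1) := by
  let _ : InnerProductSpace ℝ (EuclideanSpace ℂ (Fin n)) := InnerProductSpace.complexToReal
  refine stronglyLocallyContractibleSpace_of_openEmbeddings fun v => ?_
  have hv : ‖(-v : EuclideanSpace ℂ (Fin n))‖ = 1 := by simp
  refine ⟨_, _, inferInstance, _, isOpenEmbedding_stereographic_symm hv,
    stereographic hv v, (stereographic hv).left_inv ?_⟩
  rw [stereographic_source, mem_compl_singleton_iff, Ne, Subtype.ext_iff]
  intro h
  have h2 : (v : EuclideanSpace ℂ (Fin n)) = 0 :=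
    PiLp.ext fun i => self_eq_neg.1 (congrArg (fun w : EuclideanSpace ℂ (Fin n) => w i) h)
  simpa [h2] using norm_eq_of_mem_sphere v

theorem finrank_real_complex_plane : Module.finrank ℝ (EuclideanSpace ℂ (Fin 2)) = 4 := by
  rw [← Module.finrank_mul_finrank ℝ ℂ]
  simp

instance pathConnectedSpace_S3 : PathConnectedSpace S3 := by
  rw [← isPathConnected_iff_pathConnectedSpace]
  refine isPathConnected_sphere ?_ _ zero_le_one
  rw [← Module.finrank_eq_rank, finrank_real_complex_plane]
  norm_num

theorem acyclicOn_S3 {A : Type*} [AddCommGroup A] : AcyclicOn A (univ : Set S3) := by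
  let _ : InnerProductSpace ℝ (EuclideanSpace ℂ (Fin 2)) := InnerProductSpace.complexToReal
  exact acyclicOn_sphere (by rw [finrank_real_complex_plane]; norm_num)

instance pathConnectedSpace_lens : PathConnectedSpace (LensSpace s q) :=
  inferInstance

theorem stronglyLocallyContractibleSpace_lens (hsq : IsCoprime (s : ℤ) q) :
    StronglyLocallyContractibleSpace (LensSpace s q) :=
  let _ := lensAction s q
  (isQuotientCoveringMap_lens s q hsq).isCoveringMap.isLocalHomeomorph
    |>.stronglyLocallyContractibleSpace_right Quotient.mk_surjective

end Lens
end LensCover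

namespace LensCover

/-! ### Topology and charts of the connected sum -/

section ConnSum

variable {X Y : Type} [TopologicalSpace X] [TopologicalSpace Y] {e₁ : E3 → X} {e₂ : E3 → Y}

theorem sphere_mem_outside (he₁ : IsOpenEmbedding e₁) {v : E3} (hv : ‖v‖ = 1) :
    e₁ v ∈ outside e₁ :=
  bdry_subset_outside he₁ ⟨v, by simpa using hv, rfl⟩

/-- A partial inverse of the map of the first punctured space to the connected sum. -/
noncomputable def ConnSum.toOption (he₂ : IsOpenEmbedding e₂) : ConnSum e₁ e₂ → Option X :=
  open Classical in
  Quot.lift (Sum.elim (fun a => some a.1)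
    -- Only points of the boundary sphere have a partner in the first piece; `none` marks the rest.
    fun b => if b.1 ∈ bdry e₂ then some (e₁ (Function.invFun e₂ b.1)) else none) (by
    rintro (a | a) (b | b) h
    · exact h.elim
    · obtain ⟨x, hx, ha, hb⟩ := h
      have hb' : b.1 ∈ bdry e₂ := ⟨x, hx, hb.symm⟩
      rw [Sum.elim_inl, Sum.elim_inr, if_pos hb', hb, ha,
        Function.leftInverse_invFun he₂.injective x]
    · exact h.elim
    · exact h.elim)

theorem ConnSum.fromLeft_injective (he₂ : IsOpenEmbedding e₂) :
    Function.Injective (ConnSum.fromLeft e₁ e₂) := fun _ _ h =>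
  Subtype.ext (Option.some_injective _ (congrArg (ConnSum.toOption he₂) h))

theorem ConnSum.fromLeft_eq_fromRight (he₂ : IsOpenEmbedding e₂) {a : Punctured e₁}
    {b : Punctured e₂} : ConnSum.fromLeft e₁ e₂ a = ConnSum.fromRight e₁ e₂ b ↔
      ∃ x : E3, ‖x‖ = 1 ∧ a.1 = e₁ x ∧ b.1 = e₂ x := by
  classical
  constructor
  · intro h
    have h1 := congrArg (ConnSum.toOption he₂) h
    simp only [ConnSum.toOption, ConnSum.fromLeft, ConnSum.fromRight, ContinuousMap.coe_mk,
      Sum.elim_inl, Sum.elim_inr] at h1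
    split_ifs at h1 with hb
    · obtain ⟨x, hx, hxb⟩ := hb
      rw [← hxb, Function.leftInverse_invFun he₂.injective x] at h1
      exact ⟨x, by simpa using hx, Option.some_injective _ h1, hxb.symm⟩
  · rintro ⟨x, hx, ha, hb⟩
    exact Quot.sound ⟨x, by simpa using hx, ha, hb⟩

theorem ConnSum.forall {P : ConnSum e₁ e₂ → Prop} :
    (∀ m, P m) ↔ (∀ a, P (fromLeft e₁ e₂ a)) ∧ ∀ b, P (fromRight e₁ e₂ b) :=
  ⟨fun h => ⟨fun _ => h _, fun _ => h _⟩, fun h m => Quot.ind (Sum.rec h.1 h.2) m⟩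

/-- The symmetry of the connected sum. -/
def ConnSum.swap (e₁ : E3 → X) (e₂ : E3 → Y) : C(ConnSum e₁ e₂, ConnSum e₂ e₁) where
  toFun := Quot.lift (Sum.elim (fromRight e₂ e₁) (fromLeft e₂ e₁)) (by
    rintro (a | a) (b | b) h
    · exact h.elim
    · obtain ⟨x, hx, ha, hb⟩ := h
      exact (Quot.sound ⟨x, hx, hb, ha⟩ : fromLeft e₂ e₁ b = fromRight e₂ e₁ a).symm
    · exact h.elim
    · exact h.elim)
  continuous_toFun := continuous_quot_lift _
    (Continuous.sumElim (fromRight e₂ e₁).continuous (fromLeft e₂ e₁).continuous)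

theorem ConnSum.swap_fromLeft (a : Punctured e₁) :
    swap e₁ e₂ (fromLeft e₁ e₂ a) = fromRight e₂ e₁ a := rfl

theorem ConnSum.swap_fromRight (b : Punctured e₂) :
    swap e₁ e₂ (fromRight e₁ e₂ b) = fromLeft e₂ e₁ b := rfl

theorem ConnSum.swap_swap (m : ConnSum e₁ e₂) : swap e₂ e₁ (swap e₁ e₂ m) = m :=
  (ConnSum.forall (P := fun m => swap e₂ e₁ (swap e₁ e₂ m) = m)).2
    ⟨fun _ => rfl, fun _ => rfl⟩ m

/-- The symmetry of the connected sum, as a homeomorphism. -/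
def ConnSum.swapHomeo (e₁ : E3 → X) (e₂ : E3 → Y) : ConnSum e₁ e₂ ≃ₜ ConnSum e₂ e₁ where
  toFun := swap e₁ e₂
  invFun := swap e₂ e₁
  left_inv := swap_swap
  right_inv := swap_swap
  continuous_toFun := (swap e₁ e₂).continuous
  continuous_invFun := (swap e₂ e₁).continuous

theorem ConnSum.isClosed_iff {s : Set (ConnSum e₁ e₂)} : IsClosed s ↔
    IsClosed (fromLeft e₁ e₂ ⁻¹' s) ∧ IsClosed (fromRight e₁ e₂ ⁻¹' s) := by
  rw [← isQuotientMap_quot_mk.isClosed_preimage, isClosed_sum_iff]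
  rfl

theorem ConnSum.isOpen_iff {s : Set (ConnSum e₁ e₂)} : IsOpen s ↔
    IsOpen (fromLeft e₁ e₂ ⁻¹' s) ∧ IsOpen (fromRight e₁ e₂ ⁻¹' s) := by
  rw [← isQuotientMap_quot_mk.isOpen_preimage, isOpen_sum_iff]
  rfl

/-- On the second piece a closed subset of the first leaves the image of a compact part of the
gluing sphere, and this is closed. -/
theorem ConnSum.isClosedEmbedding_fromLeft [T2Space Y] (he₁ : IsOpenEmbedding e₁)
    (he₂ : IsOpenEmbedding e₂) : IsClosedEmbedding (fromLeft e₁ e₂) := by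
  refine .of_continuous_injective_isClosedMap (fromLeft e₁ e₂).continuous
    (fromLeft_injective he₂) fun C hC => isClosed_iff.2 ⟨?_, ?_⟩
  · rwa [preimage_image_eq _ (fromLeft_injective he₂)]
  · have h1 : IsClosed ((Subtype.val : Punctured e₁ → X) '' C) :=
      (isClosed_outside he₁).isClosedMap_subtype_val _ hC
    have h2 : IsCompact (Metric.sphere (0 : E3) 1 ∩ e₁ ⁻¹' (Subtype.val '' C)) :=
      (isCompact_sphere _ _).inter_right (h1.preimage he₁.continuous)
    convert (h2.image he₂.continuous).isClosed.preimage
      (continuous_subtype_val : Continuous (Subtype.val : Punctured e₂ → Y)) using 1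
    ext b
    constructor
    · rintro ⟨a, ha, hab⟩
      obtain ⟨x, hx, hax, hbx⟩ := (fromLeft_eq_fromRight he₂).1 hab
      exact ⟨x, ⟨by simpa using hx, a, ha, hax⟩, hbx.symm⟩
    · rintro ⟨x, ⟨hx, a, ha, hax⟩, hbx⟩
      exact ⟨a, ha, (fromLeft_eq_fromRight he₂).2 ⟨x, by simpa using hx, hax, hbx.symm⟩⟩

theorem ConnSum.isClosedEmbedding_fromRight [T2Space X] (he₁ : IsOpenEmbedding e₁)
    (he₂ : IsOpenEmbedding e₂) : IsClosedEmbedding (fromRight e₁ e₂) :=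
  (swapHomeo e₂ e₁).isClosedEmbedding.comp (isClosedEmbedding_fromLeft he₂ he₁)

theorem ConnSum.range_union_range :
    range (fromLeft e₁ e₂) ∪ range (fromRight e₁ e₂) = univ :=
  eq_univ_of_forall (ConnSum.forall.2 ⟨fun a => Or.inl ⟨a, rfl⟩, fun b => Or.inr ⟨b, rfl⟩⟩)

theorem ConnSum.pathConnectedSpace [PathConnectedSpace (Punctured e₁)]
    [PathConnectedSpace (Punctured e₂)] (he₁ : IsOpenEmbedding e₁) (he₂ : IsOpenEmbedding e₂) :
    PathConnectedSpace (ConnSum e₁ e₂) := by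
  rw [pathConnectedSpace_iff_univ, ← range_union_range]
  refine (isPathConnected_range (fromLeft e₁ e₂).continuous).union
    (isPathConnected_range (fromRight e₁ e₂).continuous) ?_
  obtain ⟨v, hv⟩ := NormedSpace.sphere_nonempty (x := (0 : E3)).2 zero_le_one
  rw [mem_sphere_zero_iff_norm] at hv
  exact ⟨_, ⟨⟨e₁ v, sphere_mem_outside he₁ hv⟩, rfl⟩, ⟨⟨e₂ v, sphere_mem_outside he₂ hv⟩,
    ((fromLeft_eq_fromRight he₂).2 ⟨v, hv, rfl, rfl⟩).symm⟩⟩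

/-- The chart away from the gluing sphere: its image is the complement of the closed second piece.
-/
theorem ConnSum.isOpenEmbedding_interior [T2Space X] [T2Space Y] (he₁ : IsOpenEmbedding e₁)
    (he₂ : IsOpenEmbedding e₂) :
    IsOpenEmbedding fun x : ((inside e₁)ᶜ : Set X) =>
      fromLeft e₁ e₂ ⟨x, compl_subset_compl.2 (image_mono Metric.ball_subset_closedBall) x.2⟩ := by
  refine ⟨(isClosedEmbedding_fromLeft he₁ he₂).isEmbedding.comp
    (IsEmbedding.inclusion (compl_subset_compl.2 (image_mono Metric.ball_subset_closedBall))),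
    ?_⟩
  convert (isClosedEmbedding_fromRight he₁ he₂).isClosed_range.isOpen_compl using 1
  ext m
  revert m
  refine ConnSum.forall.2 ⟨fun a => ?_, fun b => ?_⟩
  · constructor
    · rintro ⟨x, hx⟩ ⟨b, hb⟩
      obtain ⟨v, hv, hxv, -⟩ := (fromLeft_eq_fromRight he₂).1 (hx.trans hb.symm)
      exact x.2 ⟨v, by simp [hv], hxv.symm⟩
    · intro ha
      refine ⟨⟨a.1, ?_⟩, rfl⟩
      rintro hai
      obtain ⟨v, hv, hav⟩ := (outside_inter_inside he₁).subset ⟨a.2, hai⟩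
      rw [mem_sphere_zero_iff_norm] at hv
      exact ha ⟨⟨e₂ v, sphere_mem_outside he₂ hv⟩,
        ((fromLeft_eq_fromRight he₂).2 ⟨v, hv, hav.symm, rfl⟩).symm⟩
  · constructor
    · rintro ⟨x, hx⟩ -
      obtain ⟨v, hv, hxv, -⟩ := (fromLeft_eq_fromRight he₂).1 hx
      exact x.2 ⟨v, by simp [hv], hxv.symm⟩
    · exact fun h => (h ⟨b, rfl⟩).elim

/-- The punctured Euclidean space. -/
abbrev PuncturedE3 : Type := {v : E3 // v ≠ 0}

/-- Inversion in the unit sphere. -/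
noncomputable def inversion (v : PuncturedE3) : PuncturedE3 :=
  ⟨(‖(v : E3)‖ ^ 2)⁻¹ • (v : E3), by simp [v.2]⟩

theorem norm_inversion (v : PuncturedE3) : ‖(inversion v : E3)‖ = ‖(v : E3)‖⁻¹ := by
  have h : ‖(v : E3)‖ ≠ 0 := norm_ne_zero_iff.2 v.2
  simp only [inversion, norm_smul, norm_inv, norm_pow, norm_norm]
  field_simp

theorem inversion_inversion (v : PuncturedE3) : inversion (inversion v) = v := by
  have h : ‖(v : E3)‖ ≠ 0 := norm_ne_zero_iff.2 v.2
  refine Subtype.ext ?_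
  change (‖(inversion v : E3)‖ ^ 2)⁻¹ • ((‖(v : E3)‖ ^ 2)⁻¹ • (v : E3)) = v
  rw [norm_inversion, smul_smul]
  field_simp
  simp

theorem continuous_inversion : Continuous inversion := by
  have h : Continuous fun v : PuncturedE3 => ‖(v : E3)‖ ^ 2 := by fun_prop
  refine Continuous.subtype_mk ((h.inv₀ fun v => ?_).smul continuous_subtype_val) _
  simpa using v.2

/-- Inversion, as a homeomorphism. -/
noncomputable def inversionHomeo : PuncturedE3 ≃ₜ PuncturedE3 where
  toFun := inversion
  invFun := inversion
  left_inv := inversion_inversion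
  right_inv := inversion_inversion
  continuous_toFun := continuous_inversion
  continuous_invFun := continuous_inversion

theorem mem_outside (he₁ : IsOpenEmbedding e₁) {v : E3} (hv : 1 ≤ ‖v‖) : e₁ v ∈ outside e₁ := by
  rintro ⟨w, hw, hwv⟩
  obtain rfl := he₁.injective hwv
  exact absurd hv (by simpa using hw)

/-- The chart of the connected sum around the sphere. -/
noncomputable def ConnSum.neck (he₁ : IsOpenEmbedding e₁) (he₂ : IsOpenEmbedding e₂)
    (v : PuncturedE3) : ConnSum e₁ e₂ :=
  -- Inversion fixes the unit sphere and sends the punctured open ball to the exterior, so the two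
  -- formulas match along the gluing sphere.
  if h : 1 ≤ ‖(v : E3)‖ then fromLeft e₁ e₂ ⟨e₁ v, mem_outside he₁ h⟩
  else fromRight e₁ e₂ ⟨e₂ (inversion v), mem_outside he₂ (by
    rw [norm_inversion]
    exact (one_le_inv₀ (norm_pos_iff.2 v.2)).2 (not_le.1 h).le)⟩

theorem ConnSum.neck_of_le (he₁ : IsOpenEmbedding e₁) (he₂ : IsOpenEmbedding e₂)
    (v : PuncturedE3) (h : 1 ≤ ‖(v : E3)‖) :
    neck he₁ he₂ v = fromLeft e₁ e₂ ⟨e₁ v, mem_outside he₁ h⟩ := dif_pos h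

/-- The symmetry that reduces claims about the second piece to claims about the first. -/
theorem ConnSum.neck_inversion (he₁ : IsOpenEmbedding e₁) (he₂ : IsOpenEmbedding e₂)
    (v : PuncturedE3) : neck he₂ he₁ (inversion v) = swap e₁ e₂ (neck he₁ he₂ v) := by
  have hv := norm_pos_iff.2 v.2
  rcases lt_trichotomy ‖(v : E3)‖ 1 with h | h | h
  · rw [neck_of_le, neck, dif_neg h.not_ge, swap_fromRight]
    rw [norm_inversion]
    exact (one_le_inv₀ hv).2 h.le
  · have h' : inversion v = v := Subtype.ext (by simp [inversion, h])
    rw [h', neck_of_le _ _ _ h.ge, neck_of_le _ _ _ h.ge, swap_fromLeft]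
    exact (fromLeft_eq_fromRight he₁).2 ⟨v, h, rfl, rfl⟩
  · rw [neck_of_le _ _ v h.le, neck, dif_neg, swap_fromLeft]
    · simp only [inversion_inversion]
    · rw [norm_inversion, not_le]
      exact inv_lt_one_of_one_lt₀ h

theorem ConnSum.neck_eq_fromLeft (he₁ : IsOpenEmbedding e₁) (he₂ : IsOpenEmbedding e₂)
    {v : PuncturedE3} {a : Punctured e₁} : neck he₁ he₂ v = fromLeft e₁ e₂ a ↔ e₁ v = a.1 := by
  have hv := norm_pos_iff.2 v.2
  constructor
  · by_cases h : 1 ≤ ‖(v : E3)‖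
    · rw [neck_of_le _ _ _ h]
      exact fun h' => congrArg Subtype.val (fromLeft_injective he₂ h')
    · intro h'
      rw [neck, dif_neg h, eq_comm, fromLeft_eq_fromRight he₂] at h'
      obtain ⟨x, hx, -, hvx⟩ := h'
      have h2 := congrArg norm (he₂.injective hvx)
      rw [norm_inversion, hx, inv_eq_one] at h2
      exact (h h2.ge).elim
  · intro h
    have h1 : 1 ≤ ‖(v : E3)‖ := by
      by_contra! h1
      exact a.2 ⟨v, by simpa using h1, h⟩
    rw [neck_of_le _ _ _ h1]
    exact congrArg _ (Subtype.ext h)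

theorem ConnSum.neck_injective (he₁ : IsOpenEmbedding e₁) (he₂ : IsOpenEmbedding e₂) :
    Function.Injective (neck he₁ he₂) := by
  have key : ∀ {X Y : Type} [TopologicalSpace X] [TopologicalSpace Y] {e₁ : E3 → X} {e₂ : E3 → Y}
      (he₁ : IsOpenEmbedding e₁) (he₂ : IsOpenEmbedding e₂) (v w : PuncturedE3),
      1 ≤ ‖(w : E3)‖ → neck he₁ he₂ v = neck he₁ he₂ w → v = w := by
    intro X Y _ _ e₁ e₂ he₁ he₂ v w hw h
    rw [neck_of_le _ _ _ hw, neck_eq_fromLeft he₁ he₂] at h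
    exact Subtype.ext (he₁.injective h)
  intro v w h
  rcases le_total 1 ‖(w : E3)‖ with hw | hw
  · exact key he₁ he₂ v w hw h
  · refine inversionHomeo.injective (key he₂ he₁ _ _ ?_ ?_)
    · change 1 ≤ ‖(inversion w : E3)‖
      rw [norm_inversion]
      exact (one_le_inv₀ (norm_pos_iff.2 w.2)).2 hw
    · exact (neck_inversion he₁ he₂ v).trans
        ((congrArg _ h).trans (neck_inversion he₁ he₂ w).symm)

theorem ConnSum.continuousOn_neck (he₁ : IsOpenEmbedding e₁) (he₂ : IsOpenEmbedding e₂) :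
    ContinuousOn (neck he₁ he₂) {v | 1 ≤ ‖(v : E3)‖} := by
  rw [continuousOn_iff_continuous_domRestrict]
  have h : Continuous fun v : {v : PuncturedE3 | 1 ≤ ‖(v : E3)‖} =>
      fromLeft e₁ e₂ ⟨e₁ v.1, mem_outside he₁ v.2⟩ :=
    (fromLeft e₁ e₂).continuous.comp (Continuous.subtype_mk
      (he₁.continuous.comp (continuous_subtype_val.comp continuous_subtype_val)) _)
  exact h.congr fun v => (neck_of_le he₁ he₂ _ v.2).symm

theorem ConnSum.continuous_neck (he₁ : IsOpenEmbedding e₁) (he₂ : IsOpenEmbedding e₂) :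
    Continuous (neck he₁ he₂) := by
  have hu : {v : PuncturedE3 | 1 ≤ ‖(v : E3)‖} ∪ {v | ‖(v : E3)‖ ≤ 1} = univ :=
    eq_univ_of_forall fun v => le_total 1 ‖(v : E3)‖
  rw [← continuousOn_univ, ← hu]
  refine (continuousOn_neck he₁ he₂).union_of_isClosed ?_
    (isClosed_le (by fun_prop) (by fun_prop)) (isClosed_le (by fun_prop) (by fun_prop))
  have h := ((swap e₂ e₁).continuous.comp_continuousOn (continuousOn_neck he₂ he₁)).comp
    continuous_inversion.continuousOn
    (s := {v : PuncturedE3 | ‖(v : E3)‖ ≤ 1}) fun v hv => by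
      change 1 ≤ ‖(inversion v : E3)‖
      rw [norm_inversion]
      exact (one_le_inv₀ (norm_pos_iff.2 v.2)).2 hv
  refine h.congr fun v _ => ?_
  simp only [Function.comp_apply]
  rw [← neck_inversion, inversion_inversion]

theorem ConnSum.isOpenEmbedding_neck (he₁ : IsOpenEmbedding e₁) (he₂ : IsOpenEmbedding e₂) :
    IsOpenEmbedding (neck he₁ he₂) := by
  have key : ∀ {X Y : Type} [TopologicalSpace X] [TopologicalSpace Y] {e₁ : E3 → X} {e₂ : E3 → Y}
      (he₁ : IsOpenEmbedding e₁) (he₂ : IsOpenEmbedding e₂) (U : Set PuncturedE3), IsOpen U →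
      IsOpen (fromLeft e₁ e₂ ⁻¹' (neck he₁ he₂ '' U)) := by
    intro X Y _ _ e₁ e₂ he₁ he₂ U hU
    convert (he₁.isOpenMap _ (isOpen_ne.isOpenMap_subtype_val U hU)).preimage
      (continuous_subtype_val : Continuous (Subtype.val : Punctured e₁ → X)) using 1
    ext a
    simp [neck_eq_fromLeft he₁ he₂, eq_comm]
  refine .of_continuous_injective_isOpenMap (continuous_neck he₁ he₂) (neck_injective he₁ he₂)
    fun U hU => isOpen_iff.2 ⟨key he₁ he₂ U hU, ?_⟩
  convert key he₂ he₁ (inversion '' U) (inversionHomeo.isOpenMap U hU) using 1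
  rw [image_image]
  simp only [neck_inversion]
  rw [← image_image (swap e₁ e₂) (neck he₁ he₂)]
  ext b
  exact ((swapHomeo e₁ e₂).injective.mem_set_image (a := fromRight e₁ e₂ b)).symm

theorem ConnSum.stronglyLocallyContractibleSpace [T2Space X] [T2Space Y]
    [StronglyLocallyContractibleSpace X] [StronglyLocallyContractibleSpace Y]
    (he₁ : IsOpenEmbedding e₁) (he₂ : IsOpenEmbedding e₂) :
    StronglyLocallyContractibleSpace (ConnSum e₁ e₂) := by
  have key : ∀ {X Y : Type} [TopologicalSpace X] [TopologicalSpace Y] {e₁ : E3 → X} {e₂ : E3 → Y}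
      [T2Space X] [T2Space Y] [StronglyLocallyContractibleSpace X]
      (he₁ : IsOpenEmbedding e₁) (he₂ : IsOpenEmbedding e₂) (a : Punctured e₁),
      ∃ (Z : Type) (_ : TopologicalSpace Z) (_ : StronglyLocallyContractibleSpace Z)
      (f : Z → ConnSum e₁ e₂), IsOpenEmbedding f ∧ fromLeft e₁ e₂ a ∈ range f := by
    intro X Y _ _ e₁ e₂ _ _ _ he₁ he₂ a
    by_cases ha : a.1 ∈ inside e₁
    · obtain ⟨v, -, hv⟩ := ha
      have hv0 : v ≠ 0 := fun h => a.2 ⟨v, by simp [h], hv⟩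
      exact ⟨PuncturedE3, _, isOpen_ne.stronglyLocallyContractibleSpace, _,
        isOpenEmbedding_neck he₁ he₂, ⟨v, hv0⟩, (neck_eq_fromLeft he₁ he₂).2 hv⟩
    · exact ⟨_, _, (isClosed_inside he₁).isOpen_compl.stronglyLocallyContractibleSpace, _,
        isOpenEmbedding_interior he₁ he₂, ⟨a.1, ha⟩, rfl⟩
  refine stronglyLocallyContractibleSpace_of_openEmbeddings
    (ConnSum.forall.2 ⟨key he₁ he₂, fun b => ?_⟩)
  obtain ⟨Z, _, h, f, hf, z, hz⟩ := key he₂ he₁ b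
  exact ⟨Z, _, h, swap e₂ e₁ ∘ f, (swapHomeo e₂ e₁).isOpenEmbedding.comp hf, z,
    by simp only [Function.comp_apply, hz, swap_fromLeft]⟩

end ConnSum
end LensCover

/-! ### Extension of cocycles by zero -/

section Extension

variable {X A : Type*} [TopologicalSpace X] [AddCommGroup A]

/-- A closed set with acyclic frontier in an acyclic space is acyclic. -/
theorem AcyclicOn.of_univ {P B : Set X} (hP : IsClosed P) (hint : ∀ x ∈ P, x ∉ B → P ∈ 𝓝 x)
    (hBP : B ⊆ P) (hB : AcyclicOn A B) (h : AcyclicOn A (univ : Set X)) : AcyclicOn A P := by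
  classical
  intro d hd
  obtain ⟨K, hK⟩ := hB d (hd.mono hBP)
  -- Subtracting the increments of `K` makes the cocycle vanish between nearby points of `B`, so its
  -- extension by zero is still a cocycle. The values of `K` off `B` are arbitrary.
  let D : X → X → A := fun x z => if x ∈ P ∧ z ∈ P then d x z - (K z - K x) else 0
  have hD : CocycleOn univ D := by
    intro x _
    simp only [nhdsWithin_univ]
    by_cases hx : x ∈ P
    · have h1 := hd x hx
      simp only [eventually_nhdsWithin_iff] at h1
      -- The condition could fail only for `y` in `P` with points `z` outside `P` arbitrarily close;
      -- for such `y` the term `D x y` vanishes.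
      have h2 : ∀ᶠ y in 𝓝 x, y ∈ P → P ∈ 𝓝 y ∨ D x y = 0 := by
        by_cases hxB : x ∈ B
        · filter_upwards [eventually_nhdsWithin_iff.1 (hK x hxB)] with y hy hyP
          by_cases hyB : y ∈ B
          · exact Or.inr (by simp [D, hx, hyP, hy hyB])
          · exact Or.inl (hint y hyP hyB)
        · filter_upwards [eventually_mem_nhds_iff.2 (hint x hx hxB)] with y hy _
          exact Or.inl hy
      filter_upwards [h1, h2] with y hy hy'
      by_cases hyP : y ∈ P
      · have h3 : ∀ᶠ z in 𝓝 y, z ∈ P ∨ D x y = 0 := by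
          rcases hy' hyP with h3 | h3
          · filter_upwards [h3] with z hz using Or.inl hz
          · exact Eventually.of_forall fun _ => Or.inr h3
        filter_upwards [hy hyP, h3] with z hz hz'
        by_cases hzP : z ∈ P
        · simp only [D, hx, hyP, hzP, and_self, if_true, hz hzP]
          abel
        · rw [hz'.resolve_left hzP]
          simp [D, hzP]
      · filter_upwards [hP.isOpen_compl.mem_nhds hyP] with z hz
        simp [D, hyP, show z ∉ P from hz]
    · filter_upwards [hP.isOpen_compl.mem_nhds hx] with y hy
      simp [D, hx, show y ∉ P from hy]
  obtain ⟨G, hG⟩ := h D hD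
  refine ⟨fun x => G x + K x, fun x hx => ?_⟩
  filter_upwards [(hG.mono (subset_univ P)) x hx, self_mem_nhdsWithin] with z hz hzP
  simp only [D, hx, hzP, and_self, if_true] at hz
  rw [← sub_eq_zero] at hz ⊢
  rw [← hz]
  abel

theorem AcyclicOn.prod_discrete {ι Y : Type*} [TopologicalSpace ι] [DiscreteTopology ι]
    [TopologicalSpace Y] {Q : Set Y} (h : AcyclicOn A Q) :
    AcyclicOn A (univ ×ˢ Q : Set (ι × Y)) := by
  intro d hd
  have h1 : ∀ i, ∃ G, PrimitiveOn Q (pullDiff (Prod.mk i) d) G := fun i =>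
    h _ (hd.pull (by fun_prop) fun y hy => ⟨mem_univ _, hy⟩)
  choose G hG using h1
  refine ⟨fun x => G x.1 x.2, fun x hx => ?_⟩
  obtain ⟨i, y⟩ := x
  rw [nhdsWithin_prod_eq, nhdsWithin_univ, nhds_discrete, pure_prod, eventually_map]
  exact hG i y hx.2

end Extension

namespace LensCover

/-! ### Lifting the removed ball to a quotient covering -/

section Preimage

variable {X W Γ A : Type} [TopologicalSpace X] [TopologicalSpace W] [Group Γ] [MulAction Γ W]
  [AddCommGroup A] {h : W → X} {e : E3 → X}

/-- The simply connected space `E3` lifts to `W`, and the translates of a lift under the free action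
are disjoint. The preimage of the sphere is thus a disjoint union of two-spheres indexed by `Γ`. -/
theorem acyclicOn_preimage_bdry (hh : IsQuotientCoveringMap h Γ) (he : IsOpenEmbedding e) :
    AcyclicOn A (h ⁻¹' bdry e) := by
  have := hh.isCancelSMul
  have := hh.toContinuousConstSMul
  have hcov := hh.isCoveringMap
  obtain ⟨w, hw⟩ := hh.surjective (e 0)
  obtain ⟨l, ⟨-, hl⟩, -⟩ := hcov.existsUnique_continuousMap_lifts ⟨e, he.continuous⟩ 0 w hw
  have hl' : ∀ v, h (l v) = e v := fun v => congrFun hl v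
  have hlo : IsOpenMap l := by
    refine (IsLocalHomeomorph.of_comp (f := l) (g := h) ?_ hcov.isLocalHomeomorph l.continuous).isOpenMap
    rw [show h ∘ l = e from funext hl']
    exact he.isLocalHomeomorph
  let _ : TopologicalSpace Γ := ⊥
  have : DiscreteTopology Γ := ⟨rfl⟩
  let Φ : Γ × E3 → W := fun x => x.1 • l x.2
  have hΦc : Continuous Φ :=
    continuous_prod_of_discrete_left.2 fun γ => (continuous_const_smul γ).comp l.continuous
  have hΦ : IsOpenEmbedding Φ := by
    refine .of_continuous_injective_isOpenMap hΦc ?_ ?_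
    · rintro ⟨γ, v⟩ ⟨γ', v'⟩ hvv
      have h1 := congrArg h (show γ • l v = γ' • l v' from hvv)
      rw [hh.map_smul, hh.map_smul, hl', hl'] at h1
      obtain rfl := he.injective h1
      exact Prod.ext (IsCancelSMul.right_cancel _ _ _ hvv) rfl
    · rw [isOpenMap_iff_nhds_le]
      rintro ⟨γ, v⟩
      rw [nhds_prod_eq, nhds_discrete Γ, pure_prod, Filter.map_map]
      exact isOpenMap_iff_nhds_le.1 ((isOpenMap_smul γ).comp hlo) v
  convert ((AcyclicOn.of_subtype (acyclicOn_sphere (E := E3) (by simp))).prod_discrete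
    (ι := Γ)).image hΦ.isEmbedding using 1
  ext w
  constructor
  · rintro ⟨v, hv, hvw⟩
    rw [← hl', eq_comm, hh.apply_eq_iff_mem_orbit] at hvw
    obtain ⟨γ, hγ⟩ := hvw
    exact ⟨(γ, v), ⟨mem_univ _, hv⟩, hγ⟩
  · rintro ⟨⟨γ, v⟩, ⟨-, hv⟩, rfl⟩
    exact ⟨v, hv, by rw [← hl', hh.map_smul]⟩

/-- What remains of `W` after removal of the lifted balls is closed, and its frontier lies in a
union of acyclic spheres. -/
theorem acyclicOn_preimage_outside [T2Space X] (hh : IsQuotientCoveringMap h Γ)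
    (he : IsOpenEmbedding e) (hW : AcyclicOn A (univ : Set W)) :
    AcyclicOn A (h ⁻¹' outside e) := by
  refine AcyclicOn.of_univ ((isClosed_outside he).preimage hh.continuous) (B := h ⁻¹' bdry e)
    ?_ (preimage_mono (bdry_subset_outside he)) (acyclicOn_preimage_bdry hh he) hW
  intro x hx hxB
  refine hh.continuous.continuousAt (outside_mem_nhds he fun hi => hxB ?_)
  exact (outside_inter_inside he).subset ⟨hx, hi⟩

end Preimage

/-! ### Transfer along a finite covering -/

section Average

variable {X W M E Γ B : Type} [TopologicalSpace X] [TopologicalSpace W] [TopologicalSpace M]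
  [TopologicalSpace E] [Group Γ] [MulAction Γ W] [AddCommGroup B] {h : W → X}

/-- Transfer along a finite covering: rational cocycles are exact on the part of `E` over `Q` if
they are exact on the preimage of the corresponding set in `W`. -/
theorem acyclicOn_preimage_of_finite_cover [Finite Γ] (hh : IsQuotientCoveringMap h Γ) {J : X → M}
    {K : M → X} {P : Set X} {Q : Set M} (hJ : ContinuousOn J P) (hJm : MapsTo J P Q)
    (hK : ContinuousOn K Q) (hKm : MapsTo K Q P) (hJK : ∀ m ∈ Q, J (K m) = m)
    {r : M → M → B} {π : C(E, M)} {θ : E → B} (L : Labelling r π θ) {R : W → B}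
    (hR : PrimitiveOn (h ⁻¹' P) (pullDiff (J ∘ h) r) R)
    (hac : AcyclicOn ℚ (h ⁻¹' P)) : AcyclicOn ℚ (π ⁻¹' Q) := by
  have := hh.toContinuousConstSMul
  have := Fintype.ofFinite Γ
  intro d hd
  have hJh : ContinuousOn (J ∘ h) (h ⁻¹' P) :=
    hJ.comp hh.continuous.continuousOn (mapsTo_preimage h P)
  -- The pullback of the cover to `h ⁻¹' P` is trivialized by `R`; `F c` is its sheet number `c`.
  let F : B → W → E := fun c y => L.pt ((J ∘ h) y) (R y + c)
  have hF : ∀ c, ContinuousOn (F c) (h ⁻¹' P) := L.continuousOn_pt hJh hR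
  have hFm : ∀ c, MapsTo (F c) (h ⁻¹' P) (π ⁻¹' Q) := fun c y hy => by
    simp only [mem_preimage, F, L.π_pt]
    exact hJm hy
  have h1 : ∀ c, ∃ G, PrimitiveOn (h ⁻¹' P) (pullDiff (F c) d) G := fun c =>
    hac _ (hd.pull (hF c) (hFm c))
  choose G hG using h1
  -- For `w` over `K (π x)` the sheet that takes `w` to `x` has number `θ x - R w`.
  let g : E → W → ℚ := fun x w => G (θ x - R w) w
  obtain ⟨τ, hτ⟩ := hh.surjective.hasRightInverse
  let S : E → ℚ := fun x => ∑ γ : Γ, g x (γ • τ (K (π x)))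
  have hn : (Fintype.card Γ : ℚ) ≠ 0 := by exact_mod_cast Fintype.card_ne_zero
  refine ⟨fun x => (Fintype.card Γ : ℚ)⁻¹ * S x, fun x hx => ?_⟩
  -- The section `τ` need not be continuous. The sum over the whole fibre does not depend on the
  -- section, so near `K (π x)` a continuous one may replace it.
  obtain ⟨σ, hσx, hσ⟩ : ∃ σ : X → W, (ContinuousAt σ (K (π x))) ∧
      ∀ᶠ m in 𝓝 (K (π x)), h (σ m) = m := by
    obtain ⟨f, hf, hfh⟩ := hh.isCoveringMap.isLocalHomeomorph (τ (K (π x)))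
    have hm : K (π x) ∈ f.target := by
      rw [← hτ (K (π x)), hfh]
      exact f.map_source hf
    refine ⟨f.symm, f.continuousAt_symm hm, ?_⟩
    filter_upwards [f.open_target.mem_nhds hm] with m hm'
    rw [hfh]
    exact f.right_inv hm'
  have hKπ : ContinuousWithinAt (fun x => K (π x)) (π ⁻¹' Q) x :=
    (hK (π x) hx).comp π.continuous.continuousWithinAt (mapsTo_preimage _ _)
  have hσ' : ∀ᶠ z in 𝓝[π ⁻¹' Q] x, h (σ (K (π z))) = K (π z) := hKπ.eventually hσ
  have hS : ∀ z, h (σ (K (π z))) = K (π z) → S z = ∑ γ : Γ, g z (γ • σ (K (π z))) := by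
    intro z hz
    obtain ⟨δ, hδ⟩ := hh.apply_eq_iff_mem_orbit.1 ((hτ (K (π z))).trans hz.symm)
    change δ • σ (K (π z)) = τ (K (π z)) at hδ
    simp only [S, ← hδ, smul_smul]
    exact Fintype.sum_equiv (Equiv.mulRight δ) _ _ fun γ => rfl
  have key : ∀ γ : Γ, ∀ᶠ z in 𝓝[π ⁻¹' Q] x,
      d x z = g z (γ • σ (K (π z))) - g x (γ • σ (K (π x))) := by
    intro γ
    let u : E → W := fun z => γ • σ (K (π z))
    have hu : ContinuousWithinAt u (π ⁻¹' Q) x :=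
      (continuous_const_smul γ).continuousAt.tendsto.comp (hσx.tendsto.comp hKπ)
    have hum : ∀ᶠ z in 𝓝[π ⁻¹' Q] x, z ∈ π ⁻¹' Q ∧ h (u z) = K (π z) := by
      filter_upwards [hσ', self_mem_nhdsWithin] with z hz hzQ
      exact ⟨hzQ, by rw [hh.map_smul, hz]⟩
    have hux : h (u x) = K (π x) := (hum.self_of_nhdsWithin hx).2
    have hJhu : ∀ z, z ∈ π ⁻¹' Q → h (u z) = K (π z) → J (h (u z)) = π z := fun z hz hz' => by
      rw [hz', hJK _ hz]
    have hxP : u x ∈ h ⁻¹' P := by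
      rw [mem_preimage, hux]
      exact hKm hx
    have hut : Tendsto u (𝓝[π ⁻¹' Q] x) (𝓝[h ⁻¹' P] u x) := by
      refine tendsto_nhdsWithin_iff.2 ⟨hu, ?_⟩
      filter_upwards [hum] with z hz
      rw [mem_preimage, hz.2]
      exact hKm hz.1
    let c := θ x - R (u x)
    have hθ := (L.primitive.mono (subset_univ (π ⁻¹' Q))) x hx
    have hFu : ∀ z, z ∈ π ⁻¹' Q → h (u z) = K (π z) → θ z - R (u z) = c → F c (u z) = z := by
      intro z hz hz' hc
      simp only [F, Function.comp_apply, hJhu z hz hz']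
      rw [← hc, add_sub_cancel, L.pt_eq]
    filter_upwards [hθ, hut.eventually (hR _ hxP), hum, hut.eventually (hG c _ hxP)]
      with z h1 h2 h3 h4
    -- The functions `θ` and `R ∘ u` change by the same values of `r`, so the sheet number stays
    -- constant and one primitive `G c` serves for all `z` near `x`.
    have hc : θ z - R (u z) = c := by
      simp only [pullDiff, Function.comp_apply, hJhu z h3.1 h3.2, hJhu x hx hux] at h1 h2
      have h5 : θ z - θ x = R (u z) - R (u x) := h1.symm.trans h2
      rw [sub_eq_sub_iff_sub_eq_sub] at h5
      exact h5
    simp only [pullDiff, hFu z h3.1 h3.2 hc, hFu x hx hux rfl] at h4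
    rw [h4]
    simp only [g, ← hc]
    rw [show θ x - R (γ • σ (K (π x))) = c from rfl, ← hc]
  filter_upwards [hσ', eventually_all.2 key] with z hz hz'
  rw [hS z hz, hS x (hσ'.self_of_nhdsWithin hx), ← mul_sub, ← Finset.sum_sub_distrib,
    ← Finset.sum_congr rfl fun γ _ => hz' γ, Finset.sum_const, Finset.card_univ, nsmul_eq_mul]
  field_simp

end Average

end LensCover

namespace LensCover

/-! ### One side of the connected sum -/

section Side

variable {X M B : Type} [TopologicalSpace X] [TopologicalSpace M] [AddCommGroup B] {e : E3 → X}

/-- Replaces `j` and its inverse by total functions between the ambient spaces, as the transfer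
requires; only their values on `outside e` and `range j` matter. -/
theorem exists_extension_and_inverse [Nonempty (Punctured e)] {j : Punctured e → M}
    (hj : IsEmbedding j) : ∃ (J : X → M) (K : M → X), ContinuousOn J (outside e) ∧
      (∀ a : Punctured e, J a = j a) ∧ ContinuousOn K (range j) ∧
      ∀ a : Punctured e, K (j a) = a := by
  classical
  obtain ⟨a₀⟩ := ‹Nonempty (Punctured e)›
  have hJ : ∀ a : Punctured e, (if h : a.1 ∈ outside e then j ⟨a, h⟩ else j a₀) = j a :=
    fun a => dif_pos a.2
  refine ⟨fun x => if h : x ∈ outside e then j ⟨x, h⟩ else j a₀,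
    fun m => (Function.invFun j m).1, ?_, hJ, ?_, fun a => ?_⟩
  · rw [continuousOn_iff_continuous_domRestrict]
    exact hj.continuous.congr fun a => (hJ a).symm
  · refine continuous_subtype_val.comp_continuousOn hj.continuousOn_invFun
  · exact congrArg Subtype.val (Function.leftInverse_invFun hj.injective a)

theorem charOf_sub {d d' : X → X → B} (hd : CocycleOn univ d)
    (hd' : CocycleOn univ d') :
    charOf (hd.sub hd') = charOf hd - charOf hd' := by
  have h1 : CocycleOn univ (fun x z => d x z - d' x z + d' x z) := by simpa using hd
  have h2 := charOf_add (hd.sub hd') hd' h1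
  have h3 : charOf h1 = charOf hd := by
    congr 1
    funext x z
    simp
  rw [← h3, h2, add_sub_cancel_right]

theorem exists_primitive_sub_of_charOf_eq [PathConnectedSpace X] [LocallyPathConnectedSpace X]
    {d d' : X → X → B} (hd : CocycleOn univ d) (hd' : CocycleOn univ d')
    (h : charOf hd = charOf hd') : ∃ N, PrimitiveOn univ (fun x z => d x z - d' x z) N := by
  exact exists_primitive_of_charOf_eq_zero (hd.sub hd') (by rw [charOf_sub hd hd', h, sub_self])

variable [T2Space X] [PathConnectedSpace X] [StronglyLocallyContractibleSpace X]
  (he : IsOpenEmbedding e) {j : C(Punctured e, M)} {r : M → M → B} (hr : CocycleOn univ r)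
  {χ : H1 X →+ B}
  (hχ : ∀ u : H1 (Punctured e), charOf hr (H1map j u) = χ (H1map (puncturedIncl e) u))

include he hχ

/-- If the character is trivial on the summand, then the cocycle is exact on that side. -/
theorem exists_primitive_range (hj : IsEmbedding j) (hχ0 : χ = 0) :
    ∃ G, PrimitiveOn (range j) r G := by
  have := locallyPathConnectedSpace_punctured he
  have := pathConnectedSpace_punctured he
  have hd : CocycleOn univ (pullDiff j r) := hr.pull j.continuous.continuousOn (mapsTo_univ _ _)
  obtain ⟨G, hG⟩ := exists_primitive_of_charOf_eq_zero hd (by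
    ext u
    rw [charOf_pull hr j hd, hχ, hχ0]
    rfl)
  refine ⟨G ∘ Function.invFun j, (hG.pull (Q := range j) hj.continuousOn_invFun
    (mapsTo_univ _ _)).congr_diff ?_⟩
  rintro _ ⟨a, rfl⟩
  filter_upwards [self_mem_nhdsWithin] with z hz
  obtain ⟨b, rfl⟩ := hz
  simp [pullDiff, Function.leftInverse_invFun hj.injective _]

/-- If the character is nontrivial on the summand, then there is a loop on that side around which
the cocycle has a nonzero integral. -/
theorem exists_loop (hχ0 : χ ≠ 0) :
    ∃ (a : Punctured e) (α : Path a a), pathPeriod (pullDiff j r) α.toContinuousMap ≠ 0 := by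
  have := locallyPathConnectedSpace_punctured he
  have := pathConnectedSpace_punctured he
  have hd : CocycleOn univ (pullDiff j r) := hr.pull j.continuous.continuousOn (mapsTo_univ _ _)
  by_contra! hno
  obtain ⟨G, hG⟩ := exists_primitive_of_loops hd hno
  -- Without such a loop, a cocycle `t` on `X` that represents `χ` is exact off the ball, hence on
  -- all of `X`, and `χ = 0`.
  obtain ⟨t, ht, htχ⟩ := exists_charOf_eq χ
  have hd' : CocycleOn univ (pullDiff (puncturedIncl e) t) :=
    ht.pull (puncturedIncl e).continuous.continuousOn (mapsTo_univ _ _)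
  obtain ⟨N, hN⟩ := exists_primitive_of_charOf_eq_zero hd' (by
    ext u
    rw [charOf_pull ht _ hd', htχ, ← hχ, ← charOf_pull hr j hd, charOf_eq_zero hG])
  obtain ⟨N', hN', -⟩ := hN.of_subtype
  obtain ⟨F, hF⟩ := exists_primitive_of_outside he ht hN'
  exact hχ0 (htχ ▸ charOf_eq_zero hF ht)

/-- On the punctured space `r` and a cocycle `t` representing `χ` have the same character, so they
differ by an exact cocycle. As `t` becomes exact on `W`, so does `r` on `h ⁻¹' outside e`, which is
what the transfer needs. -/
theorem acyclicOn_preimage_range {W Γ E : Type} [TopologicalSpace W] [TopologicalSpace E]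
    [Group Γ] [Finite Γ] [MulAction Γ W]
    {h : W → X} (hh : IsQuotientCoveringMap h Γ) (hW : AcyclicOn B (univ : Set W))
    (hWℚ : AcyclicOn ℚ (univ : Set W)) (hj : IsEmbedding j) {π : C(E, M)} {θ : E → B}
    (L : Labelling r π θ) : AcyclicOn ℚ (π ⁻¹' range j) := by
  have := locallyPathConnectedSpace_punctured he
  have := pathConnectedSpace_punctured he
  obtain ⟨J, K, hJ, hJj, hK, hKj⟩ := exists_extension_and_inverse hj
  have hd : CocycleOn univ (pullDiff j r) := hr.pull j.continuous.continuousOn (mapsTo_univ _ _)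
  obtain ⟨t, ht, htχ⟩ := exists_charOf_eq χ
  have hd' : CocycleOn univ (pullDiff (puncturedIncl e) t) :=
    ht.pull (puncturedIncl e).continuous.continuousOn (mapsTo_univ _ _)
  obtain ⟨N, hN⟩ := exists_primitive_sub_of_charOf_eq hd hd' (by
    ext u
    rw [charOf_pull ht _ hd', htχ, ← hχ, ← charOf_pull hr j hd])
  have hN2 : PrimitiveOn univ (pullDiff (Subtype.val : Punctured e → X)
      (fun x z => r (J x) (J z) - t x z)) N := by
    convert hN using 3 with x z
    simp only [pullDiff, hJj]
    rfl
  obtain ⟨N', hN', -⟩ := hN2.of_subtype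
  obtain ⟨R, hR⟩ := hW _ (ht.pull hh.continuous.continuousOn (mapsTo_univ _ _))
  have hR' : PrimitiveOn (h ⁻¹' outside e) (pullDiff (J ∘ h) r) (fun y => N' (h y) + R y) := by
    convert (hN'.pull hh.continuous.continuousOn (mapsTo_preimage h _)).add
      (hR.mono (subset_univ _)) using 3
    · simp [pullDiff]
    · rfl
  refine acyclicOn_preimage_of_finite_cover hh hJ ?_ hK ?_ ?_ L hR'
    (acyclicOn_preimage_outside hh he hWℚ)
  · exact fun x hx => ⟨⟨x, hx⟩, (hJj ⟨x, hx⟩).symm⟩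
  · rintro _ ⟨a, rfl⟩
    rw [hKj]
    exact a.2
  · rintro _ ⟨a, rfl⟩
    rw [hKj, hJj]

end Side

/-! ### Connectedness of one side of the cover -/

section Connected

variable {A₀ M E : Type} [TopologicalSpace A₀] [PathConnectedSpace A₀] [TopologicalSpace M]
  [TopologicalSpace E] {p : ℕ} [Fact p.Prime] {r : M → M → ZMod p} {π : C(E, M)} {θ : E → ZMod p}

/-- The part of the covering space over a path connected set is connected if the labels change
along some loop. -/
theorem Labelling.isPreconnected_preimage (L : Labelling r π θ) (hr : CocycleOn univ r)
    (j : C(A₀, M)) {a₀ : A₀} (α : Path a₀ a₀)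
    (hα : pathPeriod (pullDiff j r) α.toContinuousMap ≠ 0) :
    IsPreconnected (π ⁻¹' range j) := by
  refine isPreconnected_of_forall_constant fun f hf => ?_
  have hd : CocycleOn univ (pullDiff j r) := hr.pull j.continuous.continuousOn (mapsTo_univ _ _)
  -- Lifting `β` joins these two points inside the preimage: the label moves by the integral along
  -- `β`.
  have key : ∀ {a b : A₀} (β : Path a b) (c : ZMod p),
      f (L.pt (j a) c) = f (L.pt (j b) (c + pathPeriod (pullDiff j r) β.toContinuousMap)) := by
    intro a b β c
    obtain ⟨R, hR⟩ := exists_primitive_path hd β.toContinuousMap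
    have h1 := L.continuousOn_pt (h := fun t => j (β t)) (R := R) (by fun_prop) hR (c - R 0)
    have h2 : ContinuousOn (fun t => f (L.pt (j (β t)) (R t + (c - R 0)))) univ :=
      hf.comp h1 fun t _ => by
        rw [mem_preimage, L.π_pt]
        exact mem_range_self _
    have h3 := isPreconnected_univ.constant h2 (mem_univ 0) (mem_univ 1)
    rw [pathPeriod_eq hR]
    simp only [β.source, β.target] at h3
    convert h3 using 3 <;> ring
  set k := pathPeriod (pullDiff j r) α.toContinuousMap with hk
  have h0 : ∀ (n : ℕ), f (L.pt (j a₀) 0) = f (L.pt (j a₀) (n * k)) := by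
    intro n
    induction n with
    | zero => simp
    | succ n ih =>
      rw [ih, key α, ← hk]
      congr 2
      push_cast
      ring
  -- The multiples of `k ≠ 0` exhaust `ZMod p`, so `f` is constant on the fibre over `j a₀`.
  have h1 : ∀ c, f (L.pt (j a₀) c) = f (L.pt (j a₀) 0) := by
    intro c
    rw [h0 (c / k).val, ZMod.natCast_zmod_val, div_mul_cancel₀ c hα]
  have h2 : ∀ x ∈ π ⁻¹' range j, f x = f (L.pt (j a₀) 0) := by
    rintro x ⟨a, ha⟩
    rw [← L.pt_eq x, ← ha, key (PathConnectedSpace.somePath a a₀), h1]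
  intro x hx y hy
  rw [h2 x hx, h2 y hy]

end Connected

end LensCover

/-! ### The connecting cocycle of a closed cover -/

section Connecting

variable {E A : Type*} [TopologicalSpace E] [AddCommGroup A] {P Q : Set E}

theorem mem_nhds_of_isClosed_cover (hQ : IsClosed Q) (hPQ : P ∪ Q = univ) {x : E} (hx : x ∉ Q) :
    P ∈ 𝓝 x := by
  filter_upwards [hQ.isOpen_compl.mem_nhds hx] with y hy
  exact ((hPQ.symm ▸ mem_univ y : y ∈ P ∪ Q)).resolve_right hy

theorem CocycleOn.of_isClosed_cover (hP : IsClosed P) (hQ : IsClosed Q) (hPQ : P ∪ Q = univ)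
    {d : E → E → A} (h1 : CocycleOn P d) (h2 : CocycleOn Q d) : CocycleOn univ d := by
  have key : ∀ {P Q : Set E}, IsClosed P → IsClosed Q → P ∪ Q = univ → CocycleOn P d → ∀ x,
      ∀ᶠ y in 𝓝 x, y ∈ P → ∀ᶠ z in 𝓝 y, z ∈ P → d x z = d x y + d y z := by
    intro P Q hP hQ hPQ h x
    by_cases hx : x ∈ P
    · simpa only [eventually_nhdsWithin_iff] using h x hx
    · filter_upwards [hP.isOpen_compl.mem_nhds hx] with y hy hy'
      exact (hy hy').elim
  intro x _
  simp only [nhdsWithin_univ]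
  filter_upwards [key hP hQ hPQ h1 x, key hQ hP (union_comm P Q ▸ hPQ) h2 x] with y hy1 hy2
  by_cases hyP : y ∈ P
  · by_cases hyQ : y ∈ Q
    · filter_upwards [hy1 hyP, hy2 hyQ] with z hz1 hz2
      exact ((hPQ.symm ▸ mem_univ z : z ∈ P ∪ Q)).elim hz1 hz2
    · filter_upwards [hy1 hyP, mem_nhds_of_isClosed_cover hQ hPQ hyQ] with z hz1 hz2
      exact hz1 hz2
  · have hyQ := ((hPQ.symm ▸ mem_univ y : y ∈ P ∪ Q)).resolve_left hyP
    filter_upwards [hy2 hyQ, mem_nhds_of_isClosed_cover hP (union_comm P Q ▸ hPQ) hyP]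
      with z hz1 hz2
    exact hz1 hz2

open Classical in
/-- The cocycle that represents the image of `u` under the connecting homomorphism of the
Mayer–Vietoris sequence of the cover by `P` and `Q`. -/
noncomputable def connecting (P Q : Set E) (u : E → A) : E → E → A := fun x z =>
  if x ∈ P ∩ Q ∧ z ∉ P then u x else 0

theorem primitiveOn_connecting_left (P Q : Set E) (u : E → A) :
    PrimitiveOn P (connecting P Q u) 0 := by
  intro x _
  filter_upwards [self_mem_nhdsWithin] with z hz
  simp [connecting, hz]

-- Against the primitive `0` on `P`, this primitive differs by exactly `u` on `P ∩ Q`, as the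
-- connecting homomorphism demands.
open Classical in
theorem primitiveOn_connecting_right (hP : IsClosed P) {u : E → A} (hu : LocConstOn (P ∩ Q) u) :
    PrimitiveOn Q (connecting P Q u) (fun z => if z ∈ P then -u z else 0) := by
  intro x hx
  by_cases hxP : x ∈ P
  · filter_upwards [nhdsWithin_le_nhds (eventually_nhdsWithin_iff.1 (hu x ⟨hxP, hx⟩)),
      self_mem_nhdsWithin] with z hz hzQ
    by_cases hzP : z ∈ P
    · simp [connecting, hxP, hzP, hz ⟨hzP, hzQ⟩]
    · simp [connecting, hxP, hzP, hx]
  · filter_upwards [nhdsWithin_le_nhds (hP.isOpen_compl.mem_nhds hxP)] with z hz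
    simp [connecting, hxP, show z ∉ P from hz]

theorem cocycleOn_connecting (hP : IsClosed P) (hQ : IsClosed Q) (hPQ : P ∪ Q = univ) {u : E → A}
    (hu : LocConstOn (P ∩ Q) u) : CocycleOn univ (connecting P Q u) :=
  .of_isClosed_cover hP hQ hPQ (primitiveOn_connecting_left P Q u).cocycleOn
    (primitiveOn_connecting_right hP hu).cocycleOn

/-- Primitives on two closed sets that agree on the intersection give a primitive. -/
theorem PrimitiveOn.glue_of_isClosed (hP : IsClosed P) (hQ : IsClosed Q) (hPQ : P ∪ Q = univ)
    {d : E → E → A} {G K : E → A} (hG : PrimitiveOn P d G) (hK : PrimitiveOn Q d K)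
    (h : ∀ x ∈ P, x ∈ Q → G x = K x) : ∃ F, PrimitiveOn univ d F := by
  classical
  refine ⟨fun x => if x ∈ P then G x else K x, PrimitiveOn.glue hPQ
    (fun x hx => mem_nhds_of_isClosed_cover hQ hPQ hx)
    (fun x hx => mem_nhds_of_isClosed_cover hP (union_comm P Q ▸ hPQ) hx)
    (hG.congr fun x hx => (if_pos hx).symm) (hK.congr fun x hx => ?_)⟩
  by_cases hxP : x ∈ P
  · rw [if_pos hxP, h x hxP hx]
  · rw [if_neg hxP]

end Connecting

namespace LensCover

/-- Both numbers are the dimension of `ℚ ⊗ H`: the homomorphisms to `ℚ` form its dual, and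
localization keeps the rank. Finiteness makes a space and its dual equidimensional. -/
theorem rank_eq_finrank_hom {H : Type} [AddCommGroup H] [Module ℤ H] [Module.Finite ℚ (H →+ ℚ)] :
    Module.rank ℤ H = Module.finrank ℚ (H →+ ℚ) := by
  obtain rfl : ‹Module ℤ H› = AddCommGroup.toIntModule H := Subsingleton.elim _ _
  let φ : Module.Dual ℚ (TensorProduct ℤ ℚ H) ≃ₗ[ℚ] (H →+ ℚ) :=
    (LinearMap.liftBaseChangeEquiv ℚ (R := ℤ) (M := H) (N := ℚ)).symm.trans
      { (addMonoidHomLequivInt (A := H) (B := ℚ) ℚ).symm with }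
  have h1 : Module.Finite ℚ (Module.Dual ℚ (TensorProduct ℤ ℚ H)) := Module.Finite.equiv φ.symm
  have h2 : Module.Finite ℚ (TensorProduct ℤ ℚ H) := (Module.finite_dual_iff ℚ).1 h1
  rw [← φ.finrank_eq, Subspace.dual_finrank_eq, Module.finrank_eq_rank,
    IsFractionRing.rank_right_eq ℤ ℚ,
    ← IsLocalizedModule.rank_eq (nonZeroDivisors ℤ) le_rfl (TensorProduct.mk ℤ ℚ H 1)]
  congr 1

/-! ### The Mayer–Vietoris count of the first Betti number -/

section MayerVietoris

variable {E ι : Type} [TopologicalSpace E] {P Q : Set E} (hP : IsClosed P) (hQ : IsClosed Q)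
  (hPQ : P ∪ Q = univ) {κ : E → ι} (hκ : LocConstOn (P ∩ Q) κ)

/-- The connecting homomorphism on the locally constant functions of the form `c ∘ κ`. -/
noncomputable def connectingHom : (ι → ℚ) →ₗ[ℚ] (H1 E →+ ℚ) where
  toFun c := charOf (cocycleOn_connecting hP hQ hPQ (hκ.comp_left c))
  map_add' c c' := by
    have h := (cocycleOn_connecting hP hQ hPQ (hκ.comp_left c)).add
      (cocycleOn_connecting hP hQ hPQ (hκ.comp_left c'))
    rw [← charOf_add _ _ h]
    congr 1
    funext x z
    simp only [connecting, Pi.add_apply]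
    split_ifs <;> simp
  map_smul' a c := by
    have h0 : (fun x z => AddMonoidHom.mulLeft a (connecting P Q (fun x => c (κ x)) x z)) =
        connecting P Q (fun x => (a • c) (κ x)) := by
      funext x z
      simp only [connecting]
      split_ifs <;> simp
    have h : CocycleOn univ fun x z =>
        AddMonoidHom.mulLeft a (connecting P Q (fun x => c (κ x)) x z) :=
      h0 ▸ cocycleOn_connecting hP hQ hPQ (hκ.comp_left (a • c))
    have h2 := charOf_map (cocycleOn_connecting hP hQ hPQ (hκ.comp_left c))
      (AddMonoidHom.mulLeft a) h
    ext u
    refine Eq.trans ?_ (DFunLike.congr_fun h2 u)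
    congr 2
    exact h0.symm

theorem connectingHom_eq_zero {c : ι → ℚ} {G : E → ℚ}
    (h : PrimitiveOn univ (connecting P Q fun x => c (κ x)) G) :
    connectingHom hP hQ hPQ hκ c = 0 :=
  charOf_eq_zero h (cocycleOn_connecting hP hQ hPQ (hκ.comp_left c))

/-- A cocycle has primitives on `P` and on `Q`. Their difference is constant on each connected fibre
of `κ`, hence of the form `c ∘ κ` on `P ∩ Q`, and the cocycle is cohomologous to the connecting
cocycle of `c ∘ κ`. -/
theorem connectingHom_surjective [PathConnectedSpace E] [StronglyLocallyContractibleSpace E]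
    (hPa : AcyclicOn ℚ P) (hQa : AcyclicOn ℚ Q)
    (hne : ∀ k, ∃ x, x ∈ P ∩ Q ∧ κ x = k) (hfib : ∀ k, IsPreconnected {x | x ∈ P ∩ Q ∧ κ x = k}) :
    Function.Surjective (connectingHom hP hQ hPQ hκ) := by
  classical
  intro g
  obtain ⟨d, hd, rfl⟩ := exists_charOf_eq g
  obtain ⟨G, hG⟩ := hPa d (hd.mono (subset_univ _))
  obtain ⟨K, hK⟩ := hQa d (hd.mono (subset_univ _))
  choose y hy hyκ using hne
  let c : ι → ℚ := fun k => G (y k) - K (y k)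
  have hu : LocConstOn (P ∩ Q) fun x => G x - K x :=
    (hG.mono inter_subset_left).sub_locConstOn (hK.mono inter_subset_right)
  have hc : ∀ x ∈ P ∩ Q, c (κ x) = G x - K x := fun x hx =>
    (hu.mono fun _ h => h.1).eq_of_isPreconnected (hfib (κ x)) ⟨hy _, hyκ _⟩ ⟨hx, rfl⟩
  have hd' := cocycleOn_connecting hP hQ hPQ (hκ.comp_left c)
  refine ⟨c, ?_⟩
  obtain ⟨F, hF⟩ := PrimitiveOn.glue_of_isClosed hP hQ hPQ
    (hG.sub (primitiveOn_connecting_left P Q fun x => c (κ x)))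
    (hK.sub (primitiveOn_connecting_right hP (hκ.comp_left c))) fun x hx hx' => by
      simp [hx, hc x ⟨hx, hx'⟩]
  have h := charOf_eq_zero hF (hd.sub hd')
  rw [charOf_sub hd hd', sub_eq_zero] at h
  exact h.symm

/-- Exactness at `H⁰(P ∩ Q)`: when `κ` is locally constant on all of `P`, the primitive there may be
changed by `-c ∘ κ` to match the one on `Q`. -/
theorem connectingHom_eq_zero_of_left (h : LocConstOn P κ) (c : ι → ℚ) :
    connectingHom hP hQ hPQ hκ c = 0 := by
  classical
  obtain ⟨F, hF⟩ := PrimitiveOn.glue_of_isClosed hP hQ hPQ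
    ((primitiveOn_connecting_left P Q fun x => c (κ x)).add_locConstOn
      (h.comp_left fun k => -c k))
    (primitiveOn_connecting_right hP (hκ.comp_left c)) fun x hx hx' => by
      simp [hx]
  exact connectingHom_eq_zero hP hQ hPQ hκ hF

theorem connectingHom_eq_zero_of_right (h : LocConstOn Q κ) (c : ι → ℚ) :
    connectingHom hP hQ hPQ hκ c = 0 := by
  classical
  obtain ⟨F, hF⟩ := PrimitiveOn.glue_of_isClosed hP hQ hPQ
    (primitiveOn_connecting_left P Q fun x => c (κ x))
    ((primitiveOn_connecting_right hP (hκ.comp_left c)).add_locConstOn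
      (h.comp_left c)) fun x hx hx' => by
      simp [hx]
  exact connectingHom_eq_zero hP hQ hPQ hκ hF

theorem connectingHom_const (a : ℚ) : connectingHom hP hQ hPQ hκ (fun _ => a) = 0 := by
  classical
  obtain ⟨F, hF⟩ := PrimitiveOn.glue_of_isClosed hP hQ hPQ
    (primitiveOn_connecting_left P Q fun x => (fun _ : ι => a) (κ x))
    ((primitiveOn_connecting_right hP (hκ.comp_left fun _ : ι => a)).add_locConstOn
      (u := fun _ => a) fun _ _ => Eventually.of_forall fun _ => rfl) fun x hx hx' => by
      simp [hx]
  exact connectingHom_eq_zero hP hQ hPQ hκ hF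

/-- A global primitive differs from the given primitives on the connected sets `P` and `Q` by
constants, and those given primitives differ by `c ∘ κ` on the overlap. -/
theorem const_of_connectingHom_eq_zero [PathConnectedSpace E] [LocallyPathConnectedSpace E]
    (hPc : IsPreconnected P) (hQc : IsPreconnected Q)
    (hne : ∀ k, ∃ x, x ∈ P ∩ Q ∧ κ x = k) {c : ι → ℚ}
    (hc : connectingHom hP hQ hPQ hκ c = 0) (k l : ι) : c k = c l := by
  classical
  obtain ⟨F, hF⟩ := exists_primitive_of_charOf_eq_zero
    (cocycleOn_connecting hP hQ hPQ (hκ.comp_left c)) hc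
  have h1 := (hF.mono (subset_univ P)).sub_locConstOn
    (primitiveOn_connecting_left P Q fun x => c (κ x))
  have h2 := (hF.mono (subset_univ Q)).sub_locConstOn
    (primitiveOn_connecting_right hP (hκ.comp_left c))
  obtain ⟨x, hx, rfl⟩ := hne k
  obtain ⟨y, hy, rfl⟩ := hne l
  have h3 := h1.eq_of_isPreconnected hPc hx.1 hy.1
  have h4 := h2.eq_of_isPreconnected hQc hx.2 hy.2
  simp only [Pi.zero_apply, sub_zero, hx.1, hy.1, if_true] at h3 h4
  linarith

include hP hQ hPQ hκ

/-- With both sides connected the kernel of the surjection `connectingHom` is the line of constant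
functions, so rank–nullity gives the count. -/
theorem betti1_eq_of_isPreconnected [Fintype ι] [Nonempty ι] [PathConnectedSpace E]
    [StronglyLocallyContractibleSpace E]
    (hPa : AcyclicOn ℚ P) (hQa : AcyclicOn ℚ Q)
    (hne : ∀ k, ∃ x, x ∈ P ∩ Q ∧ κ x = k) (hfib : ∀ k, IsPreconnected {x | x ∈ P ∩ Q ∧ κ x = k})
    (hPc : IsPreconnected P) (hQc : IsPreconnected Q) :
    betti1 E = ((Fintype.card ι - 1 : ℕ) : Cardinal) := by
  have hs := connectingHom_surjective hP hQ hPQ hκ hPa hQa hne hfib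
  have := Module.Finite.of_surjective _ hs
  have hker : LinearMap.ker (connectingHom hP hQ hPQ hκ) =
      Submodule.span ℚ {(fun _ => 1 : ι → ℚ)} := by
    ext c
    rw [LinearMap.mem_ker, Submodule.mem_span_singleton]
    constructor
    · intro hc
      obtain ⟨k⟩ := ‹Nonempty ι›
      refine ⟨c k, funext fun l => ?_⟩
      simpa using const_of_connectingHom_eq_zero hP hQ hPQ hκ hPc hQc hne hc k l
    · rintro ⟨a, rfl⟩
      rw [map_smul, connectingHom_const, smul_zero]
  have hk : Module.finrank ℚ (LinearMap.ker (connectingHom hP hQ hPQ hκ)) = 1 := by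
    rw [hker]
    refine finrank_span_singleton fun h => ?_
    obtain ⟨k⟩ := ‹Nonempty ι›
    exact one_ne_zero (congrFun h k)
  have h1 := (connectingHom hP hQ hPQ hκ).finrank_range_add_finrank_ker
  rw [hk, LinearMap.range_eq_top.2 hs, finrank_top, Module.finrank_pi] at h1
  refine rank_eq_finrank_hom.trans ?_
  rw [← h1, Nat.add_sub_cancel]

theorem betti1_eq_zero_of_locConstOn [PathConnectedSpace E] [StronglyLocallyContractibleSpace E]
    (hPa : AcyclicOn ℚ P) (hQa : AcyclicOn ℚ Q)
    (hne : ∀ k, ∃ x, x ∈ P ∩ Q ∧ κ x = k) (hfib : ∀ k, IsPreconnected {x | x ∈ P ∩ Q ∧ κ x = k})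
    (h : LocConstOn P κ ∨ LocConstOn Q κ) : betti1 E = 0 := by
  have hs := connectingHom_surjective hP hQ hPQ hκ hPa hQa hne hfib
  have h0 : ∀ c, connectingHom hP hQ hPQ hκ c = 0 := fun c =>
    h.elim (fun h => connectingHom_eq_zero_of_left hP hQ hPQ hκ h c)
      fun h => connectingHom_eq_zero_of_right hP hQ hPQ hκ h c
  have : Subsingleton (H1 E →+ ℚ) := subsingleton_of_forall_eq 0 fun g => by
    obtain ⟨c, rfl⟩ := hs g
    exact h0 c
  refine rank_eq_finrank_hom.trans ?_
  rw [Module.finrank_zero_of_subsingleton, Nat.cast_zero]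

end MayerVietoris

end LensCover

namespace LensCover

/-! ### Sheets over a set on which the cocycle is exact -/

section Labels

variable {M E B : Type} [TopologicalSpace M] [TopologicalSpace E] [AddCommGroup B]
  {r : M → M → B} {π : C(E, M)} {θ : E → B} (L : Labelling r π θ) {R : M → B} {S : Set M}
include L

/-- Where `r` has a primitive `R`, the cover is trivial and `θ - R ∘ π` is the number of the sheet.
-/
theorem Labelling.locConstOn_sub (hR : PrimitiveOn S r R) :
    LocConstOn (π ⁻¹' S) fun x => θ x - R (π x) :=
  (L.primitive.mono (subset_univ _)).sub_locConstOn
    (hR.pull π.continuous.continuousOn (mapsTo_preimage π S))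

/-- Each sheet is the image of `S` under a continuous lift. -/
theorem Labelling.isPreconnected_fibre (hR : PrimitiveOn S r R) (hS : IsPreconnected S) (k : B) :
    IsPreconnected {x | x ∈ π ⁻¹' S ∧ θ x - R (π x) = k} := by
  convert hS.image _ (L.continuousOn_pt (h := id) continuousOn_id hR k) using 1
  ext x
  constructor
  · rintro ⟨hx, rfl⟩
    exact ⟨π x, hx, by simp only [id, add_sub_cancel, L.pt_eq]⟩
  · rintro ⟨m, hm, rfl⟩
    simp [L.π_pt, L.θ_pt, hm]

theorem Labelling.exists_mem_fibre (R : M → B) (hS : S.Nonempty) (k : B) :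
    ∃ x, x ∈ π ⁻¹' S ∧ θ x - R (π x) = k := by
  obtain ⟨m, hm⟩ := hS
  exact ⟨L.pt m (R m + k), by simpa [L.π_pt] using hm, by simp [L.π_pt, L.θ_pt]⟩

end Labels

/-! ### The gluing sphere as the intersection of the two pieces -/

section Neck

variable {X Y : Type} [TopologicalSpace X] [TopologicalSpace Y] {e₁ : E3 → X} {e₂ : E3 → Y}

/-- The sphere along which the summands are glued, as a map to the connected sum. -/
def ConnSum.neckSphere (he₁ : IsOpenEmbedding e₁) (v : Metric.sphere (0 : E3) 1) :
    ConnSum e₁ e₂ :=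
  fromLeft e₁ e₂ ⟨e₁ v, sphere_mem_outside he₁ (norm_eq_of_mem_sphere v)⟩

theorem ConnSum.isEmbedding_neckSphere [T2Space Y] (he₁ : IsOpenEmbedding e₁)
    (he₂ : IsOpenEmbedding e₂) : IsEmbedding (neckSphere (e₂ := e₂) he₁) :=
  (isClosedEmbedding_fromLeft he₁ he₂).isEmbedding.comp
    ((he₁.isEmbedding.comp IsEmbedding.subtypeVal).codRestrict _ _)

theorem ConnSum.range_neckSphere (he₁ : IsOpenEmbedding e₁) (he₂ : IsOpenEmbedding e₂) :
    range (neckSphere (e₂ := e₂) he₁) = range (fromLeft e₁ e₂) ∩ range (fromRight e₁ e₂) := by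
  ext m
  constructor
  · rintro ⟨v, rfl⟩
    have hv := norm_eq_of_mem_sphere v
    exact ⟨⟨_, rfl⟩, ⟨e₂ v, sphere_mem_outside he₂ hv⟩,
      ((fromLeft_eq_fromRight he₂).2 ⟨v, hv, rfl, rfl⟩).symm⟩
  · rintro ⟨⟨a, rfl⟩, b, hb⟩
    obtain ⟨v, hv, ha, -⟩ := (fromLeft_eq_fromRight he₂).1 hb.symm
    exact ⟨⟨v, by simpa using hv⟩, congrArg (fromLeft e₁ e₂) (Subtype.ext ha.symm)⟩

theorem ConnSum.isPreconnected_inter [T2Space Y] (he₁ : IsOpenEmbedding e₁)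
    (he₂ : IsOpenEmbedding e₂) :
    IsPreconnected (range (fromLeft e₁ e₂) ∩ range (fromRight e₁ e₂)) := by
  have : PreconnectedSpace (Metric.sphere (0 : E3) 1) :=
    isPreconnected_iff_preconnectedSpace.1 (isPreconnected_sphere one_lt_rank_E3 _ _)
  rw [← range_neckSphere he₁ he₂]
  exact isPreconnected_range (isEmbedding_neckSphere he₁ he₂).continuous

theorem ConnSum.nonempty_inter (he₁ : IsOpenEmbedding e₁) (he₂ : IsOpenEmbedding e₂) :
    (range (fromLeft e₁ e₂) ∩ range (fromRight e₁ e₂)).Nonempty := by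
  have := (NormedSpace.sphere_nonempty (x := (0 : E3)).2 zero_le_one).to_subtype
  rw [← range_neckSphere he₁ he₂]
  exact range_nonempty _

theorem ConnSum.acyclicOn_inter {A : Type} [AddCommGroup A] [T2Space Y]
    (he₁ : IsOpenEmbedding e₁) (he₂ : IsOpenEmbedding e₂) :
    AcyclicOn A (range (fromLeft e₁ e₂) ∩ range (fromRight e₁ e₂)) := by
  rw [← range_neckSphere he₁ he₂, ← image_univ]
  exact (acyclicOn_sphere (by simp)).image (isEmbedding_neckSphere he₁ he₂)

end Neck

end LensCover

/-! ### Assembly of the two cases -/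

open LensCover in
theorem mainTheorem7 (s : ℕ) (hs : 0 < s) (q : ℤ) (hsq : IsCoprime (s : ℤ) q)
    (p : ℕ) (hp : p.Prime)
    (e₁ e₂ : LensCover.E3 → LensCover.LensSpace s q)
    (he₁ : Topology.IsOpenEmbedding e₁) (he₂ : Topology.IsOpenEmbedding e₂)
    (ρ : LensCover.H1 (LensCover.LensSpace s q) × LensCover.H1 (LensCover.LensSpace s q) →+
      ZMod p)
    (hρ : Function.Surjective ρ)
    (ρ' : LensCover.H1 (LensCover.ConnSum e₁ e₂) →+ ZMod p)
    (hρ' : LensCover.IsCharacterOnConnSum e₁ e₂ ρ ρ')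
    (E : Type) [TopologicalSpace E] (π : C(E, LensCover.ConnSum e₁ e₂))
    (hπ : LensCover.IsAssociatedCovering ρ' π) :
    ((∃ a, ρ (a, 0) ≠ 0) → (∃ b, ρ (0, b) ≠ 0) → LensCover.betti1 E = ((p - 1 : ℕ) : Cardinal)) ∧
    ((∀ a, ρ (a, 0) = 0) ∨ (∀ b, ρ (0, b) = 0) → LensCover.betti1 E = 0) := by
  have : NeZero s := ⟨hs.ne'⟩
  have : Fact p.Prime := ⟨hp⟩
  have hW := isQuotientCoveringMap_lens s q hsq
  let _ := lensAction s q
  have := stronglyLocallyContractibleSpace_lens s q hsq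
  have := pathConnectedSpace_punctured he₁
  have := pathConnectedSpace_punctured he₂
  have := ConnSum.stronglyLocallyContractibleSpace he₁ he₂
  have := ConnSum.pathConnectedSpace he₁ he₂
  have := hπ.pathConnected
  have := hπ.isCoveringMap.isLocalHomeomorph.stronglyLocallyContractibleSpace_left
  have hj₁ := ConnSum.isClosedEmbedding_fromLeft he₁ he₂
  have hj₂ := ConnSum.isClosedEmbedding_fromRight he₁ he₂
  obtain ⟨r, hr, rfl⟩ := exists_charOf_eq ρ'
  let χ₁ := ρ.comp (AddMonoidHom.inl _ _)
  let χ₂ := ρ.comp (AddMonoidHom.inr _ _)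
  have hχ₁ : ∀ u : H1 (Punctured e₁), charOf hr (H1map (ConnSum.fromLeft e₁ e₂) u) =
    χ₁ (H1map (puncturedIncl e₁) u) := hρ'.1
  have hχ₂ : ∀ u : H1 (Punctured e₂), charOf hr (H1map (ConnSum.fromRight e₁ e₂) u) =
    χ₂ (H1map (puncturedIncl e₂) u) := hρ'.2
  have hχ : χ₁ ≠ 0 ∨ χ₂ ≠ 0 := by
    by_contra! h
    obtain ⟨⟨a, b⟩, hab⟩ := hρ 1
    have ha : ρ (a, 0) = 0 := DFunLike.congr_fun h.1 a
    have hb : ρ (0, b) = 0 := DFunLike.congr_fun h.2 b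
    rw [show ((a, b) : H1 (LensSpace s q) × H1 (LensSpace s q)) = (a, 0) + (0, b) by simp,
      map_add, ha, hb, add_zero] at hab
    exact zero_ne_one hab
  -- Surjectivity of `ρ` makes it nontrivial on some summand, which supplies the loop that the
  -- labelling needs.
  obtain ⟨θ, L⟩ : ∃ θ, Labelling r π θ := by
    rcases hχ with h | h
    · obtain ⟨a, α, hα⟩ := exists_loop he₁ hr hχ₁ h
      exact hπ.exists_labelling hr rfl (α.map (ConnSum.fromLeft e₁ e₂).continuous) hα
    · obtain ⟨a, α, hα⟩ := exists_loop he₂ hr hχ₂ h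
      exact hπ.exists_labelling hr rfl (α.map (ConnSum.fromRight e₁ e₂).continuous) hα
  have hP := hj₁.isClosed_range.preimage π.continuous
  have hQ := hj₂.isClosed_range.preimage π.continuous
  have hPQ : π ⁻¹' range (ConnSum.fromLeft e₁ e₂) ∪ π ⁻¹' range (ConnSum.fromRight e₁ e₂) =
      univ := by
    rw [← preimage_union, ConnSum.range_union_range, preimage_univ]
  have hPa := acyclicOn_preimage_range he₁ hr hχ₁ hW acyclicOn_S3 acyclicOn_S3 hj₁.isEmbedding L
  have hQa := acyclicOn_preimage_range he₂ hr hχ₂ hW acyclicOn_S3 acyclicOn_S3 hj₂.isEmbedding L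
  have hS := ConnSum.isPreconnected_inter he₁ he₂
  have hne := ConnSum.nonempty_inter he₁ he₂
  refine ⟨fun ⟨a, ha⟩ ⟨b, hb⟩ => ?_, fun h => ?_⟩
  · obtain ⟨_, α, hα⟩ := exists_loop he₁ hr hχ₁ fun h => ha (DFunLike.congr_fun h a)
    obtain ⟨_, β, hβ⟩ := exists_loop he₂ hr hχ₂ fun h => hb (DFunLike.congr_fun h b)
    -- The gluing sphere is acyclic, so `θ - R ∘ π` numbers the `p` spheres over it by `ZMod p`.
    obtain ⟨R, hR⟩ := ConnSum.acyclicOn_inter he₁ he₂ r (hr.mono (subset_univ _))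
    rw [betti1_eq_of_isPreconnected hP hQ hPQ (L.locConstOn_sub hR) hPa hQa
      (L.exists_mem_fibre R hne) (L.isPreconnected_fibre hR hS)
      (L.isPreconnected_preimage hr _ α hα) (L.isPreconnected_preimage hr _ β hβ), ZMod.card]
  -- Here `R` is a primitive on a whole side, so the numbering of the spheres extends over that side
  -- as a locally constant function.
  · obtain ⟨R, hR⟩ : ∃ R, PrimitiveOn (range (ConnSum.fromLeft e₁ e₂)) r R ∨
        PrimitiveOn (range (ConnSum.fromRight e₁ e₂)) r R := by
      rcases h with h | h
      · obtain ⟨R, hR⟩ := exists_primitive_range he₁ hr hχ₁ hj₁.isEmbedding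
          (AddMonoidHom.ext h)
        exact ⟨R, Or.inl hR⟩
      · obtain ⟨R, hR⟩ := exists_primitive_range he₂ hr hχ₂ hj₂.isEmbedding
          (AddMonoidHom.ext h)
        exact ⟨R, Or.inr hR⟩
    have hRS := hR.elim (fun h => h.mono inter_subset_left) fun h => h.mono inter_subset_right
    exact betti1_eq_zero_of_locConstOn hP hQ hPQ (L.locConstOn_sub hRS) hPa hQa
      (L.exists_mem_fibre R hne) (L.isPreconnected_fibre hRS hS)
      (hR.imp L.locConstOn_sub L.locConstOn_sub)
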